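/- Let $\ell > q > 1$ be real numbers and let $\eta_0:\mathbb{R}^2\to\mathbb{R}$ be a smooth radial function with $\chi_{B_{1/2}}\le \eta_0\le \chi_{B_1}$, where $B_r$ is the open disc of radius $r$ centred at $0$ and $\chi$ denotes a characteristic function. For $n\ge 2$ put $a_n=(n,0)\in\mathbb{R}^2$ and $r_n=e^{-n^q}$, and let $$K_0(x) = -\sum_{n=2}^\infty r_n^{-2}\, n^{-\ell}\, \eta_0\!\left(\frac{x-a_n}{r_n}\right),\qquad x\in\mathbb{R}^2 .$$ Then for every $0<\alpha<\frac{\ell-1}{2}$ there is a unique (classical, $C^2$) solution $u_\alpha$ of $$\Delta u + K_0(x)\, e^{2u} = 0 \quad\text{in } \mathbb{R}^2$$ that satisfies $$\int_{\mathbb{R}^2} K_0 e^{2u}\,dx = -2\alpha\pi \quad\text{and}\quad \int_{\mathbb{R}^2\setminus B_1} \big|\nabla (u-\alpha\ln|x|)\big|^2\,dx<+\infty$$ (the Cheng–Lin solution). Put $\alpha_*=\frac{\ell-q}{2}$. Then: (i) For every $0<\alpha<\alpha_*$ there is a constant $c_\alpha\in\mathbb{R}$ such that $u_\alpha(x)=\alpha\ln|x|+c_\alpha+o(1)$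 as $|x|\to\infty$. (ii) For $\alpha=\alpha_*$, $u_{\alpha_*}(x)=\alpha_*\ln|x|+O(1)$ as $|x|\to\infty$, but $u_{\alpha_*}(x)-\alpha_*\ln|x|$ does not converge to any constant as $|x|\to\infty$. (iii) For every $\alpha_*<\alpha<\frac{\ell-1}{2}$, the remainder $u_\alpha(x)-\alpha\ln|x|$ is unbounded at infinity, that is, it is not $O(1)$ as $|x|\to\infty$. -/

import Mathlib

open Filter Topology MeasureTheory Asymptotics

/-- The Euclidean plane `ℝ²`. -/
abbrev Plane : Type := EuclideanSpace ℝ (Fin 2)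

/-- `η` is a smooth radial cut-off function with `χ_{B_{1/2}} ≤ η ≤ χ_{B_1}`. -/
structure IsRadialCutoff (η : Plane → ℝ) : Prop where
  smooth : ContDiff ℝ ((⊤ : ℕ∞) : WithTop ℕ∞) η
  radial : ∀ x y : Plane, ‖x‖ = ‖y‖ → η x = η y
  lower : ∀ x : Plane, (Metric.ball (0 : Plane) (1 / 2)).indicator (fun _ => (1 : ℝ)) x ≤ η x
  upper : ∀ x : Plane, η x ≤ (Metric.ball (0 : Plane) 1).indicator (fun _ => (1 : ℝ)) x

/-- The centre `a_n = (n, 0)`. -/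
noncomputable def center (n : ℕ) : Plane := !₂[(n : ℝ), 0]

/-- The radius `r_n = exp (-n^q)`. -/
noncomputable def radius (q : ℝ) (n : ℕ) : ℝ := Real.exp (-((n : ℝ) ^ q))

/-- The term `r_n^{-2} n^{-ℓ} η((x - a_n) / r_n)`. -/
noncomputable def curvatureTerm (η : Plane → ℝ) (ℓ q : ℝ) (n : ℕ) (x : Plane) : ℝ :=
  (radius q n ^ 2)⁻¹ * (n : ℝ) ^ (-ℓ) * η ((radius q n)⁻¹ • (x - center n))

/-- The curvature `K₀(x) = -∑_{n ≥ 2} r_n^{-2} n^{-ℓ} η((x - a_n) / r_n)`. For a cut-off `η` and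
`q > 1` the terms have pairwise disjoint supports, so at each point at most one is nonzero. -/
noncomputable def exoticCurvature (η : Plane → ℝ) (ℓ q : ℝ) (x : Plane) : ℝ :=
  -∑' n : ℕ, curvatureTerm η ℓ q (n + 2) x

/-- The remainder `u(x) - α ln |x|`. -/
noncomputable def remainder (u : Plane → ℝ) (α : ℝ) (x : Plane) : ℝ :=
  u x - α * Real.log ‖x‖

/-- `u` is a (classical) solution of `Δu + K e^{2u} = 0` in `ℝ²`. -/
structure IsCurvatureSolution (K u : Plane → ℝ) : Prop where
  contDiff : ContDiff ℝ 2 u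
  equation : ∀ x : Plane, Laplacian.laplacian u x + K x * Real.exp (2 * u x) = 0

/-- `u` is a Cheng–Lin solution with parameter `α`: it solves `Δu + K e^{2u} = 0` in `ℝ²`, has
total curvature `∫ K e^{2u} = -2απ`, and `∇(u - α ln |x|)` is square integrable outside the
unit disc. -/
structure IsChengLinSolution (K : Plane → ℝ) (α : ℝ) (u : Plane → ℝ) : Prop where
  solution : IsCurvatureSolution K u
  integrable : Integrable (fun x => K x * Real.exp (2 * u x)) volume
  totalCurvature : ∫ x, K x * Real.exp (2 * u x) = -2 * α * Real.pi
  finiteEnergy :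
    IntegrableOn (fun x => ‖gradient (remainder u α) x‖ ^ 2) (Metric.ball (0 : Plane) 1)ᶜ volume

/-- `u(x) = α ln |x| + O(1)` as `|x| → ∞`. -/
def HasLogGrowth (u : Plane → ℝ) (α : ℝ) : Prop :=
  remainder u α =O[cocompact Plane] (fun _ => (1 : ℝ))

/-- `u(x) = α ln |x| + c + o(1)` as `|x| → ∞`, for some real constant `c`. -/
def HasUniformLogGrowth (u : Plane → ℝ) (α : ℝ) : Prop :=
  ∃ c : ℝ, Tendsto (remainder u α) (cocompact Plane) (𝓝 c)

/-! Put `k = -K₀ ≥ 0`, so that the equation reads `Δu = k e^{2u}`.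

Uniqueness. The difference `w` of two Cheng–Lin solutions has finite Dirichlet energy, because the
logarithms cancel, and `w Δw ≥ 0`, because the exponential is increasing. Test with `arctan w` times
a cut-off: in dimension two the cut-offs have bounded energy at every scale, while only the tail of
the energy of `w` is paired with them. Hence `∇w = 0`
(`gradient_eq_zero_of_arctan_mul_laplacian_nonneg`), and a point where `k > 0` forces `w = 0`. It is
thus enough to construct one solution and to study that one.

Existence. Seek `u = α logWeight + c - P`, where `P` is the potential of `g = k e^{2u}` for the
logarithmic kernel of the sphere and `g` has mass `2πα`. Relative to the measure `k (1 + |x|²)^α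
dx`, which is finite because `∑ n^{2α-ℓ} < ∞`, this says that the density is `e^{2(c-P)}`. That is
the Euler–Lagrange equation for entropy plus self-energy at fixed mass (`exists_gibbs_density`). The
energy is convex: `1 - chordalSq` is a Gram kernel and `-log (1 - t)` has nonnegative Taylor
coefficients. The entropy is uniformly convex for the Hellinger distance, so minimising sequences
converge strongly and lose no mass. Potential theory makes the solution `C²`, and Caccioppoli's
inequality gives the energy condition.

Asymptotics. Cut the kernel at distance `1/4`. The far part of the potential converges at infinity
by dominated convergence, so `u - α log |x|` is a constant plus `o(1)` minus `nearPotential g`. Near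
`a_n` the density is at most of order `n^{2α-ℓ} r_n^{-2}` on a disc of radius `r_n`, whose
logarithmic potential is at most of order `n^{2α-ℓ} log (1/r_n) = n^{2α-ℓ+q}`; if `u` has
logarithmic growth, this order is attained at `a_n`. The exponent is negative, zero or positive
according as `α` is below, at or above `α_*`. At `α_*` the near potential stays away from `0` along
`a_n` but vanishes along `-a_n`, so there is no limit. -/

section

open scoped ENNReal RealInnerProductSpace Gradient ContDiff
open InformationTheory (klFun klFun_apply klFun_nonneg klFun_zero convexOn_klFun continuous_klFun
  measurable_klFun)

/-! ### Calculus on the plane: Green's identity and cut-offs -/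

/-- The Laplacian of a `C²` function on the plane as a sum of iterated directional derivatives. -/
theorem laplacian_eq_sum_fderiv {w : Plane → ℝ} (hw : ContDiff ℝ 2 w) (x : Plane) :
    Laplacian.laplacian w x = ∑ i, fderiv ℝ (fun y => fderiv ℝ w y
      (EuclideanSpace.basisFun (Fin 2) ℝ i)) x (EuclideanSpace.basisFun (Fin 2) ℝ i) := by
  rw [InnerProductSpace.laplacian_eq_iteratedFDeriv_orthonormalBasis w
    (EuclideanSpace.basisFun (Fin 2) ℝ)]
  refine Finset.sum_congr rfl fun i _ => ?_
  rw [iteratedFDeriv_two_apply]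
  have h1 : DifferentiableAt ℝ (fderiv ℝ w) x :=
    (hw.fderiv_right (m := 1) (by norm_num)).differentiable (by norm_num) x
  rw [fderiv_clm_apply h1 (by fun_prop)]
  simp

theorem inner_gradient_eq_sum {f g : Plane → ℝ} (x : Plane) :
    ⟪∇ f x, ∇ g x⟫ = ∑ i, fderiv ℝ f x (EuclideanSpace.basisFun (Fin 2) ℝ i) *
      fderiv ℝ g x (EuclideanSpace.basisFun (Fin 2) ℝ i) := by
  rw [← (EuclideanSpace.basisFun (Fin 2) ℝ).sum_inner_mul_inner]
  refine Finset.sum_congr rfl fun i _ => ?_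
  rw [gradient, gradient, InnerProductSpace.toDual_symm_apply, real_inner_comm,
    InnerProductSpace.toDual_symm_apply]

theorem continuous_gradient {w : Plane → ℝ} (hw : ContDiff ℝ 1 w) : Continuous (∇ w) :=
  (InnerProductSpace.toDual ℝ Plane).symm.continuous.comp (hw.continuous_fderiv (by norm_num))

theorem continuous_laplacian {w : Plane → ℝ} (hw : ContDiff ℝ 2 w) :
    Continuous (Laplacian.laplacian w) := by
  rw [funext (laplacian_eq_sum_fderiv hw)]
  refine continuous_finsetSum _ fun i _ => ?_
  have h1 : ContDiff ℝ 1 (fun y => fderiv ℝ w y (EuclideanSpace.basisFun (Fin 2) ℝ i)) :=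
    (hw.fderiv_right (m := 1) (by norm_num)).clm_apply contDiff_const
  exact (h1.continuous_fderiv (by norm_num)).clm_apply continuous_const

/-- Green's first identity on the plane, for a compactly supported test function. -/
theorem integral_mul_laplacian {φ w : Plane → ℝ} (hφ : ContDiff ℝ 1 φ)
    (hc : HasCompactSupport φ) (hw : ContDiff ℝ 2 w) :
    ∫ x, φ x * Laplacian.laplacian w x = -∫ x, ⟪∇ φ x, ∇ w x⟫ := by
  have h1 (i : Fin 2) : ContDiff ℝ 1 (fun y => fderiv ℝ w y
      (EuclideanSpace.basisFun (Fin 2) ℝ i)) :=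
    (hw.fderiv_right (m := 1) (by norm_num)).clm_apply contDiff_const
  have c1 (i : Fin 2) : Continuous (fun x => fderiv ℝ (fun y => fderiv ℝ w y
      (EuclideanSpace.basisFun (Fin 2) ℝ i)) x (EuclideanSpace.basisFun (Fin 2) ℝ i)) :=
    ((h1 i).continuous_fderiv (by norm_num)).clm_apply continuous_const
  have c2 (i : Fin 2) : Continuous (fun x => fderiv ℝ φ x
      (EuclideanSpace.basisFun (Fin 2) ℝ i)) :=
    (hφ.continuous_fderiv (by norm_num)).clm_apply continuous_const
  have s2 (i : Fin 2) : HasCompactSupport (fun x => fderiv ℝ φ x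
      (EuclideanSpace.basisFun (Fin 2) ℝ i)) := hc.fderiv_apply ℝ _
  have i1 (i : Fin 2) : Integrable (fun x => φ x * fderiv ℝ (fun y => fderiv ℝ w y
      (EuclideanSpace.basisFun (Fin 2) ℝ i)) x (EuclideanSpace.basisFun (Fin 2) ℝ i)) :=
    (hφ.continuous.mul (c1 i)).integrable_of_hasCompactSupport hc.mul_right
  have i2 (i : Fin 2) : Integrable (fun x => fderiv ℝ φ x (EuclideanSpace.basisFun (Fin 2) ℝ i) *
      fderiv ℝ w x (EuclideanSpace.basisFun (Fin 2) ℝ i)) :=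
    ((c2 i).mul (h1 i).continuous).integrable_of_hasCompactSupport (s2 i).mul_right
  simp_rw [laplacian_eq_sum_fderiv hw, inner_gradient_eq_sum, Finset.mul_sum]
  rw [integral_finsetSum _ fun i _ => i1 i, integral_finsetSum _ fun i _ => i2 i,
    ← Finset.sum_neg_distrib]
  refine Finset.sum_congr rfl fun i _ => ?_
  exact integral_mul_fderiv_eq_neg_fderiv_mul_of_integrable (i2 i) (i1 i)
    ((hφ.continuous.mul (h1 i).continuous).integrable_of_hasCompactSupport hc.mul_right)
    (fun x _ => hφ.differentiable (by norm_num) x)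
    (fun x _ => (h1 i).differentiable (by norm_num) x)

theorem gradient_eq_zero_of_eventuallyEq_const {f : Plane → ℝ} {x : Plane} {c : ℝ}
    (h : f =ᶠ[𝓝 x] fun _ => c) : ∇ f x = 0 := by
  rw [gradient, h.fderiv_eq]
  simp

theorem norm_gradient (f : Plane → ℝ) (x : Plane) : ‖∇ f x‖ = ‖fderiv ℝ f x‖ := by
  rw [gradient, LinearIsometryEquiv.norm_map]

/-- Radial cut-off functions at all scales, with scale-invariant gradient bounds. -/
theorem exists_cutoff : ∃ C : ℝ, 0 ≤ C ∧ ∀ R : ℝ, 0 < R → ∃ φ : Plane → ℝ,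
    ContDiff ℝ 2 φ ∧ HasCompactSupport φ ∧ (∀ x, 0 ≤ φ x) ∧ (∀ x, φ x ≤ 1) ∧
    (∀ x, ‖x‖ ≤ R → φ x = 1) ∧ (∀ x, 2 * R ≤ ‖x‖ → φ x = 0) ∧ (∀ x, ‖x‖ < R → ∇ φ x = 0) ∧
    (∀ x, 2 * R < ‖x‖ → ∇ φ x = 0) ∧ (∀ x, ‖∇ φ x‖ ≤ C / R) := by
  let χ : ContDiffBump (0 : Plane) := ⟨1, 2, one_pos, one_lt_two⟩
  have hχ : ContDiff ℝ 2 χ := χ.contDiff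
  obtain ⟨C, hC⟩ := ((hχ.continuous_fderiv (by norm_num)).norm).bounded_above_of_compact_support
    (χ.hasCompactSupport.fderiv ℝ).norm
  refine ⟨C, (norm_nonneg _).trans (hC 0), fun R hR => ?_⟩
  have hone : ∀ x : Plane, ‖x‖ ≤ R → χ (R⁻¹ • x) = 1 := fun x hx =>
    χ.one_of_mem_closedBall (by
      rw [mem_closedBall_zero_iff, norm_smul, norm_inv, Real.norm_of_nonneg hR.le]
      exact inv_mul_le_one_of_le₀ hx hR.le)
  have hzero : ∀ x : Plane, 2 * R ≤ ‖x‖ → χ (R⁻¹ • x) = 0 := fun x hx =>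
    χ.zero_of_le_dist (by
      rw [dist_zero_right, norm_smul, norm_inv, Real.norm_of_nonneg hR.le, ← div_eq_inv_mul,
        le_div_iff₀ hR]
      exact hx)
  refine ⟨fun x => χ (R⁻¹ • x), hχ.comp (contDiff_const_smul _), ?_, fun x => χ.nonneg,
    fun x => χ.le_one, hone, hzero, fun x hx => ?_, fun x hx => ?_, fun x => ?_⟩
  · exact HasCompactSupport.of_support_subset_isCompact (isCompact_closedBall (0 : Plane) (2 * R))
      fun x hx => by
        rw [mem_closedBall_zero_iff]
        by_contra h
        exact hx (hzero x (not_le.1 h).le)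
  · refine gradient_eq_zero_of_eventuallyEq_const (c := 1) ?_
    filter_upwards [(isOpen_lt continuous_norm continuous_const).mem_nhds hx] with y hy
    exact hone y (le_of_lt hy)
  · refine gradient_eq_zero_of_eventuallyEq_const (c := 0) ?_
    filter_upwards [(isOpen_lt continuous_const continuous_norm).mem_nhds hx] with y hy
    exact hzero y (le_of_lt hy)
  · rw [norm_gradient]
    have hd : HasFDerivAt (fun x : Plane => χ (R⁻¹ • x)) (R⁻¹ • fderiv ℝ χ (R⁻¹ • x)) x := by
      have h1 := ((hχ.differentiable (by norm_num)) (R⁻¹ • x)).hasFDerivAt.comp x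
        ((hasFDerivAt_id x).const_smul R⁻¹)
      have h2 : (fderiv ℝ χ (R⁻¹ • x)).comp (R⁻¹ • ContinuousLinearMap.id ℝ Plane) =
          R⁻¹ • fderiv ℝ χ (R⁻¹ • x) := by
        ext v
        simp
      rw [← h2]
      exact h1
    rw [hd.fderiv, norm_smul, norm_inv, Real.norm_of_nonneg hR.le, div_eq_inv_mul]
    gcongr
    simpa using hC (R⁻¹ • x)

/-! ### Finite-energy Liouville argument and uniqueness -/

theorem norm_sub_sq_le_two_mul {E : Type*} [NormedAddCommGroup E] (a b : E) :
    ‖a - b‖ ^ 2 ≤ 2 * (‖a‖ ^ 2 + ‖b‖ ^ 2) := by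
  have h := norm_sub_le a b
  nlinarith [sq_nonneg (‖a‖ - ‖b‖), norm_nonneg (a - b), norm_nonneg a, norm_nonneg b]

theorem gradient_sub_apply {f g : Plane → ℝ} {x : Plane} (hf : DifferentiableAt ℝ f x)
    (hg : DifferentiableAt ℝ g x) : ∇ (fun y => f y - g y) x = ∇ f x - ∇ g x := by
  simp only [gradient]
  rw [fderiv_fun_sub hf hg, map_sub]

theorem gradient_mul_apply {f g : Plane → ℝ} {x : Plane} (hf : DifferentiableAt ℝ f x)
    (hg : DifferentiableAt ℝ g x) :
    ∇ (fun y => f y * g y) x = f x • ∇ g x + g x • ∇ f x := by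
  simp only [gradient]
  rw [fderiv_fun_mul hf hg, map_add, map_smulₛₗ, map_smulₛₗ]
  simp

theorem gradient_comp_apply {T : ℝ → ℝ} {w : Plane → ℝ} {x : Plane} {T' : ℝ}
    (hT : HasDerivAt T T' (w x)) (hw : DifferentiableAt ℝ w x) :
    ∇ (fun y => T (w y)) x = T' • ∇ w x := by
  simp only [gradient]
  have h : HasFDerivAt (fun y => T (w y)) (T' • fderiv ℝ w x) x :=
    hT.comp_hasFDerivAt x hw.hasFDerivAt
  rw [h.fderiv, map_smulₛₗ]
  simp

theorem differentiableAt_remainder {u : Plane → ℝ} {α : ℝ} {x : Plane}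
    (hu : DifferentiableAt ℝ u x) (hx : x ≠ 0) : DifferentiableAt ℝ (remainder u α) x := by
  unfold remainder
  exact hu.sub (((differentiableAt_id.norm ℝ hx).log (norm_ne_zero_iff.2 hx)).const_mul α)

/-- Two Cheng–Lin solutions have a difference of finite Dirichlet energy. -/
theorem integrable_norm_gradient_sub {K : Plane → ℝ} {α : ℝ} {u v : Plane → ℝ}
    (hu : IsChengLinSolution K α u) (hv : IsChengLinSolution K α v) :
    Integrable (fun x => ‖∇ (fun y => u y - v y) x‖ ^ 2) := by
  have du := hu.solution.contDiff.differentiable (by norm_num)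
  have dv := hv.solution.contDiff.differentiable (by norm_num)
  have hc : Continuous (fun x => ‖∇ (fun y => u y - v y) x‖ ^ 2) :=
    (continuous_gradient ((hu.solution.contDiff.sub hv.solution.contDiff).of_le
      (by norm_num))).norm.pow 2
  rw [← integrableOn_univ, ← Set.union_compl_self (Metric.ball (0 : Plane) 1)]
  refine IntegrableOn.union ?_ ?_
  · exact (hc.continuousOn.integrableOn_compact (isCompact_closedBall 0 1)).mono_set
      Metric.ball_subset_closedBall
  · refine Integrable.mono' ((hu.finiteEnergy.add hv.finiteEnergy).const_mul 2)
      hc.aestronglyMeasurable ((ae_restrict_iff' Metric.isOpen_ball.measurableSet.compl).2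
      (Eventually.of_forall fun x hx => ?_))
    have hx0 : x ≠ 0 := by
      rintro rfl
      simp at hx
    have h1 : (fun y => u y - v y) = fun y => remainder u α y - remainder v α y := by
      ext y
      simp [remainder]
    rw [h1, gradient_sub_apply (differentiableAt_remainder (du x) hx0)
      (differentiableAt_remainder (dv x) hx0), Real.norm_of_nonneg (by positivity)]
    exact norm_sub_sq_le_two_mul _ _

theorem tendsto_integral_norm_ge {f : Plane → ℝ} (hf : Integrable f) :
    Tendsto (fun R : ℝ => ∫ x in {x | R ≤ ‖x‖}, f x) atTop (𝓝 0) := by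
  have hm (R : ℝ) : MeasurableSet {x : Plane | R ≤ ‖x‖} :=
    (isClosed_le continuous_const continuous_norm).measurableSet
  simp_rw [← integral_indicator (hm _)]
  rw [← integral_zero Plane ℝ (μ := volume)]
  refine tendsto_integral_filter_of_dominated_convergence (fun x => ‖f x‖) ?_ ?_ hf.norm ?_
  · exact Eventually.of_forall fun R => hf.aestronglyMeasurable.indicator (hm R)
  · exact Eventually.of_forall fun R => Eventually.of_forall fun x => norm_indicator_le_norm_self _ _
  · refine Eventually.of_forall fun x => tendsto_const_nhds.congr' ?_
    filter_upwards [eventually_gt_atTop ‖x‖] with R hR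
    rw [Set.indicator_of_notMem (by simpa using hR)]

/-- A `C²` function of finite Dirichlet energy with `arctan w · Δw ≥ 0` is constant, and
`arctan w · Δw` vanishes. -/
theorem gradient_eq_zero_of_arctan_mul_laplacian_nonneg {w : Plane → ℝ} (hw : ContDiff ℝ 2 w)
    (hE : Integrable (fun x => ‖∇ w x‖ ^ 2))
    (hs : ∀ x, 0 ≤ Real.arctan (w x) * Laplacian.laplacian w x) (x : Plane) :
    ∇ w x = 0 ∧ Real.arctan (w x) * Laplacian.laplacian w x = 0 := by
  have hw1 : ContDiff ℝ 1 w := hw.of_le (by norm_num)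
  have dw := hw1.differentiable (by norm_num)
  have cg := continuous_gradient hw1
  have cl := continuous_laplacian hw
  -- `J` is the divergence of `arctan (w) ∇w`. The arctangent is used instead of `w` because it is
  -- bounded: the boundary term then needs no control on the size of `w`.
  set J : Plane → ℝ := fun x => (1 / (1 + w x ^ 2)) * ‖∇ w x‖ ^ 2 +
    Real.arctan (w x) * Laplacian.laplacian w x with hJ
  have hJc : Continuous J := by
    have : ∀ x, 1 + w x ^ 2 ≠ 0 := fun x => by positivity
    have := hw.continuous
    fun_prop (disch := assumption)
  have hJ0 : ∀ x, 0 ≤ J x := fun x => add_nonneg (by positivity) (hs x)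
  obtain ⟨C, hC0, hC⟩ := exists_cutoff
  choose! φ hφd hφc hφ0 hφ1 hφe hφz hgi hgo hφg using hC
  -- Conformal invariance in dimension two: the squared gradient bound `(C / R)²` cancels the area
  -- of the disc of radius `2R`.
  obtain ⟨D, hD⟩ : ∃ D : ℝ, ∀ R : ℝ, 0 < R → ∫ x, ‖∇ (φ R) x‖ ^ 2 ≤ D := by
    refine ⟨C ^ 2 * 4 * volume.real (Metric.closedBall (0 : Plane) 1), fun R hR => ?_⟩
    have h1 : ∀ x, ‖∇ (φ R) x‖ ^ 2 ≤
        (Metric.closedBall (0 : Plane) (2 * R)).indicator (fun _ => (C / R) ^ 2) x := fun x => by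
      by_cases hx : x ∈ Metric.closedBall (0 : Plane) (2 * R)
      · rw [Set.indicator_of_mem hx]
        exact pow_le_pow_left₀ (norm_nonneg _) (hφg R hR x) 2
      · rw [Set.indicator_of_notMem hx, hgo R hR x (by simpa using hx)]
        simp
    refine (integral_mono_of_nonneg (Eventually.of_forall fun x => by positivity) ?_
      (Eventually.of_forall h1)).trans ?_
    · exact (integrable_indicator_iff Metric.isClosed_closedBall.measurableSet).2
        (integrableOn_const (measure_closedBall_lt_top.ne))
    · rw [integral_indicator Metric.isClosed_closedBall.measurableSet, setIntegral_const,
        Measure.addHaar_real_closedBall' _ _ (by positivity)]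
      simp only [finrank_euclideanSpace, Fintype.card_fin, smul_eq_mul]
      apply le_of_eq
      field_simp
      ring
  -- Young's inequality with weight `δ`: the cut-off carries the small factor, and the energy of `w`
  -- appears only where `∇ (φ R)` can be nonzero, that is for `|x| ≥ R`. Letting `R → ∞` and
  -- afterwards `δ → 0` kills both terms.
  have key : ∀ R : ℝ, 0 < R → ∀ δ : ℝ, 0 < δ → ∫ x, φ R x * J x ≤
      δ * D + δ⁻¹ * ∫ x in {x | R ≤ ‖x‖}, ‖∇ w x‖ ^ 2 := by
    intro R hR δ hδ
    have hT : ContDiff ℝ 1 (fun x => Real.arctan (w x)) := Real.contDiff_arctan.comp hw1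
    have hφ1' : ContDiff ℝ 1 (φ R) := (hφd R hR).of_le (by norm_num)
    have h1 := integral_mul_laplacian (hφ1'.mul hT) (hφc R hR).mul_right hw
    have hgr : ∀ x, ⟪∇ (fun x => φ R x * Real.arctan (w x)) x, ∇ w x⟫ =
        φ R x * ((1 / (1 + w x ^ 2)) * ‖∇ w x‖ ^ 2) +
          Real.arctan (w x) * ⟪∇ (φ R) x, ∇ w x⟫ := fun x => by
      rw [gradient_mul_apply (hφ1'.differentiable (by norm_num) x)
        (hT.differentiable (by norm_num) x),
        gradient_comp_apply (Real.hasDerivAt_arctan (w x)) (dw x), inner_add_left,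
        inner_smul_left, inner_smul_left, inner_smul_left, real_inner_self_eq_norm_sq]
      simp
    have ig : Integrable (fun x => ∇ (φ R) x) :=
      (continuous_gradient hφ1').integrable_of_hasCompactSupport
        ((hφc R hR).fderiv ℝ |>.comp_left (map_zero _))
    have sg : HasCompactSupport (∇ (φ R)) := ((hφc R hR).fderiv ℝ).comp_left (map_zero _)
    have cgφ := continuous_gradient hφ1'
    have cw := hw.continuous
    have hne : ∀ x, 1 + w x ^ 2 ≠ 0 := fun x => by positivity
    have cφ := hφ1'.continuous
    have i1 : Integrable (fun x => φ R x * ((1 / (1 + w x ^ 2)) * ‖∇ w x‖ ^ 2)) :=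
      Continuous.integrable_of_hasCompactSupport
        (by fun_prop (disch := assumption)) (hφc R hR).mul_right
    have i2 : Integrable (fun x => Real.arctan (w x) * ⟪∇ (φ R) x, ∇ w x⟫) :=
      Continuous.integrable_of_hasCompactSupport (by fun_prop)
        (HasCompactSupport.mul_left (sg.mono fun x hx h0 => hx (by simp [h0])))
    have i3 : Integrable (fun x => φ R x * Real.arctan (w x) * Laplacian.laplacian w x) :=
      Continuous.integrable_of_hasCompactSupport (by fun_prop) (hφc R hR).mul_right.mul_right
    have h2 : ∫ x, φ R x * J x = -∫ x, Real.arctan (w x) * ⟪∇ (φ R) x, ∇ w x⟫ := by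
      simp_rw [hgr] at h1
      rw [integral_add i1 i2] at h1
      have : ∀ x, φ R x * J x = φ R x * ((1 / (1 + w x ^ 2)) * ‖∇ w x‖ ^ 2) +
          φ R x * Real.arctan (w x) * Laplacian.laplacian w x := fun x => by rw [hJ]; ring
      simp_rw [this]
      rw [integral_add i1 i3, h1]
      ring
    have hm : MeasurableSet {x : Plane | R ≤ ‖x‖} :=
      (isClosed_le continuous_const continuous_norm).measurableSet
    have i4 : Integrable (fun x => ‖∇ (φ R) x‖ ^ 2) :=
      Continuous.integrable_of_hasCompactSupport (by fun_prop)
        (sg.mono fun x hx h0 => hx (by simp [h0]))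
    rw [h2, ← integral_neg, ← integral_indicator hm]
    have i5 : Integrable ({x : Plane | R ≤ ‖x‖}.indicator fun x => ‖∇ w x‖ ^ 2) :=
      hE.indicator hm
    calc ∫ x, -(Real.arctan (w x) * ⟪∇ (φ R) x, ∇ w x⟫)
        ≤ ∫ x, (δ * ‖∇ (φ R) x‖ ^ 2 +
            δ⁻¹ * {x : Plane | R ≤ ‖x‖}.indicator (fun x => ‖∇ w x‖ ^ 2) x) := by
          refine integral_mono i2.neg ((i4.const_mul δ).add (i5.const_mul _)) fun x => ?_
          by_cases hx : R ≤ ‖x‖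
          · rw [Set.indicator_of_mem (by simpa using hx)]
            have ha : |Real.arctan (w x)| ≤ 2 := by
              have := Real.arctan_lt_pi_div_two (w x)
              have := Real.neg_pi_div_two_lt_arctan (w x)
              have := Real.pi_le_four
              rw [abs_le]
              constructor <;> linarith
            have hb := abs_real_inner_le_norm (∇ (φ R) x) (∇ w x)
            have h4 : -(Real.arctan (w x) * ⟪∇ (φ R) x, ∇ w x⟫) ≤
                2 * (‖∇ (φ R) x‖ * ‖∇ w x‖) := by
              refine (neg_le_abs _).trans ?_
              rw [abs_mul]
              gcongr
            refine h4.trans ?_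
            have h5 : 0 ≤ δ⁻¹ * (δ * ‖∇ (φ R) x‖ - ‖∇ w x‖) ^ 2 := by positivity
            have h6 : δ⁻¹ * (δ * ‖∇ (φ R) x‖ - ‖∇ w x‖) ^ 2 = δ * ‖∇ (φ R) x‖ ^ 2 +
                δ⁻¹ * ‖∇ w x‖ ^ 2 - 2 * (‖∇ (φ R) x‖ * ‖∇ w x‖) := by
              field_simp
              ring
            linarith
          · rw [Set.indicator_of_notMem (by simpa using hx), hgi R hR x (not_le.1 hx)]
            simp
      _ ≤ _ := by
          rw [integral_add (i4.const_mul δ) (i5.const_mul _), integral_const_mul,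
            integral_const_mul]
          gcongr
          exact hD R hR
  have hJz : J x = 0 := by
    by_contra hne
    set R₀ := ‖x‖ + 1
    have hR₀ : 0 < R₀ := by positivity
    -- If `J` were nonzero at `x`, its integral against one fixed cut-off would be positive, and
    -- larger cut-offs only increase it since `J ≥ 0`.
    have hpos : 0 < ∫ y, φ R₀ y * J y := by
      refine Continuous.integral_pos_of_hasCompactSupport_nonneg_nonzero (x := x)
        ((hφd R₀ hR₀).continuous.mul hJc) (hφc R₀ hR₀).mul_right
        (fun y => mul_nonneg (hφ0 R₀ hR₀ y) (hJ0 y)) ?_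
      rw [hφe R₀ hR₀ x (by simp [R₀]), one_mul]
      exact hne
    have hle : ∀ δ : ℝ, 0 < δ → ∫ y, φ R₀ y * J y ≤ δ * D := by
      intro δ hδ
      have ht : Tendsto (fun R : ℝ => δ * D + δ⁻¹ * ∫ x in {x | R ≤ ‖x‖}, ‖∇ w x‖ ^ 2) atTop
          (𝓝 (δ * D)) := by
        simpa using ((tendsto_integral_norm_ge hE).const_mul δ⁻¹).const_add (δ * D)
      refine ge_of_tendsto ht ?_
      filter_upwards [eventually_ge_atTop (2 * R₀)] with R hR
      have hR0 : 0 < R := by linarith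
      refine le_trans ?_ (key R hR0 δ hδ)
      refine integral_mono
        (((hφd R₀ hR₀).continuous.mul hJc).integrable_of_hasCompactSupport (hφc R₀ hR₀).mul_right)
        (((hφd R hR0).continuous.mul hJc).integrable_of_hasCompactSupport (hφc R hR0).mul_right)
        fun y => ?_
      refine mul_le_mul_of_nonneg_right ?_ (hJ0 y)
      by_cases hy : ‖y‖ ≤ R
      · rw [hφe R hR0 y hy]
        exact hφ1 R₀ hR₀ y
      · rw [hφz R₀ hR₀ y (by linarith)]
        exact hφ0 R hR0 y
    have ht : Tendsto (fun δ : ℝ => δ * D) (𝓝[>] 0) (𝓝 0) := by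
      have : Tendsto (fun δ : ℝ => δ * D) (𝓝 0) (𝓝 (0 * D)) :=
        (continuous_id.mul continuous_const).tendsto 0
      rw [zero_mul] at this
      exact this.mono_left nhdsWithin_le_nhds
    have := ge_of_tendsto ht (eventually_nhdsWithin_of_forall fun δ hδ => hle δ hδ)
    linarith
  have h1 : 0 ≤ (1 / (1 + w x ^ 2)) * ‖∇ w x‖ ^ 2 := by positivity
  have h2 := hs x
  have h3 : (1 / (1 + w x ^ 2)) * ‖∇ w x‖ ^ 2 + Real.arctan (w x) * Laplacian.laplacian w x = 0 :=
    hJz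
  refine ⟨?_, by linarith⟩
  have h4 : (1 / (1 + w x ^ 2)) * ‖∇ w x‖ ^ 2 = 0 := by linarith
  rcases mul_eq_zero.1 h4 with h | h
  · have : 0 < 1 / (1 + w x ^ 2) := by positivity
    linarith
  · simpa using h

/-- Uniqueness of Cheng–Lin solutions for a nonpositive, nontrivial curvature. -/
theorem IsChengLinSolution.unique {K : Plane → ℝ} (hK : ∀ x, K x ≤ 0) {x₀ : Plane}
    (hK₀ : K x₀ < 0) {α : ℝ} {u v : Plane → ℝ} (hu : IsChengLinSolution K α u)
    (hv : IsChengLinSolution K α v) : u = v := by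
  have hw : ContDiff ℝ 2 (fun y => u y - v y) := hu.solution.contDiff.sub hv.solution.contDiff
  have hl : ∀ x, Laplacian.laplacian (fun y => u y - v y) x =
      -K x * (Real.exp (2 * u x) - Real.exp (2 * v x)) := fun x => by
    have h1 := hu.solution.contDiff.contDiffAt.laplacian_sub (x := x)
      hv.solution.contDiff.contDiffAt
    have h2 := hu.solution.equation x
    have h3 := hv.solution.equation x
    change Laplacian.laplacian (u - v) x = _
    rw [h1]
    linarith
  have hsign : ∀ x, 0 ≤ Real.arctan (u x - v x) * (Real.exp (2 * u x) - Real.exp (2 * v x)) :=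
    fun x => by
    rcases le_total (v x) (u x) with h | h
    · exact mul_nonneg (Real.arctan_nonneg.2 (by linarith))
        (sub_nonneg.2 (Real.exp_le_exp.2 (by linarith)))
    · exact mul_nonneg_of_nonpos_of_nonpos (Real.arctan_le_zero.2 (by linarith))
        (sub_nonpos.2 (Real.exp_le_exp.2 (by linarith)))
  have main := gradient_eq_zero_of_arctan_mul_laplacian_nonneg hw
    (integrable_norm_gradient_sub hu hv) (fun x => by
      rw [hl, mul_left_comm]
      exact mul_nonneg (by linarith [hK x]) (hsign x))
  have hconst : ∀ x, u x - v x = u x₀ - v x₀ := fun x =>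
    is_const_of_fderiv_eq_zero (𝕜 := ℝ) (hw.differentiable (by norm_num)) (fun y => by
      have := (main y).1
      rwa [gradient, LinearIsometryEquiv.map_eq_zero_iff] at this) x x₀
  -- The pointwise half of the conclusion fixes the additive constant: at `x₀` the factor `K` does
  -- not vanish.
  have h0 : u x₀ - v x₀ = 0 := by
    have h1 := (main x₀).2
    rw [hl] at h1
    rcases mul_eq_zero.1 h1 with h | h
    · exact Real.arctan_eq_zero_iff.1 h
    · rcases mul_eq_zero.1 h with h | h
      · linarith
      · have := Real.exp_injective (sub_eq_zero.1 h)
        linarith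
  ext x
  have := hconst x
  linarith

/-! ### Uniform convexity of the entropy -/

/-- The Bregman divergence of `klFun` dominates the squared Hellinger distance. -/
theorem sq_sqrt_sub_sqrt_le_klFun {a s : ℝ} (ha : 0 ≤ a) (hs : 0 < s) :
    (√a - √s) ^ 2 ≤ klFun a - klFun s - Real.log s * (a - s) := by
  have h1 : klFun a - klFun s - Real.log s * (a - s) = a * (Real.log a - Real.log s) - a + s := by
    rw [klFun_apply, klFun_apply]
    ring
  have h2 : (√a - √s) ^ 2 = a - 2 * (√a * √s) + s := by
    rw [sub_sq, Real.sq_sqrt ha, Real.sq_sqrt hs.le]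
    ring
  rw [h1, h2]
  rcases ha.eq_or_lt with rfl | ha'
  · simp
  have hsa := Real.sqrt_pos.2 ha'
  have hss := Real.sqrt_pos.2 hs
  -- This is `log t ≤ t - 1` at `t = √s / √a`; the square roots are what produces the Hellinger
  -- distance.
  have h3 : Real.log s - Real.log a ≤ 2 * (√s / √a - 1) := by
    have := Real.log_le_sub_one_of_pos (div_pos hss hsa)
    rw [Real.log_div hss.ne' hsa.ne', Real.log_sqrt hs.le, Real.log_sqrt ha] at this
    linarith
  have h4 : a * (√s / √a) = √a * √s := by
    nth_rewrite 1 [← Real.mul_self_sqrt ha]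
    field_simp
  have h5 := mul_le_mul_of_nonneg_left h3 ha
  nlinarith

/-- Quantitative midpoint convexity of `klFun`. -/
theorem klFun_midpoint_le {a b : ℝ} (ha : 0 ≤ a) (hb : 0 ≤ b) :
    2 * klFun ((a + b) / 2) + (√a - √b) ^ 2 / 2 ≤ klFun a + klFun b := by
  rcases (add_nonneg ha hb).eq_or_lt with h | h
  · have h1 : a = 0 := by linarith
    have h2 : b = 0 := by linarith
    subst h1 h2
    simp
    linarith [klFun_zero]
  · have hs : 0 < (a + b) / 2 := by linarith
    have h1 := sq_sqrt_sub_sqrt_le_klFun ha hs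
    have h2 := sq_sqrt_sub_sqrt_le_klFun hb hs
    -- The linear terms of the two divergences cancel at the midpoint. The remaining squares are
    -- bounded below by `2(x-s)² + 2(y-s)² = (x-y)² + (x+y-2s)²` with `x = √a`, `y = √b`.
    have h3 : Real.log ((a + b) / 2) * (a - (a + b) / 2) +
        Real.log ((a + b) / 2) * (b - (a + b) / 2) = 0 := by ring
    nlinarith [sq_nonneg (√a + √b - 2 * √((a + b) / 2))]

theorem klFun_le_one_add_sq {a : ℝ} (ha : 0 ≤ a) : klFun a ≤ 1 + a ^ 2 := by
  rw [klFun_apply]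
  rcases ha.eq_or_lt with rfl | h
  · simp
  · nlinarith [mul_le_mul_of_nonneg_left (Real.log_le_sub_one_of_pos h) ha]

theorem liminf_add_liminf_le (a b : ℕ → ℝ≥0∞) :
    liminf a atTop + liminf b atTop ≤ liminf (fun n => a n + b n) atTop := by
  simp only [liminf_eq_iSup_iInf_of_nat]
  rw [ENNReal.iSup_add_iSup_of_monotone]
  · refine iSup_mono fun n => le_iInf₂ fun i hi => ?_
    exact add_le_add (iInf₂_le i hi) (iInf₂_le i hi)
  · exact fun m n h => le_iInf₂ fun i hi => iInf₂_le i (h.trans hi)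
  · exact fun m n h => le_iInf₂ fun i hi => iInf₂_le i (h.trans hi)

/-! ### Free energy for a positive semidefinite kernel -/

section Variational

variable {X : Type*} [MeasurableSpace X]

/-- The potential of a density `F` with respect to a kernel `M`. -/
noncomputable def kernelPotential (μ : Measure X) (M : X × X → ℝ≥0∞) (F : X → ℝ≥0∞) (x : X) :
    ℝ≥0∞ := ∫⁻ y, M (x, y) * F y ∂μ

/-- The mutual energy of two densities with respect to a kernel `M`. -/
noncomputable def kernelEnergy (μ : Measure X) (M : X × X → ℝ≥0∞) (F G : X → ℝ≥0∞) : ℝ≥0∞ :=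
  ∫⁻ z, M z * (F z.1 * G z.2) ∂(μ.prod μ)

/-- Relative entropy plus self-energy of a nonnegative density. -/
noncomputable def freeEnergy (μ : Measure X) (M : X × X → ℝ≥0∞) (f : X → ℝ) : ℝ≥0∞ :=
  (∫⁻ x, ENNReal.ofReal (klFun (f x)) ∂μ) +
    kernelEnergy μ M (fun x => ENNReal.ofReal (f x)) (fun x => ENNReal.ofReal (f x))

/-- A symmetric, finite, measurable, positive semidefinite kernel with finite energy on an
exhausting sequence of sets. -/
structure IsEnergyKernel (μ : Measure X) (M : X × X → ℝ≥0∞) (S : ℕ → Set X) : Prop where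
  measurable : Measurable M
  ne_top : ∀ z, M z ≠ ⊤
  symm : ∀ z, M z.swap = M z
  two_mul_le : ∀ F G : X → ℝ≥0∞, Measurable F → Measurable G → ∫⁻ x, F x ∂μ ≠ ⊤ →
    ∫⁻ x, G x ∂μ ≠ ⊤ →
    2 * kernelEnergy μ M F G ≤ kernelEnergy μ M F F + kernelEnergy μ M G G
  measurableSet : ∀ n, MeasurableSet (S n)
  mono : Monotone S
  iUnion : ⋃ n, S n = Set.univ
  energy_ne_top : ∀ n, kernelEnergy μ M ((S n).indicator 1) ((S n).indicator 1) ≠ ⊤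

/-- `f` is a nonnegative measurable density of total mass `m`. -/
structure IsDensity (μ : Measure X) (m : ℝ) (f : X → ℝ) : Prop where
  measurable : Measurable f
  nonneg : ∀ x, 0 ≤ f x
  mass : ∫⁻ x, ENNReal.ofReal (f x) ∂μ = ENNReal.ofReal m

variable {μ : Measure X} {M : X × X → ℝ≥0∞} {S : ℕ → Set X} {m : ℝ}

theorem kernelEnergy_mono {F F' G G' : X → ℝ≥0∞} (hF : ∀ x, F x ≤ F' x) (hG : ∀ x, G x ≤ G' x) :
    kernelEnergy μ M F G ≤ kernelEnergy μ M F' G' :=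
  lintegral_mono fun z => by
    gcongr
    · exact hF _
    · exact hG _

theorem kernelEnergy_const_mul (hM : Measurable M) {F G : X → ℝ≥0∞} (hF : Measurable F)
    (hG : Measurable G) (a b : ℝ≥0∞) :
    kernelEnergy μ M (fun x => a * F x) (fun x => b * G x) = a * b * kernelEnergy μ M F G := by
  rw [kernelEnergy, kernelEnergy, ← lintegral_const_mul _ (by fun_prop)]
  exact lintegral_congr fun z => by ring

theorem IsDensity.lintegral_ne_top {f : X → ℝ} (hf : IsDensity μ m f) :
    ∫⁻ x, ENNReal.ofReal (f x) ∂μ ≠ ⊤ := hf.mass ▸ ENNReal.ofReal_ne_top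

theorem IsDensity.integrable {f : X → ℝ} (hf : IsDensity μ m f) : Integrable f μ := by
  refine ⟨hf.measurable.aestronglyMeasurable, ?_⟩
  rw [hasFiniteIntegral_iff_ofReal (Eventually.of_forall hf.nonneg)]
  exact hf.lintegral_ne_top.lt_top

theorem IsDensity.integral_eq {f : X → ℝ} (hm : 0 ≤ m) (hf : IsDensity μ m f) :
    ∫ x, f x ∂μ = m := by
  rw [integral_eq_lintegral_of_nonneg_ae (Eventually.of_forall hf.nonneg)
    hf.measurable.aestronglyMeasurable, hf.mass, ENNReal.toReal_ofReal hm]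

theorem IsDensity.convexComb {f g : X → ℝ} (hm : 0 ≤ m) (hf : IsDensity μ m f)
    (hg : IsDensity μ m g) {t : ℝ} (ht0 : 0 ≤ t) (ht1 : t ≤ 1) :
    IsDensity μ m (fun x => (1 - t) * f x + t * g x) := by
  have h1 : 0 ≤ 1 - t := sub_nonneg.2 ht1
  have mf := hf.measurable
  have mg := hg.measurable
  have hn : ∀ x, 0 ≤ (1 - t) * f x + t * g x := fun x =>
    add_nonneg (mul_nonneg h1 (hf.nonneg x)) (mul_nonneg ht0 (hg.nonneg x))
  refine ⟨by fun_prop, hn, ?_⟩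
  rw [← ofReal_integral_eq_lintegral_ofReal
    (f := fun x => (1 - t) * f x + t * g x)
    ((hf.integrable.const_mul _).add (hg.integrable.const_mul _)) (Eventually.of_forall hn),
    integral_add (hf.integrable.const_mul _) (hg.integrable.const_mul _), integral_const_mul,
    integral_const_mul, hf.integral_eq hm, hg.integral_eq hm]
  congr 1
  ring

/-- Fatou's lemma, on `X` for the entropy and on `X × X` for the energy. Finiteness of the kernel at
every point makes multiplication by it continuous in `ℝ≥0∞`. -/
theorem freeEnergy_le_liminf (hM : IsEnergyKernel μ M S) {f : ℕ → X → ℝ} {g : X → ℝ}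
    (hf : ∀ n, Measurable (f n))  (hlim : ∀ᵐ x ∂μ, Tendsto (fun n => f n x) atTop (𝓝 (g x))) :
    freeEnergy μ M g ≤ liminf (fun n => freeEnergy μ M (f n)) atTop := by
  have hm := hM.measurable
  have mk := measurable_klFun
  have h1 : ∫⁻ x, ENNReal.ofReal (klFun (g x)) ∂μ ≤
      liminf (fun n => ∫⁻ x, ENNReal.ofReal (klFun (f n x)) ∂μ) atTop := by
    refine le_trans (lintegral_mono_ae ?_) (lintegral_liminf_le fun n => by
      have := hf n
      fun_prop)
    filter_upwards [hlim] with x hx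
    exact ((ENNReal.continuous_ofReal.tendsto _).comp
      ((continuous_klFun.tendsto _).comp hx)).liminf_eq.ge
  have h2 : kernelEnergy μ M (fun x => ENNReal.ofReal (g x)) (fun x => ENNReal.ofReal (g x)) ≤
      liminf (fun n => kernelEnergy μ M (fun x => ENNReal.ofReal (f n x))
        (fun x => ENNReal.ofReal (f n x))) atTop := by
    refine le_trans (lintegral_mono_ae ?_) (lintegral_liminf_le fun n => by
      have := hf n
      fun_prop)
    filter_upwards [Measure.quasiMeasurePreserving_fst.ae hlim,
      Measure.quasiMeasurePreserving_snd.ae hlim] with z h1 h2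
    have h3 := ENNReal.Tendsto.mul ((ENNReal.continuous_ofReal.tendsto _).comp h1)
      (Or.inr ENNReal.ofReal_ne_top) ((ENNReal.continuous_ofReal.tendsto _).comp h2)
      (Or.inr ENNReal.ofReal_ne_top)
    exact (ENNReal.Tendsto.const_mul h3 (Or.inr (hM.ne_top z))).liminf_eq.ge
  exact (add_le_add h1 h2).trans (liminf_add_liminf_le _ _)

variable [IsFiniteMeasure μ]

theorem kernelEnergy_eq_lintegral_mul_potential (hM : Measurable M) {F G : X → ℝ≥0∞}
    (hF : Measurable F) (hG : Measurable G) :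
    kernelEnergy μ M F G = ∫⁻ x, F x * kernelPotential μ M G x ∂μ := by
  rw [kernelEnergy, lintegral_prod _ (by fun_prop)]
  refine lintegral_congr fun x => ?_
  rw [kernelPotential, ← lintegral_const_mul _ (by fun_prop)]
  exact lintegral_congr fun y => by ring

theorem measurable_kernelPotential (hM : Measurable M) {F : X → ℝ≥0∞} (hF : Measurable F) :
    Measurable (kernelPotential μ M F) := by
  unfold kernelPotential
  exact Measurable.lintegral_prod_right' (f := fun z : X × X => M z * F z.2) (by fun_prop)

theorem kernelEnergy_comm (hsymm : ∀ z, M z.swap = M z) (F G : X → ℝ≥0∞) :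
    kernelEnergy μ M F G = kernelEnergy μ M G F := by
  rw [kernelEnergy, ← lintegral_prod_swap, kernelEnergy]
  refine lintegral_congr fun z => ?_
  rw [hsymm, Prod.fst_swap, Prod.snd_swap, mul_comm (F z.2)]

theorem kernelEnergy_convexComb (hM : IsEnergyKernel μ M S) {F G : X → ℝ≥0∞} (hF : Measurable F)
    (hG : Measurable G) (a b : ℝ≥0∞) :
    kernelEnergy μ M (fun x => a * F x + b * G x) (fun x => a * F x + b * G x) =
      a ^ 2 * kernelEnergy μ M F F + 2 * (a * b) * kernelEnergy μ M F G +
        b ^ 2 * kernelEnergy μ M G G := by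
  have hm := hM.measurable
  have h1 : kernelEnergy μ M (fun x => a * F x + b * G x) (fun x => a * F x + b * G x) =
      kernelEnergy μ M (fun x => a * F x) (fun x => a * F x) +
      kernelEnergy μ M (fun x => a * F x) (fun x => b * G x) +
      kernelEnergy μ M (fun x => b * G x) (fun x => a * F x) +
      kernelEnergy μ M (fun x => b * G x) (fun x => b * G x) := by
    simp only [kernelEnergy]
    rw [← lintegral_add_left (by fun_prop), ← lintegral_add_left (by fun_prop),
      ← lintegral_add_left (by fun_prop)]
    exact lintegral_congr fun z => by ring
  rw [h1, kernelEnergy_const_mul hm hF hF, kernelEnergy_const_mul hm hF hG,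
    kernelEnergy_const_mul hm hG hF, kernelEnergy_const_mul hm hG hG,
    kernelEnergy_comm hM.symm G F]
  ring

/-- Convexity of the energy. Expanding the midpoint leaves a cross term, which positive
semidefiniteness bounds by the two self-energies; the polarised form avoids subtraction, so infinite
energies are allowed. -/
theorem kernelEnergy_add_le (hM : IsEnergyKernel μ M S) {F G : X → ℝ≥0∞} (hF : Measurable F)
    (hG : Measurable G) (hFm : ∫⁻ x, F x ∂μ ≠ ⊤) (hGm : ∫⁻ x, G x ∂μ ≠ ⊤) :
    2 * kernelEnergy μ M (fun x => (F x + G x) / 2) (fun x => (F x + G x) / 2) ≤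
      kernelEnergy μ M F F + kernelEnergy μ M G G := by
  have h1 : (fun x => (F x + G x) / 2) = fun x => (2 : ℝ≥0∞)⁻¹ * F x + 2⁻¹ * G x := by
    ext x
    rw [ENNReal.div_eq_inv_mul, mul_add]
  have h4 : (2 : ℝ≥0∞) * 2⁻¹ = 1 := ENNReal.mul_inv_cancel (by norm_num) (by norm_num)
  rw [h1, kernelEnergy_convexComb hM hF hG]
  calc _ = (2 * 2⁻¹) * 2⁻¹ * kernelEnergy μ M F F + (2 * 2⁻¹) * 2⁻¹ *
        (2 * kernelEnergy μ M F G) + (2 * 2⁻¹) * 2⁻¹ * kernelEnergy μ M G G := by ring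
    _ ≤ (2 * 2⁻¹) * 2⁻¹ * kernelEnergy μ M F F + (2 * 2⁻¹) * 2⁻¹ *
        (kernelEnergy μ M F F + kernelEnergy μ M G G) +
        (2 * 2⁻¹) * 2⁻¹ * kernelEnergy μ M G G := by
          gcongr
          exact hM.two_mul_le F G hF hG hFm hGm
    _ = (2 * 2⁻¹) * ((2 * 2⁻¹) * (kernelEnergy μ M F F + kernelEnergy μ M G G)) := by ring
    _ = _ := by rw [h4, one_mul, one_mul]

/-- Uniform convexity of the free energy. -/
theorem freeEnergy_midpoint_le (hM : IsEnergyKernel μ M S) {f g : X → ℝ} (hf : IsDensity μ m f)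
    (hg : IsDensity μ m g) :
    2 * freeEnergy μ M (fun x => (1 - 1 / 2 : ℝ) * f x + 1 / 2 * g x) +
      2⁻¹ * ∫⁻ x, ENNReal.ofReal ((√(f x) - √(g x)) ^ 2) ∂μ ≤
      freeEnergy μ M f + freeEnergy μ M g := by
  have mf := hf.measurable
  have mg := hg.measurable
  have mk := measurable_klFun
  have e1 : (fun x => (1 - 1 / 2 : ℝ) * f x + 1 / 2 * g x) = fun x => (f x + g x) / 2 := by
    ext x
    ring
  have e2 : (fun x => ENNReal.ofReal ((f x + g x) / 2)) =
      fun x => (ENNReal.ofReal (f x) + ENNReal.ofReal (g x)) / 2 := by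
    ext x
    rw [ENNReal.ofReal_div_of_pos (by norm_num), ENNReal.ofReal_add (hf.nonneg x) (hg.nonneg x)]
    simp
  have hE := kernelEnergy_add_le hM (F := fun x => ENNReal.ofReal (f x))
    (G := fun x => ENNReal.ofReal (g x)) (by fun_prop) (by fun_prop) hf.lintegral_ne_top
    hg.lintegral_ne_top
  have hK : 2 * (∫⁻ x, ENNReal.ofReal (klFun ((f x + g x) / 2)) ∂μ) +
      2⁻¹ * (∫⁻ x, ENNReal.ofReal ((√(f x) - √(g x)) ^ 2) ∂μ) ≤
      (∫⁻ x, ENNReal.ofReal (klFun (f x)) ∂μ) + ∫⁻ x, ENNReal.ofReal (klFun (g x)) ∂μ := by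
    rw [← lintegral_const_mul _ (by fun_prop), ← lintegral_const_mul _ (by fun_prop),
      ← lintegral_add_left (by fun_prop), ← lintegral_add_left (by fun_prop)]
    refine lintegral_mono fun x => ?_
    have h1 := klFun_midpoint_le (hf.nonneg x) (hg.nonneg x)
    have h2 : 0 ≤ klFun ((f x + g x) / 2) :=
      klFun_nonneg (div_nonneg (add_nonneg (hf.nonneg x) (hg.nonneg x)) zero_le_two)
    have h3 : (2 : ℝ≥0∞)⁻¹ = ENNReal.ofReal (2⁻¹) := by
      rw [ENNReal.ofReal_inv_of_pos (by norm_num)]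
      simp
    have h4 : (2 : ℝ≥0∞) = ENNReal.ofReal 2 := by simp
    simp only
    rw [h3, h4, ← ENNReal.ofReal_mul (by norm_num), ← ENNReal.ofReal_mul (by norm_num),
      ← ENNReal.ofReal_add (by positivity) (by positivity),
      ← ENNReal.ofReal_add (klFun_nonneg (hf.nonneg x)) (klFun_nonneg (hg.nonneg x))]
    exact ENNReal.ofReal_le_ofReal (by linarith)
  rw [e1]
  unfold freeEnergy
  rw [e2, mul_add]
  calc _ = (2 * (∫⁻ x, ENNReal.ofReal (klFun ((f x + g x) / 2)) ∂μ) +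
      2⁻¹ * (∫⁻ x, ENNReal.ofReal ((√(f x) - √(g x)) ^ 2) ∂μ)) + 2 * kernelEnergy μ M
        (fun x => (ENNReal.ofReal (f x) + ENNReal.ofReal (g x)) / 2)
        (fun x => (ENNReal.ofReal (f x) + ENNReal.ofReal (g x)) / 2) := by ring
    _ ≤ _ := (add_le_add hK hE).trans (le_of_eq (by ring))

end Variational

/-! ### Minimisers and Gibbs densities -/

section Variational

variable {X : Type*} [MeasurableSpace X] {μ : Measure X} {M : X × X → ℝ≥0∞} {S : ℕ → Set X} {m : ℝ}

theorem eLpNorm_two_sq (h : X → ℝ) :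
    eLpNorm h 2 μ ^ 2 = ∫⁻ x, ENNReal.ofReal (h x ^ 2) ∂μ := by
  have h1 := eLpNorm_nnreal_pow_eq_lintegral (f := h) (μ := μ) (p := 2) two_ne_zero
  simp only [NNReal.coe_ofNat, ENNReal.rpow_ofNat, ENNReal.coe_ofNat] at h1
  rw [h1]
  refine lintegral_congr fun x => ?_
  rw [← sq_abs, ENNReal.ofReal_pow (abs_nonneg _), Real.enorm_eq_ofReal_abs]

theorem measure_ne_zero_of_exhaustion (hM : IsEnergyKernel μ M S) (hμ : μ ≠ 0) :
    ∃ N, ∀ n, N ≤ n → μ (S n) ≠ 0 := by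
  by_contra! h
  refine hμ (Measure.measure_univ_eq_zero.1 ?_)
  rw [← hM.iUnion, measure_iUnion_null_iff]
  intro n
  obtain ⟨k, hk, h0⟩ := h n
  exact measure_mono_null (hM.mono hk) h0

theorem kernelEnergy_const_indicator_ne_top (hM : IsEnergyKernel μ M S) {F : X → ℝ≥0∞} {n : ℕ}
    {a : ℝ≥0∞} (ha : a ≠ ⊤) (hF : ∀ x, F x ≤ a * (S n).indicator 1 x) :
    kernelEnergy μ M F F ≠ ⊤ := by
  have hmS : Measurable ((S n).indicator (1 : X → ℝ≥0∞)) :=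
    measurable_one.indicator (hM.measurableSet n)
  refine ((kernelEnergy_mono hF hF).trans_lt ?_).ne
  rw [kernelEnergy_const_mul hM.measurable hmS hmS]
  exact ENNReal.mul_lt_top (ENNReal.mul_lt_top ha.lt_top ha.lt_top) (hM.energy_ne_top n).lt_top

variable [IsFiniteMeasure μ]

/-- The free energy attains its infimum among densities of given mass. -/
theorem exists_freeEnergy_minimizer (hM : IsEnergyKernel μ M S) (hm : 0 ≤ m) {f₀ : X → ℝ}
    (hf₀ : IsDensity μ m f₀) (hE₀ : freeEnergy μ M f₀ ≠ ⊤) :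
    ∃ f, IsDensity μ m f ∧ freeEnergy μ M f ≠ ⊤ ∧
      ∀ g, IsDensity μ m g → freeEnergy μ M f ≤ freeEnergy μ M g := by
  set I : ℝ≥0∞ := ⨅ (f) (_ : IsDensity μ m f), freeEnergy μ M f with hI
  have hIle : ∀ g, IsDensity μ m g → I ≤ freeEnergy μ M g := fun g hg => iInf₂_le g hg
  have hItop : I ≠ ⊤ := ((hIle f₀ hf₀).trans_lt hE₀.lt_top).ne
  -- The excess `4^{-(n+2)}` is tuned to the uniform convexity: two terms of index at least `N` have
  -- squared Hellinger distance at most `4^{-(N+1)}`, hence `L²` distance of square roots below the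
  -- summable `2^{-N}`.
  have hδ : ∀ n : ℕ, ∃ f, IsDensity μ m f ∧ freeEnergy μ M f < I + ((4 : ℝ≥0∞) ^ (n + 2))⁻¹ := by
    intro n
    have h1 : I < I + ((4 : ℝ≥0∞) ^ (n + 2))⁻¹ :=
      ENNReal.lt_add_right hItop (by simp)
    have h2 := h1
    nth_rewrite 1 [hI] at h2
    simp only [iInf_lt_iff] at h2
    obtain ⟨f, hf, h⟩ := h2
    exact ⟨f, hf, h⟩
  choose f hf hfE using hδ
  have hmeas : ∀ n, Measurable (f n) := fun n => (hf n).measurable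
  have hsq : ∀ n, eLpNorm (fun x => √(f n x)) 2 μ ^ 2 = ENNReal.ofReal m := fun n => by
    rw [eLpNorm_two_sq, ← (hf n).mass]
    exact lintegral_congr fun x => by rw [Real.sq_sqrt ((hf n).nonneg x)]
  have hLp : ∀ n, MemLp (fun x => √(f n x)) 2 μ := fun n => by
    refine ⟨(hmeas n).sqrt.aestronglyMeasurable, ?_⟩
    refine lt_top_iff_ne_top.2 fun h => ?_
    have := hsq n
    rw [h] at this
    simp at this
  -- The midpoint is again a competitor, so its free energy is at least `I`, and the gain in
  -- `freeEnergy_midpoint_le` must be absorbed by the excesses.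
  have hcau : ∀ N i j : ℕ, N ≤ i → N ≤ j →
      eLpNorm ((fun x => √(f i x)) - (fun x => √(f j x))) 2 μ < ((2 : ℝ≥0∞) ^ N)⁻¹ := by
    intro N i j hi hj
    have h1 := freeEnergy_midpoint_le hM (hf i) (hf j)
    have hmid := hIle _ ((hf i).convexComb hm (hf j) (t := 1 / 2) (by norm_num) (by norm_num))
    have hmono : ∀ i, N ≤ i → freeEnergy μ M (f i) ≤ I + ((4 : ℝ≥0∞) ^ (N + 2))⁻¹ := fun i hi =>
      (hfE i).le.trans (by
        gcongr
        norm_num)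
    set D := ∫⁻ x, ENNReal.ofReal ((√(f i x) - √(f j x)) ^ 2) ∂μ with hD
    have h2 : 2 * I + 2⁻¹ * D ≤ 2 * I + 2 * ((4 : ℝ≥0∞) ^ (N + 2))⁻¹ :=
      calc 2 * I + 2⁻¹ * D ≤ _ := by gcongr
        _ ≤ _ := h1
        _ ≤ (I + ((4 : ℝ≥0∞) ^ (N + 2))⁻¹) + (I + ((4 : ℝ≥0∞) ^ (N + 2))⁻¹) :=
          add_le_add (hmono i hi) (hmono j hj)
        _ = _ := by ring
    have h3 := (ENNReal.add_le_add_iff_left (ENNReal.mul_ne_top (by norm_num) hItop)).1 h2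
    have h4 : D ≤ ((4 : ℝ≥0∞) ^ (N + 1))⁻¹ :=
      calc D = 2 * (2⁻¹ * D) := by
            rw [← mul_assoc, ENNReal.mul_inv_cancel (by norm_num) (by norm_num), one_mul]
        _ ≤ 2 * (2 * ((4 : ℝ≥0∞) ^ (N + 2))⁻¹) := by gcongr
        _ = ((4 : ℝ≥0∞) ^ (N + 1))⁻¹ * (4 * 4⁻¹) := by
          rw [pow_succ _ (N + 1), ENNReal.mul_inv (by simp) (by simp)]
          ring
        _ = _ := by rw [ENNReal.mul_inv_cancel (by norm_num) (by norm_num), mul_one]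
    refine lt_of_not_ge fun h => absurd (pow_le_pow_left' h 2) (not_le.2 ?_)
    rw [eLpNorm_two_sq]
    refine lt_of_le_of_lt h4 ?_
    rw [ENNReal.inv_pow, ENNReal.inv_pow, ← pow_mul, mul_comm N 2, pow_mul]
    have h5 : ((2 : ℝ≥0∞)⁻¹) ^ 2 = 4⁻¹ := by
      rw [← ENNReal.inv_pow]
      norm_num
    rw [h5, pow_succ]
    have h6 : ((4 : ℝ≥0∞)⁻¹) ^ N ≠ 0 := by simp
    have h7 : ((4 : ℝ≥0∞)⁻¹) ^ N ≠ ⊤ := by simp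
    calc ((4 : ℝ≥0∞)⁻¹) ^ N * 4⁻¹ < ((4 : ℝ≥0∞)⁻¹) ^ N * 1 := by
          refine (ENNReal.mul_lt_mul_iff_right h6 h7).2 ?_
          rw [ENNReal.inv_lt_one]
          norm_num
      _ = _ := mul_one _
  obtain ⟨h, hhLp, hhlim⟩ := Lp.cauchy_complete_eLpNorm (by norm_num) hLp (B := fun N => (2 ^ N)⁻¹)
    (by
      simp_rw [ENNReal.inv_pow]
      rw [ENNReal.tsum_geometric]
      simp) hcau
  obtain ⟨ns, hns, hae⟩ := (tendstoInMeasure_of_tendsto_eLpNorm (by norm_num)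
    (fun n => (hLp n).1) hhLp.1 hhlim).exists_seq_tendsto_ae
  -- A density must be measurable, not only almost everywhere equal to a measurable function.
  set k := hhLp.1.mk h with hk
  have hkm : Measurable k := hhLp.1.stronglyMeasurable_mk.measurable
  have hke : h =ᵐ[μ] k := hhLp.1.ae_eq_mk
  -- Strong `L²` convergence of the square roots carries the mass to the limit, so none escapes
  -- along the minimising sequence.
  have hnorm : eLpNorm h 2 μ ^ 2 = ENNReal.ofReal m := by
    have hlim : Tendsto (fun n => eLpNorm (fun x => √(f n x)) 2 μ) atTop (𝓝 (eLpNorm h 2 μ)) := by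
      refine tendsto_of_tendsto_of_tendsto_of_le_of_le
        (g := fun n => eLpNorm h 2 μ - eLpNorm ((fun x => √(f n x)) - h) 2 μ)
        (h := fun n => eLpNorm h 2 μ + eLpNorm ((fun x => √(f n x)) - h) 2 μ) ?_ ?_ ?_ ?_
      · simpa using ENNReal.Tendsto.sub tendsto_const_nhds hhlim (Or.inl hhLp.2.ne)
      · simpa using Tendsto.const_add (eLpNorm h 2 μ) hhlim
      · intro n
        simp only
        rw [tsub_le_iff_right]
        have h1 := eLpNorm_add_le (hLp n).1 (hhLp.1.sub (hLp n).1) one_le_two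
        rw [add_sub_cancel, eLpNorm_sub_comm] at h1
        exact h1
      · intro n
        have h1 := eLpNorm_add_le hhLp.1 ((hLp n).1.sub hhLp.1) one_le_two
        rw [add_sub_cancel] at h1
        exact h1
    have h2 := ((ENNReal.continuous_pow 2).tendsto _).comp hlim
    refine tendsto_nhds_unique h2 ?_
    refine tendsto_const_nhds.congr fun n => ?_
    exact (hsq n).symm
  have hdens : IsDensity μ m (fun x => k x ^ 2) := by
    refine ⟨by fun_prop, fun x => by positivity, ?_⟩
    rw [← hnorm, eLpNorm_two_sq]
    refine lintegral_congr_ae ?_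
    filter_upwards [hke] with x hx
    rw [hx]
  have hle : freeEnergy μ M (fun x => k x ^ 2) ≤ I := by
    refine (freeEnergy_le_liminf hM (fun n => hmeas (ns n)) ?_).trans ?_
    · filter_upwards [hae, hke] with x hx hx2
      rw [← hx2]
      refine (hx.pow 2).congr fun n => ?_
      exact Real.sq_sqrt ((hf _).nonneg x)
    · have h1 : Tendsto (fun n : ℕ => I + ((4 : ℝ≥0∞) ^ (ns n + 2))⁻¹) atTop (𝓝 (I + 0)) := by
        refine Tendsto.const_add I ?_
        have h2 : Tendsto (fun n : ℕ => ((4 : ℝ≥0∞)⁻¹) ^ n) atTop (𝓝 0) :=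
          ENNReal.tendsto_pow_atTop_nhds_zero_of_lt_one (by
            rw [ENNReal.inv_lt_one]
            norm_num)
        simp_rw [ENNReal.inv_pow]
        exact h2.comp ((tendsto_add_atTop_nat 2).comp hns.tendsto_atTop)
      rw [add_zero] at h1
      rw [← h1.liminf_eq]
      exact liminf_le_liminf (Eventually.of_forall fun n => (hfE (ns n)).le)
  exact ⟨_, hdens, (hle.trans_lt hItop.lt_top).ne, fun g hg => hle.trans (hIle g hg)⟩

/-- A minimiser of the free energy also minimises the functional linearised in the energy part. -/
theorem linearized_le_of_minimizer (hM : IsEnergyKernel μ M S) (hm : 0 ≤ m) {f g : X → ℝ}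
    (hf : IsDensity μ m f) (hE : freeEnergy μ M f ≠ ⊤)
    (hmin : ∀ g, IsDensity μ m g → freeEnergy μ M f ≤ freeEnergy μ M g)
    (hg : IsDensity μ m g) (hEg : freeEnergy μ M g ≠ ⊤) :
    (∫⁻ x, ENNReal.ofReal (klFun (f x)) ∂μ) + 2 * kernelEnergy μ M
      (fun x => ENNReal.ofReal (f x)) (fun x => ENNReal.ofReal (f x)) ≤
    (∫⁻ x, ENNReal.ofReal (klFun (g x)) ∂μ) + 2 * kernelEnergy μ M
      (fun x => ENNReal.ofReal (g x)) (fun x => ENNReal.ofReal (f x)) := by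
  have mf := hf.measurable
  have mg := hg.measurable
  have mk := measurable_klFun
  set a := ∫⁻ x, ENNReal.ofReal (klFun (f x)) ∂μ with ha
  set b := ∫⁻ x, ENNReal.ofReal (klFun (g x)) ∂μ with hb
  set Q := kernelEnergy μ M (fun x => ENNReal.ofReal (f x)) (fun x => ENNReal.ofReal (f x)) with hQ
  set Q' := kernelEnergy μ M (fun x => ENNReal.ofReal (g x)) (fun x => ENNReal.ofReal (g x)) with hQ'
  set B := kernelEnergy μ M (fun x => ENNReal.ofReal (g x)) (fun x => ENNReal.ofReal (f x)) with hB
  have hat : a ≠ ⊤ := (ENNReal.add_ne_top.1 hE).1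
  have hQt : Q ≠ ⊤ := (ENNReal.add_ne_top.1 hE).2
  have hbt : b ≠ ⊤ := (ENNReal.add_ne_top.1 hEg).1
  have hQt' : Q' ≠ ⊤ := (ENNReal.add_ne_top.1 hEg).2
  -- Positive semidefiniteness bounds the mutual energy by the self-energies, so the comparison
  -- below can be made in real numbers.
  have hBt : B ≠ ⊤ := by
    have h1 := hM.two_mul_le (fun x => ENNReal.ofReal (g x)) (fun x => ENNReal.ofReal (f x))
      (by fun_prop) (by fun_prop) hg.lintegral_ne_top hf.lintegral_ne_top
    intro h
    rw [← hB, h] at h1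
    exact (ENNReal.add_ne_top.2 ⟨hQt', hQt⟩) (top_le_iff.1 (by simpa using h1))
  -- Compare `f` with `(1 - t) f + t g`: the entropy is convex and the energy exactly quadratic, so
  -- after division by `t` only a term linear in `t` remains on the right.
  have key : ∀ t : ℝ, 0 < t → t ≤ 1 → a.toReal + 2 * Q.toReal - (b.toReal + 2 * B.toReal) ≤
      t * (Q.toReal - 2 * B.toReal + Q'.toReal) := by
    intro t ht0 ht1
    have h1t : 0 ≤ 1 - t := sub_nonneg.2 ht1
    have h1 := hmin _ (hf.convexComb hm hg ht0.le ht1)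
    have h2 : ∫⁻ x, ENNReal.ofReal (klFun ((1 - t) * f x + t * g x)) ∂μ ≤
        ENNReal.ofReal (1 - t) * a + ENNReal.ofReal t * b := by
      rw [ha, hb, ← lintegral_const_mul _ (by fun_prop), ← lintegral_const_mul _ (by fun_prop),
        ← lintegral_add_left (by fun_prop)]
      refine lintegral_mono fun x => ?_
      simp only
      rw [← ENNReal.ofReal_mul h1t, ← ENNReal.ofReal_mul ht0.le, ← ENNReal.ofReal_add
        (mul_nonneg h1t (klFun_nonneg (hf.nonneg x)))
        (mul_nonneg ht0.le (klFun_nonneg (hg.nonneg x)))]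
      refine ENNReal.ofReal_le_ofReal ?_
      exact convexOn_klFun.2 (hf.nonneg x) (hg.nonneg x) h1t ht0.le (by ring)
    have h3 : (fun x => ENNReal.ofReal ((1 - t) * f x + t * g x)) = fun x =>
        ENNReal.ofReal (1 - t) * ENNReal.ofReal (f x) + ENNReal.ofReal t * ENNReal.ofReal (g x) := by
      ext x
      rw [← ENNReal.ofReal_mul h1t, ← ENNReal.ofReal_mul ht0.le, ← ENNReal.ofReal_add
        (mul_nonneg h1t (hf.nonneg x)) (mul_nonneg ht0.le (hg.nonneg x))]
    have h4 : freeEnergy μ M (fun x => (1 - t) * f x + t * g x) ≤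
        (ENNReal.ofReal (1 - t) * a + ENNReal.ofReal t * b) +
        (ENNReal.ofReal (1 - t) ^ 2 * Q + 2 * (ENNReal.ofReal (1 - t) * ENNReal.ofReal t) * B +
          ENNReal.ofReal t ^ 2 * Q') := by
      unfold freeEnergy
      refine add_le_add h2 (le_of_eq ?_)
      rw [h3, kernelEnergy_convexComb hM (by fun_prop) (by fun_prop),
        kernelEnergy_comm hM.symm (fun x => ENNReal.ofReal (f x)) (fun x => ENNReal.ofReal (g x))]
    have h5 := h1.trans h4
    unfold freeEnergy at h5
    rw [← ha, ← hQ, ← ENNReal.ofReal_toReal hat, ← ENNReal.ofReal_toReal hbt,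
      ← ENNReal.ofReal_toReal hQt, ← ENNReal.ofReal_toReal hQt', ← ENNReal.ofReal_toReal hBt] at h5
    have h6 : (2 : ℝ≥0∞) = ENNReal.ofReal 2 := by simp
    have a0 : 0 ≤ a.toReal := ENNReal.toReal_nonneg
    have b0 : 0 ≤ b.toReal := ENNReal.toReal_nonneg
    have Q0 : 0 ≤ Q.toReal := ENNReal.toReal_nonneg
    have Q0' : 0 ≤ Q'.toReal := ENNReal.toReal_nonneg
    have B0 : 0 ≤ B.toReal := ENNReal.toReal_nonneg
    rw [h6, ← ENNReal.ofReal_pow h1t, ← ENNReal.ofReal_pow ht0.le, ← ENNReal.ofReal_mul h1t,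
      ← ENNReal.ofReal_mul ht0.le, ← ENNReal.ofReal_mul h1t,
      ← ENNReal.ofReal_mul (by positivity), ← ENNReal.ofReal_mul (by positivity),
      ← ENNReal.ofReal_mul (by positivity), ← ENNReal.ofReal_mul (by positivity),
      ← ENNReal.ofReal_add (by positivity) (by positivity),
      ← ENNReal.ofReal_add (by positivity) (by positivity),
      ← ENNReal.ofReal_add (by positivity) (by positivity),
      ← ENNReal.ofReal_add (by positivity) (by positivity),
      ← ENNReal.ofReal_add (by positivity) (by positivity),
      ENNReal.ofReal_le_ofReal_iff (by positivity)] at h5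
    have h7 : t * (a.toReal + 2 * Q.toReal - (b.toReal + 2 * B.toReal)) ≤
        t * (t * (Q.toReal - 2 * B.toReal + Q'.toReal)) := by nlinarith
    exact le_of_mul_le_mul_left h7 ht0
  have hlim : Tendsto (fun t : ℝ => t * (Q.toReal - 2 * B.toReal + Q'.toReal)) (𝓝[>] 0) (𝓝 0) := by
    have : Tendsto (fun t : ℝ => t * (Q.toReal - 2 * B.toReal + Q'.toReal)) (𝓝 0)
        (𝓝 (0 * (Q.toReal - 2 * B.toReal + Q'.toReal))) :=
      (continuous_id.mul continuous_const).tendsto 0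
    rw [zero_mul] at this
    exact this.mono_left nhdsWithin_le_nhds
  have hfin : a.toReal + 2 * Q.toReal - (b.toReal + 2 * B.toReal) ≤ 0 := by
    refine ge_of_tendsto hlim ?_
    filter_upwards [Ioc_mem_nhdsGT (zero_lt_one' ℝ)] with t ht
    exact key t ht.1 ht.2
  have h6 : (2 : ℝ≥0∞) = ENNReal.ofReal 2 := by simp
  rw [← ENNReal.ofReal_toReal hat, ← ENNReal.ofReal_toReal hbt,
      ← ENNReal.ofReal_toReal hQt, ← ENNReal.ofReal_toReal hBt, h6,
      ← ENNReal.ofReal_mul (by positivity), ← ENNReal.ofReal_mul (by positivity),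
      ← ENNReal.ofReal_add (by positivity) (by positivity),
      ← ENNReal.ofReal_add (by positivity) (by positivity)]
  exact ENNReal.ofReal_le_ofReal (by linarith)

/-- Supplies admissible competitors: bounded functions supported in one set of the exhaustion. The
entropy is bounded on a finite measure, and the energy is at most that of a multiple of the
indicator. -/
theorem freeEnergy_ne_top_of_bounded (hM : IsEnergyKernel μ M S) {f : X → ℝ} {n : ℕ} {a : ℝ}
    (hf0 : ∀ x, 0 ≤ f x) (hf : ∀ x, f x ≤ (S n).indicator (fun _ => a) x) :
    freeEnergy μ M f ≠ ⊤ := by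
  have ha : ∀ x, f x ≤ |a| := fun x => (hf x).trans
    ((le_abs_self _).trans (by
      by_cases hx : x ∈ S n <;> simp [hx]))
  refine ENNReal.add_ne_top.2 ⟨?_, ?_⟩
  · refine ((lintegral_mono fun x => ENNReal.ofReal_le_ofReal
      ((klFun_le_one_add_sq (hf0 x)).trans
        (add_le_add_right (pow_le_pow_left₀ (hf0 x) (ha x) 2) 1))).trans_lt ?_).ne
    rw [lintegral_const]
    exact ENNReal.mul_lt_top ENNReal.ofReal_lt_top (measure_lt_top _ _)
  · refine kernelEnergy_const_indicator_ne_top hM (n := n) (a := ENNReal.ofReal |a|)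
      ENNReal.ofReal_ne_top fun x => ?_
    by_cases hx : x ∈ S n
    · simpa [hx] using ENNReal.ofReal_le_ofReal (ha x)
    · have := hf x
      simp only [hx, not_false_eq_true, Set.indicator_of_notMem] at this ⊢
      simp [ENNReal.ofReal_of_nonpos this]

/-- The mutual energy of `f` with the indicator of `S n` is finite by positive semidefiniteness, and
it is the integral of the potential over `S n`. -/
theorem ae_kernelPotential_ne_top (hM : IsEnergyKernel μ M S) {f : X → ℝ}
    (hf : IsDensity μ m f) (hE : freeEnergy μ M f ≠ ⊤) :
    ∀ᵐ x ∂μ, kernelPotential μ M (fun x => ENNReal.ofReal (f x)) x ≠ ⊤ := by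
  have mf := hf.measurable
  have h1 : ∀ n, ∀ᵐ x ∂μ, x ∈ S n →
      kernelPotential μ M (fun x => ENNReal.ofReal (f x)) x ≠ ⊤ := by
    intro n
    have hmS : Measurable ((S n).indicator (1 : X → ℝ≥0∞)) :=
      measurable_one.indicator (hM.measurableSet n)
    have h2 := hM.two_mul_le ((S n).indicator 1) (fun x => ENNReal.ofReal (f x)) hmS (by fun_prop)
      (by
        rw [lintegral_indicator (hM.measurableSet n)]
        simp) hf.lintegral_ne_top
    have h3 : kernelEnergy μ M ((S n).indicator 1) (fun x => ENNReal.ofReal (f x)) ≠ ⊤ := by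
      intro h
      rw [h] at h2
      exact (ENNReal.add_ne_top.2 ⟨hM.energy_ne_top n, (ENNReal.add_ne_top.1 hE).2⟩)
        (top_le_iff.1 (by simpa using h2))
    rw [kernelEnergy_eq_lintegral_mul_potential hM.measurable hmS (by fun_prop)] at h3
    filter_upwards [ae_lt_top (hmS.mul (measurable_kernelPotential hM.measurable
      (by fun_prop))) h3] with x hx hxS
    simpa [hxS] using hx.ne
  filter_upwards [ae_all_iff.2 h1] with x hx
  obtain ⟨n, hn⟩ := Set.mem_iUnion.1 (hM.iUnion.symm ▸ Set.mem_univ x)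
  exact hx n hn

/-- Existence of a self-consistent Gibbs density `f = exp (2 (c - ∫ M f))` of prescribed mass, for
a positive semidefinite interaction kernel `M`. -/
theorem exists_gibbs_density (hM : IsEnergyKernel μ M S) (hμ : μ ≠ 0) (hm : 0 < m) :
    ∃ (f : X → ℝ) (c : ℝ), IsDensity μ m f ∧
      f =ᵐ[μ] fun x => Real.exp
        (2 * (c - (kernelPotential μ M (fun x => ENNReal.ofReal (f x)) x).toReal)) := by
  obtain ⟨N, hN⟩ := measure_ne_zero_of_exhaustion hM hμ
  have hSpos : ∀ n, N ≤ n → 0 < μ.real (S n) := fun n hn =>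
    ENNReal.toReal_pos (hN n hn) (measure_ne_top _ _)
  have hf₀ : IsDensity μ m ((S N).indicator fun _ => m / μ.real (S N)) := by
    have h0 : 0 ≤ m / μ.real (S N) := div_nonneg hm.le (hSpos N le_rfl).le
    refine ⟨measurable_const.indicator (hM.measurableSet N),
      fun x => Set.indicator_nonneg (fun _ _ => h0) x, ?_⟩
    rw [← ofReal_integral_eq_lintegral_ofReal
      ((integrable_const _).indicator (hM.measurableSet N))
      (Eventually.of_forall fun x => Set.indicator_nonneg (fun _ _ => h0) x),
      integral_indicator (hM.measurableSet N), setIntegral_const, smul_eq_mul,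
      mul_div_cancel₀ _ (hSpos N le_rfl).ne']
  obtain ⟨f, hf, hE, hmin⟩ := exists_freeEnergy_minimizer hM hm.le hf₀
    (freeEnergy_ne_top_of_bounded hM hf₀.nonneg fun x => le_rfl)
  have mf := hf.measurable
  have mk := measurable_klFun
  set pot := kernelPotential μ M (fun x => ENNReal.ofReal (f x)) with hpot
  have mpot : Measurable pot := measurable_kernelPotential hM.measurable (by fun_prop)
  have hpt : ∀ᵐ x ∂μ, pot x ≠ ⊤ := ae_kernelPotential_ne_top hM hf hE
  set P : X → ℝ := fun x => (pot x).toReal with hP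
  have mP : Measurable P := mpot.ennreal_toReal
  have P0 : ∀ x, 0 ≤ P x := fun x => ENNReal.toReal_nonneg
  -- The unnormalised Gibbs weight of the potential of the minimiser. The goal is to show that `f`
  -- is its normalisation.
  set g₀ : X → ℝ := fun x => Real.exp (-2 * P x) with hg₀
  have mg₀ : Measurable g₀ := by fun_prop
  have g₀pos : ∀ x, 0 < g₀ x := fun x => Real.exp_pos _
  have g₀le : ∀ x, g₀ x ≤ 1 := fun x => Real.exp_le_one_iff.2 (by linarith [P0 x])
  -- The bound `P e^{-2P} ≤ 1` keeps the interaction term bounded although `P` need not be.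
  have Pg₀ : ∀ x, P x * g₀ x ≤ 1 := fun x => by
    have h1 := Real.add_one_le_exp (2 * P x)
    have h2 : g₀ x * Real.exp (2 * P x) = 1 := by
      rw [hg₀, ← Real.exp_add]
      simp
    nlinarith [g₀pos x, P0 x, mul_nonneg (P0 x) (g₀pos x).le]
  have ig₀ : Integrable g₀ μ := Integrable.of_bound mg₀.aestronglyMeasurable 1
    (Eventually.of_forall fun x => by
      rw [Real.norm_of_nonneg (g₀pos x).le]
      exact g₀le x)
  -- The minimality inequality needs competitors of finite free energy. The Gibbs density is
  -- therefore truncated to `S n`, renormalised by `Z n`, and recovered as `n → ∞`; since `Z n ≥ Z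
  -- N`, all truncations obey bounds depending only on `Λ`.
  set Z : ℕ → ℝ := fun n => ∫ x in S n, g₀ x ∂μ with hZ
  have Zpos : ∀ n, N ≤ n → 0 < Z n := fun n hn =>
    (setIntegral_pos_iff_support_of_nonneg_ae (Eventually.of_forall fun x => (g₀pos x).le)
      ig₀.integrableOn).2 (by
        have : Function.support g₀ = Set.univ := Set.eq_univ_of_forall fun x => (g₀pos x).ne'
        rw [this, Set.univ_inter]
        exact pos_iff_ne_zero.2 (hN n hn))
  have Zmono : ∀ n, N ≤ n → Z N ≤ Z n := fun n hn =>
    setIntegral_mono_set ig₀.integrableOn (Eventually.of_forall fun x => (g₀pos x).le)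
      (hM.mono hn).eventuallyLE
  set Zi : ℝ := ∫ x, g₀ x ∂μ with hZi
  have Zlim : Tendsto Z atTop (𝓝 Zi) := by
    have := tendsto_setIntegral_of_monotone (μ := μ) (f := g₀) hM.measurableSet hM.mono
      (by rw [hM.iUnion]; exact ig₀.integrableOn)
    rwa [hM.iUnion, setIntegral_univ] at this
  have Zipos : 0 < Zi := lt_of_lt_of_le (Zpos N le_rfl) (setIntegral_le_integral ig₀
    (Eventually.of_forall fun x => (g₀pos x).le))
  set Λ : ℝ := m / Z N with hΛ
  have Λ0 : 0 ≤ Λ := div_nonneg hm.le (Zpos N le_rfl).le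
  set G : ℕ → X → ℝ := fun n => (S n).indicator fun x => m / Z n * g₀ x with hG
  have G0 : ∀ n, N ≤ n → ∀ x, 0 ≤ G n x := fun n hn x => Set.indicator_nonneg (fun x _ =>
    mul_nonneg (div_nonneg hm.le (Zpos n hn).le) (g₀pos x).le) x
  have mG : ∀ n, Measurable (G n) := fun n =>
    Measurable.indicator (by fun_prop) (hM.measurableSet n)
  have Gle : ∀ n, N ≤ n → ∀ x, G n x ≤ Λ * g₀ x := fun n hn x => by
    refine Set.indicator_apply_le' (fun _ => ?_) fun _ => mul_nonneg Λ0 (g₀pos x).le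
    refine mul_le_mul_of_nonneg_right ?_ (g₀pos x).le
    exact div_le_div_of_nonneg_left hm.le (Zpos N le_rfl) (Zmono n hn)
  have Gle' : ∀ n, N ≤ n → ∀ x, G n x ≤ Λ := fun n hn x =>
    (Gle n hn x).trans (mul_le_of_le_one_right Λ0 (g₀le x))
  have GP : ∀ n, N ≤ n → ∀ x, G n x * P x ≤ Λ := fun n hn x => by
    have h1 := mul_le_mul_of_nonneg_right (Gle n hn x) (P0 x)
    have h2 := mul_le_mul_of_nonneg_left (Pg₀ x) Λ0
    nlinarith
  have hGd : ∀ n, N ≤ n → IsDensity μ m (G n) := fun n hn => by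
    refine ⟨mG n, G0 n hn, ?_⟩
    rw [← ofReal_integral_eq_lintegral_ofReal
      ((ig₀.const_mul _).indicator (hM.measurableSet n)) (Eventually.of_forall (G0 n hn)),
      integral_indicator (hM.measurableSet n), integral_const_mul,
      div_mul_cancel₀ _ (Zpos n hn).ne']
  have hpint : ∀ {h : X → ℝ}, Measurable h → (∀ x, 0 ≤ h x) →
      kernelEnergy μ M (fun x => ENNReal.ofReal (h x)) (fun x => ENNReal.ofReal (f x)) =
      ∫⁻ x, ENNReal.ofReal (h x * P x) ∂μ := fun {h} mh h0 => by
    rw [kernelEnergy_eq_lintegral_mul_potential hM.measurable (by fun_prop) (by fun_prop)]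
    refine lintegral_congr_ae ?_
    filter_upwards [hpt] with x hx
    rw [ENNReal.ofReal_mul (h0 x), hP, ENNReal.ofReal_toReal hx]
  have ikf : Integrable (fun x => klFun (f x)) μ := by
    refine ⟨by fun_prop, ?_⟩
    rw [hasFiniteIntegral_iff_ofReal (Eventually.of_forall fun x => klFun_nonneg (hf.nonneg x))]
    exact (ENNReal.add_ne_top.1 hE).1.lt_top
  have ifP : Integrable (fun x => f x * P x) μ := by
    refine ⟨by fun_prop, ?_⟩
    rw [hasFiniteIntegral_iff_ofReal (Eventually.of_forall fun x => mul_nonneg (hf.nonneg x) (P0 x)),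
      ← hpint mf hf.nonneg]
    exact (ENNReal.add_ne_top.1 hE).2.lt_top
  have hklG : ∀ n, N ≤ n → ∀ x, klFun (G n x) ≤ 1 + Λ ^ 2 := fun n hn x =>
    (klFun_le_one_add_sq (G0 n hn x)).trans
      (add_le_add_right (pow_le_pow_left₀ (G0 n hn x) (Gle' n hn x) 2) 1)
  have ikG : ∀ n, N ≤ n → Integrable (fun x => klFun (G n x)) μ := fun n hn =>
    Integrable.of_bound (measurable_klFun.comp (mG n)).aestronglyMeasurable (1 + Λ ^ 2)
      (Eventually.of_forall fun x => by
        rw [Real.norm_of_nonneg (klFun_nonneg (G0 n hn x))]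
        exact hklG n hn x)
  have iGP : ∀ n, N ≤ n → Integrable (fun x => G n x * P x) μ := fun n hn =>
    Integrable.of_bound ((mG n).mul mP).aestronglyMeasurable Λ
      (Eventually.of_forall fun x => by
        rw [Real.norm_of_nonneg (mul_nonneg (G0 n hn x) (P0 x))]
        exact GP n hn x)
  have hlin : ∀ n, N ≤ n → (∫ x, (klFun (f x) + 2 * (f x * P x)) ∂μ) ≤
      ∫ x, (klFun (G n x) + 2 * (G n x * P x)) ∂μ := fun n hn => by
    have h1 := linearized_le_of_minimizer hM hm.le hf hE hmin (hGd n hn)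
      (freeEnergy_ne_top_of_bounded hM (G0 n hn) (n := n) (a := Λ) fun x => by
        by_cases hx : x ∈ S n
        · rw [Set.indicator_of_mem hx]
          exact Gle' n hn x
        · rw [Set.indicator_of_notMem hx, hG]
          simp [hx])
    have h6 : (2 : ℝ≥0∞) = ENNReal.ofReal 2 := by simp
    have j1 : 0 ≤ ∫ x, klFun (f x) ∂μ := integral_nonneg fun x => klFun_nonneg (hf.nonneg x)
    have j2 : 0 ≤ ∫ x, klFun (G n x) ∂μ := integral_nonneg fun x => klFun_nonneg (G0 n hn x)
    have j3 : 0 ≤ ∫ x, f x * P x ∂μ := integral_nonneg fun x => mul_nonneg (hf.nonneg x) (P0 x)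
    have j4 : 0 ≤ ∫ x, G n x * P x ∂μ := integral_nonneg fun x => mul_nonneg (G0 n hn x) (P0 x)
    rw [hpint mf hf.nonneg, hpint (mG n) (G0 n hn),
      ← ofReal_integral_eq_lintegral_ofReal ikf
        (Eventually.of_forall fun x => klFun_nonneg (hf.nonneg x)),
      ← ofReal_integral_eq_lintegral_ofReal ifP
        (Eventually.of_forall fun x => mul_nonneg (hf.nonneg x) (P0 x)),
      ← ofReal_integral_eq_lintegral_ofReal (ikG n hn)
        (Eventually.of_forall fun x => klFun_nonneg (G0 n hn x)),
      ← ofReal_integral_eq_lintegral_ofReal (iGP n hn)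
        (Eventually.of_forall fun x => mul_nonneg (G0 n hn x) (P0 x)),
      h6, ← ENNReal.ofReal_mul (by norm_num), ← ENNReal.ofReal_mul (by norm_num),
      ← ENNReal.ofReal_add j1 (by positivity), ← ENNReal.ofReal_add j2 (by positivity),
      ENNReal.ofReal_le_ofReal_iff (by positivity)] at h1
    rw [integral_add ikf (ifP.const_mul 2), integral_add (ikG n hn) ((iGP n hn).const_mul 2),
      integral_const_mul, integral_const_mul]
    exact h1
  set g : X → ℝ := fun x => m / Zi * g₀ x with hg
  have gpos : ∀ x, 0 < g x := fun x => mul_pos (div_pos hm Zipos) (g₀pos x)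
  have Glim : ∀ x, Tendsto (fun n => G n x) atTop (𝓝 (g x)) := fun x => by
    have h1 : Tendsto (fun n => m / Z n * g₀ x) atTop (𝓝 (g x)) :=
      (tendsto_const_nhds.div Zlim Zipos.ne').mul_const _
    refine h1.congr' ?_
    obtain ⟨k, hk⟩ := Set.mem_iUnion.1 (hM.iUnion.symm ▸ Set.mem_univ x)
    filter_upwards [eventually_ge_atTop k] with n hn
    exact (Set.indicator_of_mem (hM.mono hn hk) fun x => m / Z n * g₀ x).symm
  have hlim : Tendsto (fun n => ∫ x, (klFun (G n x) + 2 * (G n x * P x)) ∂μ) atTop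
      (𝓝 (∫ x, (klFun (g x) + 2 * (g x * P x)) ∂μ)) := by
    refine tendsto_integral_filter_of_dominated_convergence (fun _ => 1 + Λ ^ 2 + 2 * Λ) ?_ ?_
      (integrable_const _) ?_
    · refine Eventually.of_forall fun n => ?_
      have := mG n
      exact Measurable.aestronglyMeasurable (by fun_prop)
    · filter_upwards [eventually_ge_atTop N] with n hn
      refine Eventually.of_forall fun x => ?_
      rw [Real.norm_of_nonneg (add_nonneg (klFun_nonneg (G0 n hn x))
        (mul_nonneg zero_le_two (mul_nonneg (G0 n hn x) (P0 x))))]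
      exact add_le_add (hklG n hn x) (mul_le_mul_of_nonneg_left (GP n hn x) zero_le_two)
    · refine Eventually.of_forall fun x => ?_
      exact ((continuous_klFun.tendsto _).comp (Glim x)).add
        (((Glim x).mul_const _).const_mul 2)
  have hfin : (∫ x, (klFun (f x) + 2 * (f x * P x)) ∂μ) ≤
      ∫ x, (klFun (g x) + 2 * (g x * P x)) ∂μ := by
    refine ge_of_tendsto hlim ?_
    filter_upwards [eventually_ge_atTop N] with n hn
    exact hlin n hn
  have gleΛ : ∀ x, g x ≤ Λ := fun x => le_of_tendsto (Glim x) (by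
    filter_upwards [eventually_ge_atTop N] with n hn
    exact Gle' n hn x)
  have gPle : ∀ x, g x * P x ≤ Λ := fun x => le_of_tendsto ((Glim x).mul_const _) (by
    filter_upwards [eventually_ge_atTop N] with n hn
    exact GP n hn x)
  have mg : Measurable g := by fun_prop
  have ig : Integrable g μ := ig₀.const_mul _
  have ikg : Integrable (fun x => klFun (g x)) μ :=
    Integrable.of_bound (measurable_klFun.comp mg).aestronglyMeasurable (1 + Λ ^ 2)
      (Eventually.of_forall fun x => by
        rw [Real.norm_of_nonneg (klFun_nonneg (gpos x).le)]
        exact (klFun_le_one_add_sq (gpos x).le).trans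
          (add_le_add_right (pow_le_pow_left₀ (gpos x).le (gleΛ x) 2) 1))
  have igP : Integrable (fun x => g x * P x) μ :=
    Integrable.of_bound (mg.mul mP).aestronglyMeasurable Λ (Eventually.of_forall fun x => by
      rw [Real.norm_of_nonneg (mul_nonneg (gpos x).le (P0 x))]
      exact gPle x)
  have hmg : ∫ x, g x ∂μ = m := by
    rw [hg, integral_const_mul, ← hZi, div_mul_cancel₀ _ Zipos.ne']
  set c : ℝ := Real.log (m / Zi) / 2 with hc
  have hlogg : ∀ x, Real.log (g x) = 2 * c - 2 * P x := fun x => by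
    rw [hg, Real.log_mul (div_pos hm Zipos).ne' (g₀pos x).ne', hg₀, Real.log_exp, hc]
    ring
  -- The last term is the Lagrange multiplier; it integrates to `0` because both masses are `m`. As
  -- `log g = 2c - 2P`, `Φ` is the Bregman divergence of the entropy between `f` and `g`, so it
  -- dominates a square, while the linearised inequality makes its integral nonpositive.
  set Φ : X → ℝ := fun x => (klFun (f x) + 2 * (f x * P x)) - (klFun (g x) + 2 * (g x * P x)) -
    2 * c * (f x - g x) with hΦ
  have hΦge : ∀ x, (√(f x) - √(g x)) ^ 2 ≤ Φ x := fun x => by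
    have := sq_sqrt_sub_sqrt_le_klFun (hf.nonneg x) (gpos x)
    rw [hlogg] at this
    rw [hΦ]
    linarith
  have i1 : Integrable (fun x => klFun (f x) + 2 * (f x * P x)) μ := ikf.add (ifP.const_mul 2)
  have i2 : Integrable (fun x => klFun (g x) + 2 * (g x * P x)) μ := ikg.add (igP.const_mul 2)
  have i3 : Integrable (fun x => 2 * c * (f x - g x)) μ := (hf.integrable.sub ig).const_mul _
  have iΦ : Integrable Φ μ := (i1.sub i2).sub i3
  have hΦint : ∫ x, Φ x ∂μ ≤ 0 := by
    have h1 : ∫ x, Φ x ∂μ = (∫ x, (klFun (f x) + 2 * (f x * P x)) ∂μ) -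
        (∫ x, (klFun (g x) + 2 * (g x * P x)) ∂μ) - ∫ x, 2 * c * (f x - g x) ∂μ := by
      rw [← integral_sub i1 i2]
      exact integral_sub (i1.sub i2) i3
    rw [h1, integral_const_mul, integral_sub hf.integrable ig, hf.integral_eq hm.le, hmg]
    linarith
  have hΦ0 : Φ =ᵐ[μ] 0 := by
    rw [← integral_eq_zero_iff_of_nonneg (fun x => (sq_nonneg _).trans (hΦge x)) iΦ]
    exact le_antisymm hΦint (integral_nonneg fun x => (sq_nonneg _).trans (hΦge x))
  refine ⟨f, c, hf, ?_⟩
  filter_upwards [hΦ0] with x hx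
  have h1 := hΦge x
  rw [hx] at h1
  have h2 : √(f x) - √(g x) = 0 := pow_eq_zero_iff two_ne_zero |>.1 (le_antisymm h1 (sq_nonneg _))
  have h3 : f x = g x := (Real.sqrt_inj (hf.nonneg x) (gpos x).le).1 (by linarith)
  rw [h3, ← Real.exp_log (gpos x), hlogg]
  congr 1
  ring

end Variational

/-! ### The logarithmic kernel of the sphere and its positivity -/

/-- The squared chordal distance, after stereographic projection, on the plane. -/
noncomputable def chordalSq (z : Plane × Plane) : ℝ :=
  ‖z.1 - z.2‖ ^ 2 / ((1 + ‖z.1‖ ^ 2) * (1 + ‖z.2‖ ^ 2))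

/-- The logarithmic kernel of the sphere, read on the plane. -/
noncomputable def sphericalKernel (z : Plane × Plane) : ℝ :=
  -(4 * Real.pi)⁻¹ * Real.log (chordalSq z)

/-- A feature map for the kernel `1 - chordalSq`. -/
noncomputable def sphericalFeature (x : Plane) : Fin 4 → ℝ :=
  ![1 / (1 + ‖x‖ ^ 2), ‖x‖ ^ 2 / (1 + ‖x‖ ^ 2), √2 * x 0 / (1 + ‖x‖ ^ 2), √2 * x 1 / (1 + ‖x‖ ^ 2)]

theorem plane_norm_sq (x : Plane) : ‖x‖ ^ 2 = x 0 ^ 2 + x 1 ^ 2 := by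
  rw [EuclideanSpace.real_norm_sq_eq, Fin.sum_univ_two]

theorem chordalSq_nonneg (z : Plane × Plane) : 0 ≤ chordalSq z := by
  unfold chordalSq
  positivity

/-- The difference of the two sides is `(1 + x·y)² + (x₀y₁ - x₁y₀)²`. -/
theorem norm_sub_sq_le (x y : Plane) : ‖x - y‖ ^ 2 ≤ (1 + ‖x‖ ^ 2) * (1 + ‖y‖ ^ 2) := by
  rw [plane_norm_sq, plane_norm_sq, plane_norm_sq]
  simp only [PiLp.sub_apply]
  nlinarith [sq_nonneg (1 + x 0 * y 0 + x 1 * y 1), sq_nonneg (x 0 * y 1 - x 1 * y 0)]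

theorem chordalSq_le_one (z : Plane × Plane) : chordalSq z ≤ 1 := by
  unfold chordalSq
  exact div_le_one_of_le₀ (norm_sub_sq_le _ _) (by positivity)

theorem chordalSq_pos {z : Plane × Plane} (hz : z.1 ≠ z.2) : 0 < chordalSq z := by
  have : 0 < ‖z.1 - z.2‖ := norm_pos_iff.2 (sub_ne_zero.2 hz)
  unfold chordalSq
  positivity

/-- The numerator equals `1 + |x|²|y|² + 2 x·y`, a sum of products of features. All positivity of
the logarithmic kernel comes from this Gram representation. -/
theorem one_sub_chordalSq (z : Plane × Plane) :
    1 - chordalSq z = ∑ i, sphericalFeature z.1 i * sphericalFeature z.2 i := by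
  obtain ⟨x, y⟩ := z
  have h1 : 1 + (x 0 ^ 2 + x 1 ^ 2) ≠ 0 := by positivity
  have h2 : 1 + (y 0 ^ 2 + y 1 ^ 2) ≠ 0 := by positivity
  have h3 : √2 ^ 2 = 2 := Real.sq_sqrt zero_le_two
  simp only [chordalSq, sphericalFeature, Fin.sum_univ_four, plane_norm_sq, PiLp.sub_apply,
    Matrix.cons_val]
  field_simp
  rw [h3]
  ring

theorem continuous_sphericalFeature : Continuous sphericalFeature := by
  have h : ∀ x : Plane, 1 + ‖x‖ ^ 2 ≠ 0 := fun x => by positivity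
  have h0 : Continuous fun x : Plane => x 0 := by fun_prop
  have h1 : Continuous fun x : Plane => x 1 := by fun_prop
  refine continuous_pi fun i => ?_
  fin_cases i <;> simp only [sphericalFeature] <;> simp <;> fun_prop (disch := exact h _)

/-- On the diagonal the chordal distance vanishes, so the squares of the features add up to `1`. -/
theorem abs_sphericalFeature_le_one (x : Plane) (i : Fin 4) : |sphericalFeature x i| ≤ 1 := by
  have h := one_sub_chordalSq (x, x)
  simp only [chordalSq, sub_self, norm_zero, ne_eq, OfNat.ofNat_ne_zero, not_false_eq_true,
    zero_pow, zero_div, sub_zero] at h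
  have h2 : sphericalFeature x i * sphericalFeature x i ≤
      ∑ j, sphericalFeature x j * sphericalFeature x j :=
    Finset.single_le_sum (fun j _ => mul_self_nonneg _) (Finset.mem_univ i)
  exact abs_le_one_iff_mul_self_le_one.2 (h ▸ h2)

theorem measurable_chordalSq : Measurable chordalSq := by
  unfold chordalSq
  fun_prop

theorem measurable_sphericalKernel : Measurable sphericalKernel :=
  (Real.measurable_log.comp measurable_chordalSq).const_mul _

theorem sphericalKernel_nonneg (z : Plane × Plane) : 0 ≤ sphericalKernel z := by
  unfold sphericalKernel
  have := Real.log_nonpos (chordalSq_nonneg z) (chordalSq_le_one z)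
  have := Real.pi_pos
  have : 0 ≤ (4 * Real.pi)⁻¹ := by positivity
  nlinarith

/-- Power series of the spherical kernel off the diagonal. -/
theorem ofReal_sphericalKernel_eq_tsum {z : Plane × Plane} (hz : z.1 ≠ z.2) :
    ENNReal.ofReal (sphericalKernel z) =
      ∑' k : ℕ, ENNReal.ofReal ((4 * Real.pi)⁻¹ / (k + 1)) *
        ENNReal.ofReal ((1 - chordalSq z) ^ (k + 1)) := by
  have hp := Real.pi_pos
  have h0 := chordalSq_pos hz
  have h1 := chordalSq_le_one z
  have hs := Real.hasSum_pow_div_log_of_abs_lt_one (x := 1 - chordalSq z) (by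
    rw [abs_lt]
    constructor <;> linarith)
  rw [sub_sub_cancel] at hs
  have hs' := hs.mul_left (4 * Real.pi)⁻¹
  have hn : ∀ k : ℕ, 0 ≤ (1 - chordalSq z) ^ (k + 1) := fun k => pow_nonneg (by linarith) _
  have he : sphericalKernel z = (4 * Real.pi)⁻¹ * -Real.log (chordalSq z) := by
    unfold sphericalKernel
    ring
  rw [he, ← hs'.tsum_eq, ENNReal.ofReal_tsum_of_nonneg (fun k => by
    have := hn k
    positivity) hs'.summable]
  refine tsum_congr fun k => ?_
  rw [← ENNReal.ofReal_mul (by positivity)]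
  congr 1
  ring

/-- Powers of `1 - chordalSq` are positive semidefinite, in polarised form. -/
theorem two_mul_lintegral_one_sub_chordalSq_pow_le (ν ν' : Measure Plane) [IsFiniteMeasure ν]
    [IsFiniteMeasure ν'] (k : ℕ) :
    2 * ∫⁻ z, ENNReal.ofReal ((1 - chordalSq z) ^ k) ∂(ν.prod ν') ≤
      (∫⁻ z, ENNReal.ofReal ((1 - chordalSq z) ^ k) ∂(ν.prod ν)) +
      ∫⁻ z, ENNReal.ofReal ((1 - chordalSq z) ^ k) ∂(ν'.prod ν') := by
  set a : (Fin k → Fin 4) → Plane → ℝ := fun p x => ∏ j, sphericalFeature x (p j) with ha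
  have hac : ∀ p, Continuous (a p) := fun p => by
    refine continuous_finsetProd _ fun j _ => ?_
    exact (continuous_apply (p j)).comp continuous_sphericalFeature
  have hab : ∀ p x, ‖a p x‖ ≤ 1 := fun p x => by
    rw [ha, Real.norm_eq_abs, Finset.abs_prod]
    exact Finset.prod_le_one (fun _ _ => abs_nonneg _) fun j _ => abs_sphericalFeature_le_one _ _
  -- The `k`-th power of a four-term Gram kernel is a Gram kernel whose features are indexed by
  -- words of length `k`; integrating turns it into a sum of products of numbers.
  have hexp : ∀ z, (1 - chordalSq z) ^ k = ∑ p, a p z.1 * a p z.2 := fun z => by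
    rw [one_sub_chordalSq, Fintype.sum_pow]
    exact Finset.sum_congr rfl fun p _ => Finset.prod_mul_distrib
  have hint : ∀ (σ τ : Measure Plane) [IsFiniteMeasure σ] [IsFiniteMeasure τ],
      ∫⁻ z, ENNReal.ofReal ((1 - chordalSq z) ^ k) ∂(σ.prod τ) =
        ENNReal.ofReal (∑ p, (∫ x, a p x ∂σ) * ∫ x, a p x ∂τ) := by
    intro σ τ _ _
    have hi : ∀ p, Integrable (fun z : Plane × Plane => a p z.1 * a p z.2) (σ.prod τ) := fun p =>
      Integrable.of_bound (by
        have := hac p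
        exact Continuous.aestronglyMeasurable (by fun_prop)) 1 (Eventually.of_forall fun z => by
          rw [norm_mul]
          exact mul_le_one₀ (hab p _) (norm_nonneg _) (hab p _))
    rw [← ofReal_integral_eq_lintegral_ofReal]
    · simp_rw [hexp]
      rw [integral_finsetSum _ fun p _ => hi p]
      congr 1
      exact Finset.sum_congr rfl fun p _ => integral_prod_mul _ _
    · simp_rw [hexp]
      exact integrable_finsetSum _ fun p _ => hi p
    · exact Eventually.of_forall fun z => pow_nonneg (by linarith [chordalSq_le_one z]) _
  rw [hint, hint, hint]
  have h2 : ∀ r : ℝ, 2 * ENNReal.ofReal r = ENNReal.ofReal (2 * r) := fun r => by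
    rw [ENNReal.ofReal_mul zero_le_two]
    simp
  rw [h2,
    ← ENNReal.ofReal_add (Finset.sum_nonneg fun p _ => mul_self_nonneg _)
      (Finset.sum_nonneg fun p _ => mul_self_nonneg _)]
  refine ENNReal.ofReal_le_ofReal ?_
  rw [Finset.mul_sum, ← Finset.sum_add_distrib]
  refine Finset.sum_le_sum fun p _ => ?_
  nlinarith [sq_nonneg ((∫ x, a p x ∂ν) - ∫ x, a p x ∂ν')]

theorem ae_prod_fst_ne_snd (μ : Measure Plane) [SFinite μ] [NullSingletonClass μ] :
    ∀ᵐ z ∂(μ.prod μ), z.1 ≠ z.2 := by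
  have hm : MeasurableSet {z : Plane × Plane | z.1 = z.2} :=
    (isClosed_eq continuous_fst continuous_snd).measurableSet
  have h : (μ.prod μ) {z | z.1 = z.2} = 0 := by
    rw [Measure.measure_prod_null hm]
    refine Eventually.of_forall fun x => ?_
    have : Prod.mk x ⁻¹' {z : Plane × Plane | z.1 = z.2} = {x} := by
      ext y
      simp [eq_comm]
    simp only [this, measure_singleton, Pi.zero_apply]
  simpa [ae_iff] using h

/-- The power series of `-log (1 - t)` has nonnegative coefficients, and each power of `1 -
chordalSq` is positive semidefinite. The series is used only off the diagonal, which is null because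
`μ` has no atoms. -/
theorem sphericalKernel_two_mul_kernelEnergy_le (μ : Measure Plane) [SFinite μ] [NullSingletonClass μ]
    {F G : Plane → ℝ≥0∞} (hF : Measurable F) (hG : Measurable G) (hFm : ∫⁻ x, F x ∂μ ≠ ⊤)
    (hGm : ∫⁻ x, G x ∂μ ≠ ⊤) :
    2 * kernelEnergy μ (fun z => ENNReal.ofReal (sphericalKernel z)) F G ≤
      kernelEnergy μ (fun z => ENNReal.ofReal (sphericalKernel z)) F F +
      kernelEnergy μ (fun z => ENNReal.ofReal (sphericalKernel z)) G G := by
  have hmc := measurable_chordalSq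
  have key : ∀ {F G : Plane → ℝ≥0∞}, Measurable F → Measurable G →
      kernelEnergy μ (fun z => ENNReal.ofReal (sphericalKernel z)) F G =
      ∑' k : ℕ, ENNReal.ofReal ((4 * Real.pi)⁻¹ / (k + 1)) *
        ∫⁻ z, ENNReal.ofReal ((1 - chordalSq z) ^ (k + 1))
          ∂((μ.withDensity F).prod (μ.withDensity G)) := by
    intro F G hF hG
    have h1 : kernelEnergy μ (fun z => ENNReal.ofReal (sphericalKernel z)) F G =
        ∫⁻ z, ∑' k : ℕ, ENNReal.ofReal ((4 * Real.pi)⁻¹ / (k + 1)) *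
          (F z.1 * G z.2 * ENNReal.ofReal ((1 - chordalSq z) ^ (k + 1))) ∂(μ.prod μ) := by
      refine lintegral_congr_ae ?_
      filter_upwards [ae_prod_fst_ne_snd μ] with z hz
      rw [ofReal_sphericalKernel_eq_tsum hz, ← ENNReal.tsum_mul_right]
      exact tsum_congr fun k => by ring
    rw [h1, lintegral_tsum fun k => by fun_prop]
    refine tsum_congr fun k => ?_
    rw [lintegral_const_mul _ (by fun_prop), prod_withDensity hF hG,
      lintegral_withDensity_eq_lintegral_mul _ (by fun_prop) (by fun_prop)]
    rfl
  have : IsFiniteMeasure (μ.withDensity F) := isFiniteMeasure_withDensity hFm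
  have : IsFiniteMeasure (μ.withDensity G) := isFiniteMeasure_withDensity hGm
  rw [key hF hG, key hF hF, key hG hG, ← ENNReal.tsum_mul_left, ← ENNReal.tsum_add]
  refine ENNReal.tsum_le_tsum fun k => ?_
  rw [← mul_add, mul_left_comm]
  gcongr
  exact two_mul_lintegral_one_sub_chordalSq_pow_le _ _ _

/-! ### Integrable singularities and finite energy of the spherical kernel -/

/-- The logarithmic weight `log √(1 + |x|²)`. -/
noncomputable def logWeight (x : Plane) : ℝ := Real.log (1 + ‖x‖ ^ 2) / 2

/-- The integrable singularity `|z|^(-3/2)`. -/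
noncomputable def singularity (z : Plane) : ℝ := ‖z‖ ^ (-(3 / 2) : ℝ)

theorem logWeight_nonneg (x : Plane) : 0 ≤ logWeight x :=
  div_nonneg (Real.log_nonneg (by nlinarith [sq_nonneg ‖x‖])) zero_le_two

theorem continuous_logWeight : Continuous logWeight := by
  unfold logWeight
  have : ∀ x : Plane, 1 + ‖x‖ ^ 2 ≠ 0 := fun x => by positivity
  fun_prop (disch := exact this _)

theorem singularity_nonneg (z : Plane) : 0 ≤ singularity z := Real.rpow_nonneg (norm_nonneg _) _

theorem measurable_singularity : Measurable singularity := by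
  unfold singularity
  fun_prop

theorem singularity_le_one {z : Plane} (hz : 1 ≤ ‖z‖) : singularity z ≤ 1 :=
  Real.rpow_le_one_of_one_le_of_nonpos hz (by norm_num)

theorem inv_norm_le_singularity {z : Plane} (hz : ‖z‖ ≤ 1) : ‖z‖⁻¹ ≤ singularity z := by
  rcases (norm_nonneg z).eq_or_lt with h | h
  · rw [← h, inv_zero]
    exact singularity_nonneg z
  · rw [← Real.rpow_neg_one]
    exact Real.rpow_le_rpow_of_exponent_ge h hz (by norm_num)

theorem neg_log_norm_le_singularity (z : Plane) : -Real.log ‖z‖ ≤ singularity z := by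
  rcases (norm_nonneg z).eq_or_lt with h | h
  · rw [← h, Real.log_zero, neg_zero]
    exact singularity_nonneg z
  rcases le_total ‖z‖ 1 with h1 | h1
  · refine le_trans ?_ (inv_norm_le_singularity h1)
    have := Real.log_le_sub_one_of_pos (inv_pos.2 h)
    rw [Real.log_inv] at this
    linarith
  · linarith [Real.log_nonneg h1, singularity_nonneg z]

/-- In polar coordinates `r^{-1/2}` remains. The exponent `3/2` is below `2`, hence locally
integrable, and above `1`, hence dominating `1/|z|` near `0` and square integrable at infinity. -/
theorem integrableOn_singularity (R : ℝ) : IntegrableOn singularity (Metric.ball 0 R) := by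
  rcases le_or_gt R 0 with hR | hR
  · rw [Metric.ball_eq_empty.2 hR]
    exact integrableOn_empty
  refine (integrableOn_fun_norm_addHaar (volume : Measure Plane)
    (f := fun r : ℝ => r ^ (-(3 / 2) : ℝ))).2 ?_
  have h1 : IntegrableOn (fun r : ℝ => r ^ (-(1 / 2) : ℝ)) (Set.Ioo 0 R) :=
    (intervalIntegral.integrableOn_Ioo_rpow_iff hR).2 (by norm_num)
  refine h1.congr_fun (fun r hr => ?_) measurableSet_Ioo
  simp only [finrank_euclideanSpace, Fintype.card_fin, smul_eq_mul]
  norm_num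
  rw [← Real.rpow_one_add' hr.1.le (by norm_num)]
  norm_num

/-- The integral of the singularity over the unit disc. -/
noncomputable def singularityMass : ℝ := ∫ z in Metric.ball (0 : Plane) 1, singularity z

theorem singularityMass_nonneg : 0 ≤ singularityMass :=
  setIntegral_nonneg Metric.isOpen_ball.measurableSet fun z _ => singularity_nonneg z

/-- Use the local bound on `g` in the unit disc about `x`, and `singularity ≤ 1` with the
integrability of `g` outside it. -/
theorem integrable_singularity_mul {g : Plane → ℝ} (hg : Integrable g) {x : Plane} {Λ : ℝ}
    (hb : ∀ y ∈ Metric.ball x 1, |g y| ≤ Λ) :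
    Integrable (fun y => singularity (x - y) * |g y|) ∧
      ∫ y, singularity (x - y) * |g y| ≤ Λ * singularityMass + ∫ y, |g y| := by
  set s : Plane → ℝ := (Metric.ball (0 : Plane) 1).indicator singularity with hs
  have is : Integrable s :=
    (integrable_indicator_iff Metric.isOpen_ball.measurableSet).2 (integrableOn_singularity 1)
  have is' : Integrable (fun y => s (x - y)) := is.comp_sub_left x
  have hle : ∀ y, singularity (x - y) * |g y| ≤ Λ * s (x - y) + |g y| := fun y => by
    by_cases h : x - y ∈ Metric.ball (0 : Plane) 1
    · have h1 : y ∈ Metric.ball x 1 := by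
        rw [mem_ball_zero_iff] at h
        rwa [mem_ball_iff_norm']
      rw [hs, Set.indicator_of_mem h]
      have := mul_le_mul_of_nonneg_left (hb y h1) (singularity_nonneg (x - y))
      linarith [abs_nonneg (g y)]
    · rw [hs, Set.indicator_of_notMem h, mul_zero, zero_add]
      refine mul_le_of_le_one_left (abs_nonneg _) (singularity_le_one ?_)
      rw [mem_ball_zero_iff] at h
      exact not_lt.1 h
  have ib : Integrable (fun y => Λ * s (x - y) + |g y|) := (is'.const_mul Λ).add hg.abs
  have i1 : Integrable (fun y => singularity (x - y) * |g y|) := by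
    refine ib.mono' ?_ (Eventually.of_forall fun y => ?_)
    · exact (measurable_singularity.comp (measurable_const.sub measurable_id)).aestronglyMeasurable.mul
        hg.abs.aestronglyMeasurable
    · rw [Real.norm_of_nonneg (mul_nonneg (singularity_nonneg _) (abs_nonneg _))]
      exact hle y
  refine ⟨i1, (integral_mono i1 ib hle).trans ?_⟩
  rw [integral_add (is'.const_mul Λ) hg.abs, integral_const_mul,
    integral_sub_left_eq_self s volume x, hs, integral_indicator Metric.isOpen_ball.measurableSet]
  rfl

theorem sphericalKernel_eq {z : Plane × Plane} (hz : z.1 ≠ z.2) :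
    sphericalKernel z =
      (2 * Real.pi)⁻¹ * (logWeight z.1 + logWeight z.2 - Real.log ‖z.1 - z.2‖) := by
  have h : 0 < ‖z.1 - z.2‖ := norm_pos_iff.2 (sub_ne_zero.2 hz)
  unfold sphericalKernel chordalSq logWeight
  rw [Real.log_div (by positivity) (by positivity), Real.log_mul (by positivity) (by positivity),
    Real.log_pow, mul_inv, mul_inv]
  have : (4 : ℝ)⁻¹ = 2⁻¹ / 2 := by norm_num
  rw [this]
  push_cast
  ring

theorem sphericalKernel_le (z : Plane × Plane) :
    sphericalKernel z ≤ logWeight z.1 + logWeight z.2 + singularity (z.1 - z.2) := by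
  have h1 := logWeight_nonneg z.1
  have h2 := logWeight_nonneg z.2
  have h3 := singularity_nonneg (z.1 - z.2)
  by_cases hz : z.1 = z.2
  · have : sphericalKernel z = 0 := by
      unfold sphericalKernel chordalSq
      simp [hz]
    linarith
  · rw [sphericalKernel_eq hz]
    have h4 := neg_log_norm_le_singularity (z.1 - z.2)
    have h5 : (2 * Real.pi)⁻¹ ≤ 1 := inv_le_one_of_one_le₀ (by linarith [Real.pi_gt_three])
    have h6 : 0 < (2 * Real.pi)⁻¹ := by positivity
    nlinarith

theorem logWeight_mono {x : Plane} {r : ℝ} (hx : ‖x‖ ≤ r) : logWeight x ≤ Real.log (1 + r ^ 2) / 2 := by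
  unfold logWeight
  gcongr

/-- The spherical kernel is an energy kernel for any continuous density of finite mass. -/
theorem isEnergyKernel_sphericalKernel {ρ : Plane → ℝ} (hρ : Continuous ρ) (hρ0 : ∀ x, 0 ≤ ρ x)
    (hρi : Integrable ρ) :
    IsEnergyKernel (volume.withDensity fun x => ENNReal.ofReal (ρ x))
      (fun z => ENNReal.ofReal (sphericalKernel z)) (fun n => Metric.ball 0 n) := by
  have hmρ : Measurable fun x => ENNReal.ofReal (ρ x) := hρ.measurable.ennreal_ofReal
  have hfin : IsFiniteMeasure (volume.withDensity fun x => ENNReal.ofReal (ρ x)) :=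
    isFiniteMeasure_withDensity (by
      rw [← ofReal_integral_eq_lintegral_ofReal hρi (Eventually.of_forall hρ0)]
      exact ENNReal.ofReal_ne_top)
  have hK : Measurable fun z => ENNReal.ofReal (sphericalKernel z) :=
    measurable_sphericalKernel.ennreal_ofReal
  refine ⟨hK, fun _ => ENNReal.ofReal_ne_top, fun z => ?_, ?_, fun n =>
    Metric.isOpen_ball.measurableSet, fun m n h => Metric.ball_subset_ball (Nat.cast_le.2 h), ?_, ?_⟩
  · simp only [sphericalKernel, chordalSq, Prod.fst_swap, Prod.snd_swap]
    rw [norm_sub_rev, mul_comm (1 + ‖z.2‖ ^ 2)]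
  · have : NullSingletonClass (volume.withDensity fun x : Plane => ENNReal.ofReal (ρ x)) :=
      ⟨fun x => withDensity_absolutelyContinuous _ _ (measure_singleton x)⟩
    exact fun F G hF hG hFm hGm => sphericalKernel_two_mul_kernelEnergy_le _ hF hG hFm hGm
  · refine Set.eq_univ_of_forall fun x => Set.mem_iUnion.2 ?_
    obtain ⟨n, hn⟩ := exists_nat_gt ‖x‖
    exact ⟨n, by simpa using hn⟩
  · intro n
    set g : Plane → ℝ := (Metric.ball (0 : Plane) n).indicator ρ with hg
    have ig : Integrable g := hρi.indicator Metric.isOpen_ball.measurableSet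
    have g0 : ∀ y, 0 ≤ g y := fun y => Set.indicator_nonneg (fun y _ => hρ0 y) y
    obtain ⟨Λ, hΛ⟩ := (isCompact_closedBall (0 : Plane) n).exists_bound_of_continuousOn
      hρ.continuousOn
    have hΛ0 : 0 ≤ Λ := (norm_nonneg _).trans (hΛ 0 (by simp))
    have hgΛ : ∀ y, |g y| ≤ Λ := fun y => by
      by_cases h : y ∈ Metric.ball (0 : Plane) n
      · rw [hg, Set.indicator_of_mem h]
        exact hΛ y (Metric.ball_subset_closedBall h)
      · rw [hg, Set.indicator_of_notMem h]
        simpa using hΛ0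
    set A : ℝ := Real.log (1 + (n : ℝ) ^ 2) / 2 + Real.log (1 + (n : ℝ) ^ 2) / 2 with hA
    have mind : Measurable ((Metric.ball (0 : Plane) n).indicator (1 : Plane → ℝ≥0∞)) :=
      measurable_one.indicator Metric.isOpen_ball.measurableSet
    -- On a fixed disc the potential of its indicator is bounded; as the measure is finite, this
    -- already bounds the energy.
    have hpot : ∀ x ∈ Metric.ball (0 : Plane) n,
        kernelPotential (volume.withDensity fun x => ENNReal.ofReal (ρ x))
          (fun z => ENNReal.ofReal (sphericalKernel z))
          ((Metric.ball (0 : Plane) n).indicator 1) x ≤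
        ENNReal.ofReal (A * (∫ y, |g y|) + (Λ * singularityMass + ∫ y, |g y|)) := by
      intro x hx
      obtain ⟨i1, hi1⟩ := integrable_singularity_mul ig (x := x) (Λ := Λ) fun y _ => hgΛ y
      have i2 : Integrable (fun y => A * |g y| + singularity (x - y) * |g y|) :=
        (ig.abs.const_mul A).add i1
      have hA0 : 0 ≤ A := by
        have := Real.log_nonneg (x := 1 + (n : ℝ) ^ 2) (by nlinarith [sq_nonneg (n : ℝ)])
        linarith
      have mx : Measurable fun y => ENNReal.ofReal (sphericalKernel (x, y)) :=
        hK.comp measurable_prodMk_left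
      have mxi : Measurable fun y => ENNReal.ofReal (sphericalKernel (x, y)) *
          (Metric.ball (0 : Plane) n).indicator (1 : Plane → ℝ≥0∞) y := mx.mul mind
      rw [kernelPotential, lintegral_withDensity_eq_lintegral_mul _ hmρ mxi]
      calc _ ≤ ∫⁻ y, ENNReal.ofReal (A * |g y| + singularity (x - y) * |g y|) := by
            refine lintegral_mono fun y => ?_
            simp only [Pi.mul_apply]
            by_cases hy : y ∈ Metric.ball (0 : Plane) n
            · rw [Set.indicator_of_mem hy, Pi.one_apply, mul_one, ← ENNReal.ofReal_mul (hρ0 y), hg,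
                Set.indicator_of_mem hy, abs_of_nonneg (hρ0 y), ← add_mul, mul_comm]
              refine ENNReal.ofReal_le_ofReal (mul_le_mul_of_nonneg_right ?_ (hρ0 y))
              refine (sphericalKernel_le (x, y)).trans ?_
              have h1 := logWeight_mono (mem_ball_zero_iff.1 hx).le
              have h2 := logWeight_mono (mem_ball_zero_iff.1 hy).le
              simp only
              linarith
            · rw [Set.indicator_of_notMem hy]
              simp
        _ = ENNReal.ofReal (∫ y, (A * |g y| + singularity (x - y) * |g y|)) :=
            (ofReal_integral_eq_lintegral_ofReal i2 (Eventually.of_forall fun y =>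
              add_nonneg (mul_nonneg hA0 (abs_nonneg _))
                (mul_nonneg (singularity_nonneg _) (abs_nonneg _)))).symm
        _ ≤ _ := by
            refine ENNReal.ofReal_le_ofReal ?_
            rw [integral_add (ig.abs.const_mul A) i1, integral_const_mul]
            linarith
    rw [kernelEnergy_eq_lintegral_mul_potential hK mind mind]
    refine ((lintegral_mono (g := fun _ =>
      ENNReal.ofReal (A * (∫ y, |g y|) + (Λ * singularityMass + ∫ y, |g y|))) fun x => ?_).trans_lt
        ?_).ne
    · by_cases hx : x ∈ Metric.ball (0 : Plane) n
      · rw [Set.indicator_of_mem hx, Pi.one_apply, one_mul]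
        exact hpot x hx
      · rw [Set.indicator_of_notMem hx]
        simp
    · rw [lintegral_const]
      exact ENNReal.mul_lt_top ENNReal.ofReal_lt_top (measure_lt_top _ _)

/-! ### Regularised logarithmic kernels -/

/-- The regularised logarithmic kernel `log √(|z|² + a)`. -/
noncomputable def logKernel (a : ℝ) (z : Plane) : ℝ := Real.log (‖z‖ ^ 2 + a) / 2

/-- The gradient of `logKernel a`. -/
noncomputable def gradKernel (a : ℝ) (z : Plane) : Plane := (‖z‖ ^ 2 + a)⁻¹ • z

/-- The derivative of `gradKernel a`. -/
noncomputable def hessKernel (a : ℝ) (z : Plane) : Plane →L[ℝ] Plane :=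
  (‖z‖ ^ 2 + a)⁻¹ • ContinuousLinearMap.id ℝ Plane -
    (2 * ((‖z‖ ^ 2 + a) ^ 2)⁻¹) • (innerSL ℝ z).smulRight z

theorem logKernel_zero (z : Plane) : logKernel 0 z = Real.log ‖z‖ := by
  unfold logKernel
  rw [add_zero, Real.log_pow]
  push_cast
  ring

theorem hasFDerivAt_norm_sq_add (a : ℝ) (z : Plane) :
    HasFDerivAt (fun z : Plane => ‖z‖ ^ 2 + a) (2 • innerSL ℝ z) z :=
  ((hasStrictFDerivAt_norm_sq z).hasFDerivAt).add_const a

theorem hasFDerivAt_logKernel {a : ℝ} {z : Plane} (h : ‖z‖ ^ 2 + a ≠ 0) :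
    HasFDerivAt (logKernel a) (innerSL ℝ (gradKernel a z)) z := by
  have h1 := ((hasFDerivAt_norm_sq_add a z).log h).const_mul (2⁻¹ : ℝ)
  have h2 : (fun z : Plane => 2⁻¹ * Real.log (‖z‖ ^ 2 + a)) = logKernel a := by
    ext z
    unfold logKernel
    ring
  have h3 : (2⁻¹ : ℝ) • (‖z‖ ^ 2 + a)⁻¹ • (2 • innerSL ℝ z) = innerSL ℝ (gradKernel a z) := by
    ext v
    simp [gradKernel]
    ring
  rw [h2, h3] at h1
  exact h1

theorem hasFDerivAt_gradKernel {a : ℝ} {z : Plane} (h : ‖z‖ ^ 2 + a ≠ 0) :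
    HasFDerivAt (gradKernel a) (hessKernel a z) z := by
  have h1 := ((hasDerivAt_inv h).comp_hasFDerivAt z (hasFDerivAt_norm_sq_add a z)).smul (hasFDerivAt_id z)
  have h3 : (‖z‖ ^ 2 + a)⁻¹ • ContinuousLinearMap.id ℝ Plane +
      (-((‖z‖ ^ 2 + a) ^ 2)⁻¹ • (2 • innerSL ℝ z)).smulRight z = hessKernel a z := by
    ext v : 1
    simp [hessKernel, smul_smul, sub_eq_add_neg, ← neg_smul]
    congr 1
    ring
  rw [← h3]
  exact h1

theorem gradient_logKernel {a : ℝ} {z : Plane} (h : ‖z‖ ^ 2 + a ≠ 0) :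
    ∇ (logKernel a) z = gradKernel a z := by
  rw [gradient, (hasFDerivAt_logKernel h).fderiv, LinearIsometryEquiv.symm_apply_eq]
  ext v
  simp

/-- This trace is the Laplacian of `logKernel a`. It vanishes off the origin when `a = 0` and is
`2π` times an approximate identity as `a → 0⁺`. -/
theorem sum_hessKernel {a : ℝ} {z : Plane} (h : ‖z‖ ^ 2 + a ≠ 0) :
    ∑ i, hessKernel a z (EuclideanSpace.basisFun (Fin 2) ℝ i) i = 2 * a / (‖z‖ ^ 2 + a) ^ 2 := by
  have h0 := plane_norm_sq z
  simp only [hessKernel, Fin.sum_univ_two, sub_apply, smul_apply, ContinuousLinearMap.smulRight_apply, PiLp.sub_apply,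
    PiLp.smul_apply, smul_eq_mul, innerSL_apply_apply, ContinuousLinearMap.id_apply,
    EuclideanSpace.basisFun_apply]
  simp only [EuclideanSpace.inner_single_right, PiLp.single_apply]
  simp
  field_simp
  linear_combination 2 * h0

theorem contDiff_logKernel {a : ℝ} (ha : 0 < a) : ContDiff ℝ 2 (logKernel a) := by
  unfold logKernel
  have : ∀ z : Plane, ‖z‖ ^ 2 + a ≠ 0 := fun z => by positivity
  exact ((contDiff_norm_sq ℝ).add contDiff_const |>.log this).div_const 2

theorem laplacian_logKernel {a : ℝ} (ha : 0 < a) (z : Plane) :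
    Laplacian.laplacian (logKernel a) z = 2 * a / (‖z‖ ^ 2 + a) ^ 2 := by
  have hne : ∀ z : Plane, ‖z‖ ^ 2 + a ≠ 0 := fun z => by positivity
  rw [laplacian_eq_sum_fderiv (contDiff_logKernel ha), ← sum_hessKernel (hne z)]
  refine Finset.sum_congr rfl fun i _ => ?_
  have h1 : (fun y => fderiv ℝ (logKernel a) y (EuclideanSpace.basisFun (Fin 2) ℝ i)) =
      fun y => gradKernel a y i := by
    ext y
    rw [(hasFDerivAt_logKernel (hne y)).fderiv]
    simp [EuclideanSpace.inner_single_right]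
  rw [h1]
  have h2 : HasFDerivAt (fun y => gradKernel a y i)
      ((EuclideanSpace.proj i).comp (hessKernel a z)) z :=
    (EuclideanSpace.proj (𝕜 := ℝ) i).hasFDerivAt.comp z
      (hasFDerivAt_gradKernel (hne z))
  rw [h2.fderiv]
  simp

theorem measurable_logKernel (a : ℝ) : Measurable (logKernel a) := by
  unfold logKernel
  fun_prop

theorem measurable_gradKernel (a : ℝ) : Measurable (gradKernel a) := by
  unfold gradKernel
  fun_prop

theorem continuous_gradKernel {a : ℝ} (ha : 0 < a) : Continuous (gradKernel a) := by
  unfold gradKernel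
  have : ∀ z : Plane, ‖z‖ ^ 2 + a ≠ 0 := fun z => by positivity
  fun_prop (disch := exact this _)

theorem norm_gradKernel_zero (z : Plane) : ‖gradKernel 0 z‖ = ‖z‖⁻¹ := by
  unfold gradKernel
  rw [norm_smul, add_zero, norm_inv, norm_pow, norm_norm]
  rcases (norm_nonneg z).eq_or_lt with h | h
  · rw [← h]
    simp
  · field_simp

theorem norm_gradKernel_zero_le (z : Plane) : ‖gradKernel 0 z‖ ≤ singularity z + 1 := by
  rw [norm_gradKernel_zero]
  rcases le_total ‖z‖ 1 with h | h
  · linarith [inv_norm_le_singularity h]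
  · linarith [inv_le_one_of_one_le₀ h, singularity_nonneg z]

theorem norm_gradKernel_le {a : ℝ} (ha : 0 < a) (z : Plane) : ‖gradKernel a z‖ ≤ 1 + a⁻¹ := by
  unfold gradKernel
  rw [norm_smul, norm_inv, Real.norm_of_nonneg (by positivity), ← div_eq_inv_mul,
    div_le_iff₀ (by positivity)]
  have h1 : a⁻¹ * a = 1 := inv_mul_cancel₀ ha.ne'
  have h2 : 0 < a⁻¹ := inv_pos.2 ha
  nlinarith [sq_nonneg (‖z‖ - 1), mul_nonneg h2.le (sq_nonneg ‖z‖)]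

theorem singularity_eq (z : Plane) : singularity z = (√‖z‖ ^ 3)⁻¹ := by
  unfold singularity
  rw [Real.rpow_neg (norm_nonneg z), Real.sqrt_eq_rpow, ← Real.rpow_natCast, ← Real.rpow_mul
    (norm_nonneg z)]
  norm_num

/-- With `s = √‖z‖` the difference has norm `t⁴ / (s² (s⁴ + t⁴))`, and `t³ s ≤ s⁴ + t⁴`. The
parametrisation `a = t⁴` makes the error linear in `t` at the cost of an integrable singularity. -/
theorem norm_gradKernel_sub_le {t : ℝ} (ht : 0 < t) (z : Plane) :
    ‖gradKernel (t ^ 4) z - gradKernel 0 z‖ ≤ t * singularity z := by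
  rcases eq_or_ne z 0 with rfl | hz
  · simp only [gradKernel, smul_zero, sub_self, norm_zero]
    exact mul_nonneg ht.le (singularity_nonneg _)
  have hr : 0 < ‖z‖ := norm_pos_iff.2 hz
  set s := √‖z‖ with hs
  have hs0 : 0 < s := Real.sqrt_pos.2 hr
  have hs2 : ‖z‖ = s ^ 2 := (Real.sq_sqrt hr.le).symm
  rw [singularity_eq z, ← hs]
  unfold gradKernel
  rw [← sub_smul, norm_smul, hs2, add_zero, ← pow_mul]
  have h1 : (s ^ (2 * 2) + t ^ 4)⁻¹ - (s ^ (2 * 2))⁻¹ = -(t ^ 4 / (s ^ 4 * (s ^ 4 + t ^ 4))) := by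
    field_simp
    ring
  rw [h1, norm_neg, Real.norm_of_nonneg (by positivity), div_mul_eq_mul_div,
    div_le_iff₀ (by positivity)]
  have h2 : t ^ 3 * s ≤ s ^ 4 + t ^ 4 := by
    rcases le_total s t with h | h
    · have := mul_le_mul_of_nonneg_left h (pow_pos ht 3).le
      have : 0 < s ^ 4 := by positivity
      nlinarith
    · have := mul_le_mul_of_nonneg_right (pow_le_pow_left₀ ht.le h 3) hs0.le
      have : 0 < t ^ 4 := by positivity
      nlinarith
  have h3 : t * (s ^ 3)⁻¹ * (s ^ 4 * (s ^ 4 + t ^ 4)) = t * s * (s ^ 4 + t ^ 4) := by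
    field_simp
  rw [h3]
  have h4 := mul_le_mul_of_nonneg_left h2 (mul_pos ht hs0).le
  nlinarith

theorem abs_logKernel_sub_le {t : ℝ} (ht : 0 < t) {z : Plane} (hz : z ≠ 0) :
    |logKernel (t ^ 4) z - logKernel 0 z| ≤ t ^ 2 * (singularity z + 1) := by
  have hr : 0 < ‖z‖ := norm_pos_iff.2 hz
  have h0 : ‖z‖⁻¹ ≤ singularity z + 1 := by
    rw [← norm_gradKernel_zero]
    exact norm_gradKernel_zero_le z
  have h1 : logKernel (t ^ 4) z - logKernel 0 z =
      Real.log ((‖z‖ ^ 2 + t ^ 4) / ‖z‖ ^ 2) / 2 := by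
    unfold logKernel
    rw [Real.log_div (by positivity) (by positivity), add_zero]
    ring
  have h2 : 1 ≤ (‖z‖ ^ 2 + t ^ 4) / ‖z‖ ^ 2 := by
    rw [le_div_iff₀ (by positivity)]
    nlinarith [pow_pos ht 4]
  have h3 : (‖z‖ ^ 2 + t ^ 4) / ‖z‖ ^ 2 ≤ (1 + t ^ 2 * ‖z‖⁻¹) ^ 2 := by
    rw [div_le_iff₀ (by positivity)]
    have : (1 + t ^ 2 * ‖z‖⁻¹) ^ 2 * ‖z‖ ^ 2 = (‖z‖ + t ^ 2) ^ 2 := by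
      field_simp
    rw [this]
    nlinarith [mul_pos hr (pow_pos ht 2)]
  rw [h1, abs_of_nonneg (div_nonneg (Real.log_nonneg h2) zero_le_two)]
  have h4 : Real.log ((‖z‖ ^ 2 + t ^ 4) / ‖z‖ ^ 2) ≤ 2 * (t ^ 2 * ‖z‖⁻¹) := by
    refine (Real.log_le_log (by positivity) h3).trans ?_
    rw [Real.log_pow]
    have := Real.log_le_sub_one_of_pos (x := 1 + t ^ 2 * ‖z‖⁻¹) (by positivity)
    push_cast
    linarith
  have h5 := mul_le_mul_of_nonneg_left h0 (sq_nonneg t)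
  linarith

/-- The upper bound is nonnegativity of the spherical kernel. For fixed `x` the right side is
integrable against any source, so the normalised potential converges absolutely. -/
theorem abs_log_norm_sub_logWeight_le (x y : Plane) :
    |Real.log ‖x - y‖ - logWeight y| ≤ logWeight x + logWeight y + singularity (x - y) := by
  have h1 := logWeight_nonneg x
  have h2 := logWeight_nonneg y
  have h3 := singularity_nonneg (x - y)
  have h4 := neg_log_norm_le_singularity (x - y)
  have h5 : Real.log ‖x - y‖ ≤ logWeight x + logWeight y := by
    rcases eq_or_ne x y with rfl | h
    · simp
      linarith
    · have h6 := sphericalKernel_nonneg (x, y)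
      rw [sphericalKernel_eq (z := (x, y)) h] at h6
      have := (mul_nonneg_iff_of_pos_left (by positivity : 0 < (2 * Real.pi)⁻¹)).1 h6
      simp only at this
      linarith
  rw [abs_le]
  constructor <;> linarith

/-! ### Logarithmic potentials of locally bounded densities -/

/-- A density whose logarithmic potential is well defined and continuously differentiable. -/
structure IsSource (g : Plane → ℝ) : Prop where
  integrable : Integrable g
  integrable_logWeight_mul : Integrable (fun y => logWeight y * g y)
  exists_bound : ∀ R : ℝ, ∃ Λ : ℝ, ∀ y ∈ Metric.ball (0 : Plane) R, |g y| ≤ Λ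

/-- The normalised potential of `g` for the kernel `logKernel a`. -/
noncomputable def logPotential (a : ℝ) (g : Plane → ℝ) (x : Plane) : ℝ :=
  ∫ y, (logKernel a (x - y) - logWeight y) * g y

/-- The gradient of `logPotential a g`. -/
noncomputable def gradPotential (a : ℝ) (g : Plane → ℝ) (x : Plane) : Plane :=
  ∫ y, g y • gradKernel a (x - y)

namespace IsSource

variable {g : Plane → ℝ} (hg : IsSource g)
include hg

theorem exists_bound_near (R : ℝ) :
    ∃ Λ : ℝ, 0 ≤ Λ ∧ ∀ x ∈ Metric.ball (0 : Plane) R, ∀ y ∈ Metric.ball x 1, |g y| ≤ Λ := by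
  obtain ⟨Λ, h⟩ := hg.exists_bound (R + 1)
  refine ⟨|Λ|, abs_nonneg _, fun x hx y hy => (h y ?_).trans (le_abs_self Λ)⟩
  rw [mem_ball_zero_iff] at hx ⊢
  rw [mem_ball_iff_norm] at hy
  have := norm_add_le (y - x) x
  rw [sub_add_cancel] at this
  linarith

theorem integrable_singularity (x : Plane) : Integrable (fun y => singularity (x - y) * |g y|) := by
  obtain ⟨Λ, -, h⟩ := hg.exists_bound_near (‖x‖ + 1)
  exact (integrable_singularity_mul hg.integrable (h x (by simp))).1

theorem aestronglyMeasurable_smul (a : ℝ) (x : Plane) :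
    AEStronglyMeasurable (fun y => g y • gradKernel a (x - y)) :=
  hg.integrable.aestronglyMeasurable.smul
    ((measurable_gradKernel a).comp (measurable_const.sub measurable_id)).aestronglyMeasurable

theorem integrable_smul_zero (x : Plane) : Integrable (fun y => g y • gradKernel 0 (x - y)) := by
  refine ((hg.integrable_singularity x).add hg.integrable.abs).mono'
    (hg.aestronglyMeasurable_smul 0 x) (Eventually.of_forall fun y => ?_)
  rw [norm_smul, Real.norm_eq_abs]
  have := mul_le_mul_of_nonneg_left (norm_gradKernel_zero_le (x - y)) (abs_nonneg (g y))
  simp only [Pi.add_apply]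
  linarith

theorem integrable_smul {a : ℝ} (ha : 0 < a) (x : Plane) :
    Integrable (fun y => g y • gradKernel a (x - y)) := by
  refine (hg.integrable.abs.const_mul (1 + a⁻¹)).mono' (hg.aestronglyMeasurable_smul a x)
    (Eventually.of_forall fun y => ?_)
  rw [norm_smul, Real.norm_eq_abs, mul_comm]
  exact mul_le_mul_of_nonneg_right (norm_gradKernel_le ha _) (abs_nonneg _)

theorem norm_gradPotential_sub_le {x : Plane} {Λ t : ℝ} (ht : 0 < t)
    (hb : ∀ y ∈ Metric.ball x 1, |g y| ≤ Λ) :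
    ‖gradPotential (t ^ 4) g x - gradPotential 0 g x‖ ≤
      t * (Λ * singularityMass + ∫ y, |g y|) := by
  obtain ⟨h1, h2⟩ := integrable_singularity_mul hg.integrable hb
  unfold gradPotential
  rw [← integral_sub (hg.integrable_smul (by positivity) x) (hg.integrable_smul_zero x)]
  refine (norm_integral_le_of_norm_le (h1.const_mul t) (Eventually.of_forall fun y => ?_)).trans ?_
  · rw [← smul_sub, norm_smul, Real.norm_eq_abs]
    have := mul_le_mul_of_nonneg_left (norm_gradKernel_sub_le ht (x - y)) (abs_nonneg (g y))
    linarith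
  · rw [integral_const_mul]
    exact mul_le_mul_of_nonneg_left h2 ht.le

theorem integrable_logPotential (x : Plane) :
    Integrable (fun y => (logKernel 0 (x - y) - logWeight y) * g y) := by
  have h := ((hg.integrable.abs.const_mul (logWeight x)).add hg.integrable_logWeight_mul.abs).add
    (hg.integrable_singularity x)
  refine h.mono' ?_ (Eventually.of_forall fun y => ?_)
  · exact (((measurable_logKernel 0).comp (measurable_const.sub measurable_id)).sub
      continuous_logWeight.measurable).aestronglyMeasurable.mul hg.integrable.aestronglyMeasurable
  · rw [norm_mul, Real.norm_eq_abs, Real.norm_eq_abs, logKernel_zero]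
    have := mul_le_mul_of_nonneg_right (abs_log_norm_sub_logWeight_le x y) (abs_nonneg (g y))
    simp only [Pi.add_apply, abs_mul, abs_of_nonneg (logWeight_nonneg y)]
    linarith

theorem integrable_logPotential_sub {t : ℝ} (ht : 0 < t) (x : Plane) :
    Integrable (fun y => (logKernel (t ^ 4) (x - y) - logKernel 0 (x - y)) * g y) ∧
    ∫ y, |(logKernel (t ^ 4) (x - y) - logKernel 0 (x - y)) * g y| ≤
      t ^ 2 * ∫ y, (singularity (x - y) * |g y| + |g y|) := by
  have h := ((hg.integrable_singularity x).add hg.integrable.abs).const_mul (t ^ 2)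
  have hle : ∀ᵐ y, |(logKernel (t ^ 4) (x - y) - logKernel 0 (x - y)) * g y| ≤
      t ^ 2 * (singularity (x - y) * |g y| + |g y|) := by
    filter_upwards [Measure.ae_ne volume x] with y hy
    rw [abs_mul]
    have := mul_le_mul_of_nonneg_right (abs_logKernel_sub_le ht (sub_ne_zero.2 hy.symm))
      (abs_nonneg (g y))
    linarith
  have hm : AEStronglyMeasurable
      (fun y => (logKernel (t ^ 4) (x - y) - logKernel 0 (x - y)) * g y) :=
    (((measurable_logKernel _).comp (measurable_const.sub measurable_id)).sub
      ((measurable_logKernel _).comp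
        (measurable_const.sub measurable_id))).aestronglyMeasurable.mul
      hg.integrable.aestronglyMeasurable
  have hi := h.mono' hm hle
  refine ⟨hi, ?_⟩
  rw [← integral_const_mul]
  exact integral_mono_ae hi.abs h hle

theorem integrable_logPotential_pow {t : ℝ} (ht : 0 < t) (x : Plane) :
    Integrable (fun y => (logKernel (t ^ 4) (x - y) - logWeight y) * g y) := by
  refine ((hg.integrable_logPotential_sub ht x).1.add (hg.integrable_logPotential x)).congr
    (Eventually.of_forall fun y => ?_)
  simp only [Pi.add_apply]
  ring

theorem abs_logPotential_sub_le {t : ℝ} (ht : 0 < t) (x : Plane) :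
    |logPotential (t ^ 4) g x - logPotential 0 g x| ≤
      t ^ 2 * ∫ y, (singularity (x - y) * |g y| + |g y|) := by
  refine le_trans ?_ (hg.integrable_logPotential_sub ht x).2
  unfold logPotential
  rw [← integral_sub (hg.integrable_logPotential_pow ht x) (hg.integrable_logPotential x)]
  have : ∀ y, (logKernel (t ^ 4) (x - y) - logWeight y) * g y -
      (logKernel 0 (x - y) - logWeight y) * g y =
      (logKernel (t ^ 4) (x - y) - logKernel 0 (x - y)) * g y := fun y => by ring
  simp only [this]
  exact abs_integral_le_integral_abs

theorem hasFDerivAt_logPotential_pow {t : ℝ} (ht : 0 < t) (x : Plane) :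
    HasFDerivAt (logPotential (t ^ 4) g) (innerSL ℝ (gradPotential (t ^ 4) g x)) x := by
  have ha : 0 < t ^ 4 := by positivity
  have hi := hg.integrable_smul ha x
  have h1 : innerSL ℝ (gradPotential (t ^ 4) g x) =
      ∫ y, innerSL ℝ (g y • gradKernel (t ^ 4) (x - y)) :=
    ((innerSL ℝ).integral_comp_comm hi).symm
  rw [h1]
  refine hasFDerivAt_integral_of_dominated_of_fderiv_le (s := Set.univ)
    (F' := fun x y => innerSL ℝ (g y • gradKernel (t ^ 4) (x - y)))
    (bound := fun y => (1 + (t ^ 4)⁻¹) * |g y|) univ_mem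
    (Eventually.of_forall fun x => (hg.integrable_logPotential_pow ht x).aestronglyMeasurable)
    (hg.integrable_logPotential_pow ht x)
    ((innerSL ℝ).continuous.comp_aestronglyMeasurable (hg.aestronglyMeasurable_smul _ x))
    (Eventually.of_forall fun y x _ => ?_) (hg.integrable.abs.const_mul _)
    (Eventually.of_forall fun y x _ => ?_)
  · rw [innerSL_apply_norm, norm_smul, Real.norm_eq_abs, mul_comm]
    exact mul_le_mul_of_nonneg_right (norm_gradKernel_le ha _) (abs_nonneg _)
  · have hne : ‖x - y‖ ^ 2 + t ^ 4 ≠ 0 := by positivity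
    have h2 := (((hasFDerivAt_logKernel hne).comp x ((hasFDerivAt_id x).sub_const y)).sub_const
      (logWeight y)).mul_const (g y)
    refine h2.congr_fderiv ?_
    ext v
    simp

theorem continuous_gradPotential_pow {t : ℝ} (ht : 0 < t) :
    Continuous (gradPotential (t ^ 4) g) := by
  have ha : 0 < t ^ 4 := by positivity
  refine continuous_of_dominated (bound := fun y => (1 + (t ^ 4)⁻¹) * |g y|)
    (fun x => hg.aestronglyMeasurable_smul _ x) (fun x => Eventually.of_forall fun y => ?_)
    (hg.integrable.abs.const_mul _) (Eventually.of_forall fun y => ?_)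
  · rw [norm_smul, Real.norm_eq_abs, mul_comm]
    exact mul_le_mul_of_nonneg_right (norm_gradKernel_le ha _) (abs_nonneg _)
  · exact ((continuous_gradKernel ha).comp (continuous_id.sub continuous_const)).const_smul (g y)

/-- The error is `t` times a constant depending only on the mass of `|g|` and a bound for `g` near
the disc, taken at `t = 1 / (n + 1)`. -/
theorem tendstoUniformlyOn_gradPotential (R : ℝ) :
    TendstoUniformlyOn (fun (n : ℕ) => gradPotential ((1 / ((n : ℝ) + 1)) ^ 4) g)
      (gradPotential 0 g) atTop (Metric.ball 0 R) := by
  obtain ⟨Λ, hΛ, hb⟩ := hg.exists_bound_near R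
  rw [Metric.tendstoUniformlyOn_iff]
  intro ε hε
  have h1 : Tendsto (fun n : ℕ => 1 / ((n : ℝ) + 1) * (Λ * singularityMass + ∫ y, |g y|)) atTop
      (𝓝 0) := by
    simpa using tendsto_one_div_add_atTop_nhds_zero_nat.mul_const
      (Λ * singularityMass + ∫ y, |g y|)
  filter_upwards [h1.eventually (gt_mem_nhds hε)] with n hn x hx
  rw [dist_comm, dist_eq_norm]
  exact (hg.norm_gradPotential_sub_le (by positivity) (hb x hx)).trans_lt hn

/-- The regularised potentials converge pointwise and their gradients locally uniformly. No
continuity of `g` is needed, which matters since the density found by minimisation is at this stage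
only measurable. -/
theorem hasFDerivAt_logPotential (x : Plane) :
    HasFDerivAt (logPotential 0 g) (innerSL ℝ (gradPotential 0 g x)) x := by
  have h1 := (innerSL ℝ (E := Plane)).uniformContinuous.comp_tendstoUniformlyOn
    (hg.tendstoUniformlyOn_gradPotential (‖x‖ + 1))
  refine hasFDerivAt_of_tendstoUniformlyOn Metric.isOpen_ball h1
    (f := fun (n : ℕ) => logPotential ((1 / ((n : ℝ) + 1)) ^ 4) g)
    (fun n y _ => hg.hasFDerivAt_logPotential_pow (by positivity) y) (fun y _ => ?_) (by simp)
  have h2 : Tendsto (fun n : ℕ => (1 / ((n : ℝ) + 1)) ^ 2 *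
      ∫ z, (singularity (y - z) * |g z| + |g z|)) atTop (𝓝 0) := by
    simpa using (tendsto_one_div_add_atTop_nhds_zero_nat.pow 2).mul_const
      (∫ z, (singularity (y - z) * |g z| + |g z|))
  rw [tendsto_iff_dist_tendsto_zero]
  exact squeeze_zero (fun _ => dist_nonneg)
    (fun n => hg.abs_logPotential_sub_le (by positivity) y) h2

theorem continuous_gradPotential : Continuous (gradPotential 0 g) := by
  rw [continuous_iff_continuousAt]
  intro x
  have h1 := (hg.tendstoUniformlyOn_gradPotential (‖x‖ + 1)).continuousOn
    (Eventually.frequently (Eventually.of_forall fun n =>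
      (hg.continuous_gradPotential_pow (t := 1 / ((n : ℝ) + 1)) (by positivity)).continuousOn))
  exact h1.continuousAt (Metric.isOpen_ball.mem_nhds (by simp))

theorem contDiff_one_logPotential : ContDiff ℝ 1 (logPotential 0 g) := by
  rw [contDiff_one_iff_hasFDerivAt]
  exact ⟨_, (innerSL ℝ).continuous.comp hg.continuous_gradPotential, hg.hasFDerivAt_logPotential⟩

end IsSource

/-! ### Poisson's equation for the logarithmic potential -/

/-- The trace of an endomorphism of the plane. -/
noncomputable def planeTrace : (Plane →L[ℝ] Plane) →L[ℝ] ℝ :=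
  ∑ i, (EuclideanSpace.proj (𝕜 := ℝ) i).comp
    (ContinuousLinearMap.apply ℝ Plane (EuclideanSpace.basisFun (Fin 2) ℝ i))

theorem planeTrace_apply (A : Plane →L[ℝ] Plane) :
    planeTrace A = ∑ i, A (EuclideanSpace.basisFun (Fin 2) ℝ i) i := by
  simp [planeTrace]

theorem integrable_two_div_sq : Integrable (fun y : Plane => 2 / (‖y‖ ^ 2 + 1) ^ 2) := by
  have h := integrable_rpow_neg_one_add_norm_sq (E := Plane) (μ := volume) (r := 4) (by simp; norm_num)
  refine (h.const_mul 2).congr (Eventually.of_forall fun y => ?_)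
  simp only
  have h1 : (-4 / 2 : ℝ) = -((2 : ℕ) : ℝ) := by norm_num
  rw [h1, Real.rpow_neg (by positivity), Real.rpow_natCast, add_comm]
  rfl

theorem integral_two_div_sq : ∫ y : Plane, 2 / (‖y‖ ^ 2 + 1) ^ 2 = 2 * Real.pi := by
  have h := integral_fun_norm_addHaar (volume : Measure Plane) (fun r : ℝ => 2 / (r ^ 2 + 1) ^ 2)
  rw [h]
  have hb : (volume : Measure Plane).real (Metric.ball 0 1) = Real.pi := by
    rw [measureReal_def, EuclideanSpace.volume_ball_fin_two]
    simp [Real.pi_nonneg]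
  -- An explicit radial primitive: the radial integral is `1`, and polar integration contributes the
  -- dimension `2` times the area `π` of the unit disc.
  have hd : ∀ r ∈ Set.Ici (0 : ℝ), HasDerivAt (fun r : ℝ => -(r ^ 2 + 1)⁻¹)
      (r ^ (2 - 1) • (2 / (r ^ 2 + 1) ^ 2)) r := fun r _ => by
    have h1 : HasDerivAt (fun r : ℝ => r ^ 2 + 1) (2 * r) r := by
      simpa using (hasDerivAt_pow 2 r).add_const 1
    refine (h1.fun_inv (by positivity)).neg.congr_deriv ?_
    simp
    ring
  have ht : Tendsto (fun r : ℝ => -(r ^ 2 + 1)⁻¹) atTop (𝓝 (-0)) :=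
    (tendsto_inv_atTop_zero.comp
      (tendsto_atTop_add_const_right _ _ (tendsto_pow_atTop two_ne_zero))).neg
  have hI := integral_Ioi_of_hasDerivAt_of_nonneg' hd
    (fun r (hr : 0 < r) => by simp only [smul_eq_mul]; positivity) ht
  rw [hb, finrank_euclideanSpace_fin, hI]
  simp

theorem integral_mul_two_mul_div_sq (φ : Plane → ℝ) {s : ℝ} (hs : 0 < s) :
    ∫ z, φ z * (2 * s ^ 2 / (‖z‖ ^ 2 + s ^ 2) ^ 2) =
      ∫ y, φ (s • y) * (2 / (‖y‖ ^ 2 + 1) ^ 2) := by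
  have h := Measure.integral_comp_smul (volume : Measure Plane)
    (fun z => φ z * (2 * s ^ 2 / (‖z‖ ^ 2 + s ^ 2) ^ 2)) s
  have h2 : (s ^ 2) ≠ 0 := by positivity
  rw [finrank_euclideanSpace_fin, abs_of_pos (by positivity), smul_eq_mul,
    eq_inv_mul_iff_mul_eq₀ h2, ← integral_const_mul] at h
  rw [← h]
  refine integral_congr_ae (Eventually.of_forall fun y => ?_)
  simp only [norm_smul, Real.norm_of_nonneg hs.le]
  have : (s * ‖y‖) ^ 2 + s ^ 2 = s ^ 2 * (‖y‖ ^ 2 + 1) := by ring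
  rw [this]
  field_simp

/-- After rescaling `z = s y` the profile is fixed and only the argument of `φ` shrinks to `0`. -/
theorem tendsto_integral_mul_two_mul_div_sq {φ : Plane → ℝ} (hφ : Continuous φ)
    {M : ℝ} (hM : ∀ x, |φ x| ≤ M) {s : ℕ → ℝ} (hs : ∀ n, 0 < s n) (hs0 : Tendsto s atTop (𝓝 0)) :
    Tendsto (fun n => ∫ z, φ z * (2 * s n ^ 2 / (‖z‖ ^ 2 + s n ^ 2) ^ 2)) atTop
      (𝓝 (2 * Real.pi * φ 0)) := by
  simp only [integral_mul_two_mul_div_sq φ (hs _)]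
  have h1 : 2 * Real.pi * φ 0 = ∫ y : Plane, φ 0 * (2 / (‖y‖ ^ 2 + 1) ^ 2) := by
    rw [integral_const_mul, integral_two_div_sq, mul_comm]
  rw [h1]
  refine tendsto_integral_of_dominated_convergence (fun y => M * (2 / (‖y‖ ^ 2 + 1) ^ 2))
    (fun n => ?_) (integrable_two_div_sq.const_mul M) (fun n => Eventually.of_forall fun y => ?_)
    (Eventually.of_forall fun y => ?_)
  · exact ((hφ.comp (continuous_const_smul (s n))).aestronglyMeasurable).mul
      integrable_two_div_sq.aestronglyMeasurable
  · rw [norm_mul, Real.norm_eq_abs, Real.norm_of_nonneg (by positivity)]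
    exact mul_le_mul_of_nonneg_right (hM _) (by positivity)
  · refine Tendsto.mul_const _ ?_
    have h2 : Tendsto (fun n => s n • y) atTop (𝓝 0) := by
      simpa using hs0.smul_const y
    exact (hφ.tendsto 0).comp h2

theorem isSource_of_hasCompactSupport {h : Plane → ℝ} (hh : Continuous h)
    (hc : HasCompactSupport h) : IsSource h where
  integrable := hh.integrable_of_hasCompactSupport hc
  integrable_logWeight_mul :=
    (continuous_logWeight.mul hh).integrable_of_hasCompactSupport hc.mul_left
  exists_bound R := by
    obtain ⟨M, hM⟩ := hc.exists_bound_of_continuous hh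
    exact ⟨M, fun y _ => hM y⟩

/-- The weak form of `Δ log |z| = 2π δ₀`: Green's identity for the regularised kernel, whose
Laplacian is an approximate identity, and the limit of both sides as the regularisation is removed.
-/
theorem integral_inner_gradient_gradKernel {φ : Plane → ℝ} (hφ : ContDiff ℝ 1 φ)
    (hc : HasCompactSupport φ) : ∫ z, ⟪∇ φ z, gradKernel 0 z⟫ = -(2 * Real.pi * φ 0) := by
  have hgc : Continuous (∇ φ) := continuous_gradient hφ
  have hnc : HasCompactSupport (∇ φ) := (hc.fderiv (𝕜 := ℝ)).comp_left
    (g := (InnerProductSpace.toDual ℝ Plane).symm) (map_zero _)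
  obtain ⟨M, hM⟩ := hc.exists_bound_of_continuous hφ.continuous
  have hS : Integrable (fun z => singularity z * ‖∇ φ z‖) := by
    refine ((isSource_of_hasCompactSupport hgc.norm hnc.norm).integrable_singularity 0).congr
      (Eventually.of_forall fun z => ?_)
    simp [singularity]
  have hpos : ∀ n : ℕ, 0 < 1 / ((n : ℝ) + 1) := fun n => by positivity
  have hL := tendsto_integral_mul_two_mul_div_sq hφ.continuous hM
    (s := fun n : ℕ => (1 / ((n : ℝ) + 1)) ^ 2) (fun n => pow_pos (hpos n) 2)
    (by simpa using (tendsto_one_div_add_atTop_nhds_zero_nat (𝕜 := ℝ)).pow 2)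
  have hI : ∀ n : ℕ, Integrable (fun z => ⟪∇ φ z, gradKernel ((1 / ((n : ℝ) + 1)) ^ 4) z⟫) :=
    fun n => (hgc.inner (continuous_gradKernel (pow_pos (hpos n) 4))).integrable_of_hasCompactSupport
      (hnc.mono' fun z hz => subset_tsupport _ fun h0 => hz (by simp [h0]))
  have hd : ∀ (n : ℕ) (z : Plane), ‖⟪∇ φ z, gradKernel ((1 / ((n : ℝ) + 1)) ^ 4) z⟫ -
      ⟪∇ φ z, gradKernel 0 z⟫‖ ≤ 1 / ((n : ℝ) + 1) * (singularity z * ‖∇ φ z‖) := fun n z => by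
    rw [← inner_sub_right]
    refine (norm_inner_le_norm _ _).trans ?_
    have := mul_le_mul_of_nonneg_left (norm_gradKernel_sub_le (hpos n) z) (norm_nonneg (∇ φ z))
    linarith
  have hm : AEStronglyMeasurable (fun z => ⟪∇ φ z, gradKernel 0 z⟫) :=
    hgc.aestronglyMeasurable.inner (measurable_gradKernel 0).aestronglyMeasurable
  have hI0 : Integrable (fun z => ⟪∇ φ z, gradKernel 0 z⟫) := by
    have h1 := (hS.const_mul (1 / (((0 : ℕ) : ℝ) + 1))).mono'
      ((hI 0).aestronglyMeasurable.sub hm) (Eventually.of_forall (hd 0))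
    refine ((hI 0).sub h1).congr (Eventually.of_forall fun z => ?_)
    simp
  have hT : Tendsto (fun n : ℕ => ∫ z, ⟪∇ φ z, gradKernel ((1 / ((n : ℝ) + 1)) ^ 4) z⟫) atTop
      (𝓝 (∫ z, ⟪∇ φ z, gradKernel 0 z⟫)) := by
    rw [tendsto_iff_dist_tendsto_zero]
    refine squeeze_zero (fun _ => dist_nonneg)
      (g := fun n : ℕ => 1 / ((n : ℝ) + 1) * ∫ z, singularity z * ‖∇ φ z‖) (fun n => ?_) ?_
    · rw [dist_eq_norm, ← integral_sub (hI n) hI0, ← integral_const_mul]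
      exact norm_integral_le_of_norm_le (hS.const_mul _) (Eventually.of_forall (hd n))
    · simpa using tendsto_one_div_add_atTop_nhds_zero_nat.mul_const
        (∫ z, singularity z * ‖∇ φ z‖)
  refine tendsto_nhds_unique hT (hL.neg.congr fun n => ?_)
  have h4 := pow_pos (hpos n) 4
  have h1 := integral_mul_laplacian hφ hc (contDiff_logKernel h4)
  have h2 : ∀ z : Plane, ∇ (logKernel ((1 / ((n : ℝ) + 1)) ^ 4)) z =
      gradKernel ((1 / ((n : ℝ) + 1)) ^ 4) z := fun z => gradient_logKernel (by positivity)
  simp only [h2, laplacian_logKernel h4] at h1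
  rw [← neg_eq_iff_eq_neg.2 h1, ← pow_mul]

/-- The operator is the rank-one map `v ↦ A(v) k`. Its trace turns the derivative of a convolution
into the pairing of `gradKernel` with a gradient. -/
theorem planeTrace_precompR (k : Plane) (A : Plane →L[ℝ] ℝ) :
    planeTrace ((ContinuousLinearMap.lsmul ℝ ℝ (E := Plane)).flip.precompR Plane k A) = A k := by
  have h : A k = ∑ i, k i * A (EuclideanSpace.basisFun (Fin 2) ℝ i) := by
    conv_lhs => rw [← (EuclideanSpace.basisFun (Fin 2) ℝ).sum_repr k]
    simp
  rw [planeTrace_apply, h]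
  refine Finset.sum_congr rfl fun i _ => ?_
  simp [ContinuousLinearMap.precompR_apply, mul_comm]

theorem locallyIntegrable_gradKernel : LocallyIntegrable (gradKernel 0) := by
  rw [locallyIntegrable_iff]
  intro K hK
  obtain ⟨R, hR⟩ := hK.isBounded.subset_ball 0
  refine IntegrableOn.mono_set ?_ hR
  refine Integrable.mono' ((integrableOn_singularity R).add
    (integrableOn_const (C := (1 : ℝ)) measure_ball_lt_top.ne))
    (measurable_gradKernel 0).aestronglyMeasurable
    (Eventually.of_forall norm_gradKernel_zero_le)

/-- As a convolution, the potential can be differentiated on `h`, so the nonintegrable Hessian of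
the logarithm never appears; the trace is then the weak identity for `Δ log` applied to `t ↦ h (x -
t)`. -/
theorem gradPotential_of_hasCompactSupport {h : Plane → ℝ} (hh : ContDiff ℝ 1 h)
    (hc : HasCompactSupport h) (x : Plane) :
    ContDiff ℝ 1 (gradPotential 0 h) ∧
      planeTrace (fderiv ℝ (gradPotential 0 h) x) = 2 * Real.pi * h x := by
  set L := (ContinuousLinearMap.lsmul ℝ ℝ (E := Plane)).flip with hL
  have heq : gradPotential 0 h = convolution (gradKernel 0) h L volume := by
    ext1 x
    rw [gradPotential, ← integral_sub_left_eq_self _ volume x, convolution_def]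
    simp [hL]
  refine ⟨heq ▸ hc.contDiff_convolution_right (n := 1) L locallyIntegrable_gradKernel hh, ?_⟩
  rw [heq, (hc.hasFDerivAt_convolution_right L locallyIntegrable_gradKernel hh x).fderiv,
    convolution_def, ← planeTrace.integral_comp_comm]
  · simp only [hL, planeTrace_precompR]
    have hφ : ContDiff ℝ 1 (fun t => h (x - t)) := hh.comp (contDiff_const.sub contDiff_id)
    have hφc : HasCompactSupport (fun t => h (x - t)) :=
      hc.comp_homeomorph (Homeomorph.subLeft x)
    have h1 := integral_inner_gradient_gradKernel hφ hφc
    rw [sub_zero] at h1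
    rw [← neg_eq_iff_eq_neg] at h1
    rw [← h1, ← integral_neg]
    refine integral_congr_ae (Eventually.of_forall fun t => ?_)
    have hd := ((hh.differentiable one_ne_zero (x - t)).hasFDerivAt.comp t
      ((hasFDerivAt_id t).const_sub x)).fderiv
    simp only [Function.comp_def] at hd
    simp only [gradient, InnerProductSpace.toDual_symm_apply]
    rw [hd]
    simp
  · exact (hc.fderiv (𝕜 := ℝ)).convolutionExists_right _ locallyIntegrable_gradKernel
      (hh.continuous_fderiv one_ne_zero) x

theorem norm_hessKernel_le {z : Plane} (hz : 1 ≤ ‖z‖) : ‖hessKernel 0 z‖ ≤ 3 := by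
  have hz0 : 0 < ‖z‖ := by linarith
  have h1 : ‖(‖z‖ ^ 2 + 0)⁻¹ • ContinuousLinearMap.id ℝ Plane‖ ≤ 1 := by
    rw [norm_smul, add_zero, norm_inv, norm_pow, norm_norm]
    have h2 := ContinuousLinearMap.norm_id_le (𝕜 := ℝ) (E := Plane)
    have h3 := inv_le_one_of_one_le₀ (one_le_pow₀ (n := 2) hz)
    exact mul_le_one₀ h3 (norm_nonneg _) h2
  have h2 : ‖(2 * ((‖z‖ ^ 2 + 0) ^ 2)⁻¹) • (innerSL ℝ z).smulRight z‖ ≤ 2 := by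
    rw [norm_smul, ContinuousLinearMap.norm_smulRight_apply, innerSL_apply_norm, add_zero,
      Real.norm_of_nonneg (by positivity)]
    have h3 := inv_le_one_of_one_le₀ (one_le_pow₀ (n := 2) hz)
    have : 2 * ((‖z‖ ^ 2) ^ 2)⁻¹ * (‖z‖ * ‖z‖) = 2 * (‖z‖ ^ 2)⁻¹ := by
      field_simp
    rw [this]
    linarith
  refine (norm_sub_le _ _).trans ?_
  linarith

theorem measurable_hessKernel (a : ℝ) : Measurable (hessKernel a) := by
  have : Continuous fun z : Plane => (innerSL ℝ z).smulRight z := by fun_prop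
  have h2 : Measurable fun z : Plane => (‖z‖ ^ 2 + a)⁻¹ := by fun_prop
  have h3 : Measurable fun z : Plane => 2 * ((‖z‖ ^ 2 + a) ^ 2)⁻¹ := by fun_prop
  exact (h2.smul_const _).sub (h3.smul this.measurable)

theorem planeTrace_hessKernel {z : Plane} (hz : z ≠ 0) : planeTrace (hessKernel 0 z) = 0 := by
  rw [planeTrace_apply, sum_hessKernel]
  · simp
  · simpa using hz

/-- The sources lie at distance at least `1` from the disc, where the Hessian of the kernel is
bounded and trace-free, so differentiation under the integral is legitimate. -/
theorem gradPotential_of_vanishing {g : Plane → ℝ} (hg : IsSource g) {R : ℝ}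
    (h0 : ∀ y ∈ Metric.ball (0 : Plane) (R + 1), g y = 0) {x : Plane}
    (hx : x ∈ Metric.ball (0 : Plane) R) :
    ContDiffAt ℝ 1 (gradPotential 0 g) x ∧ planeTrace (fderiv ℝ (gradPotential 0 g) x) = 0 := by
  have hfar : ∀ y, g y ≠ 0 → ∀ x ∈ Metric.ball (0 : Plane) R, 1 ≤ ‖x - y‖ := fun y hy x hx => by
    by_contra hlt
    refine hy (h0 y ?_)
    rw [mem_ball_zero_iff] at hx ⊢
    have := norm_sub_le x (x - y)
    rw [sub_sub_cancel] at this
    linarith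
  have hm : ∀ x, AEStronglyMeasurable (fun y => g y • hessKernel 0 (x - y)) := fun x =>
    hg.integrable.aestronglyMeasurable.smul
      ((measurable_hessKernel 0).comp (measurable_const.sub measurable_id)).aestronglyMeasurable
  have hle : ∀ y, ∀ x ∈ Metric.ball (0 : Plane) R, ‖g y • hessKernel 0 (x - y)‖ ≤ 3 * |g y| :=
    fun y x hx => by
    rcases eq_or_ne (g y) 0 with h | h
    · rw [h, zero_smul ℝ (hessKernel 0 (x - y))]
      simp
    · rw [norm_smul, Real.norm_eq_abs, mul_comm]
      exact mul_le_mul_of_nonneg_right (norm_hessKernel_le (hfar y h x hx)) (abs_nonneg _)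
  have hint : Integrable (fun y => 3 * |g y|) := hg.integrable.abs.const_mul 3
  have hd : ∀ x ∈ Metric.ball (0 : Plane) R,
      HasFDerivAt (gradPotential 0 g) (∫ y, g y • hessKernel 0 (x - y)) x := fun x hx => by
    refine hasFDerivAt_integral_of_dominated_of_fderiv_le
      (F' := fun x y => g y • hessKernel 0 (x - y)) (Metric.isOpen_ball.mem_nhds hx)
      (Eventually.of_forall fun x => hg.aestronglyMeasurable_smul 0 x) (hg.integrable_smul_zero x)
      (hm x) (Eventually.of_forall hle) hint (Eventually.of_forall fun y x hx => ?_)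
    rcases eq_or_ne (g y) 0 with h | h
    · rw [h, zero_smul ℝ (hessKernel 0 (x - y))]
      simp only [zero_smul]
      exact hasFDerivAt_const _ _
    · have hne : ‖x - y‖ ^ 2 + 0 ≠ 0 := by
        have := hfar y h x hx
        positivity
      exact ((hasFDerivAt_gradKernel hne).comp x ((hasFDerivAt_id x).sub_const y)).const_smul (g y)
  have hcont : ContinuousOn (fun x => ∫ y, g y • hessKernel 0 (x - y)) (Metric.ball 0 R) := by
    refine continuousOn_of_dominated (fun x _ => hm x)
      (fun x hx => Eventually.of_forall fun y => hle y x hx) hint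
      (Eventually.of_forall fun y => ?_)
    rcases eq_or_ne (g y) 0 with h | h
    · simp only [h, zero_smul ℝ (_ : Plane →L[ℝ] Plane)]
      exact continuousOn_const
    · have hne : ∀ x ∈ Metric.ball (0 : Plane) R, ‖x - y‖ ^ 2 + 0 ≠ 0 := fun x hx => by
        have := hfar y h x hx
        positivity
      have hne2 : ∀ x ∈ Metric.ball (0 : Plane) R, (‖x - y‖ ^ 2 + 0) ^ 2 ≠ 0 := fun x hx =>
        pow_ne_zero 2 (hne x hx)
      have hc : Continuous fun x : Plane => (innerSL ℝ (x - y)).smulRight (x - y) := by fun_prop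
      have hc2 : Continuous fun x : Plane => ‖x - y‖ ^ 2 + 0 := by fun_prop
      exact (((hc2.continuousOn.inv₀ hne).smul continuousOn_const).sub
        ((continuousOn_const.mul ((hc2.pow 2).continuousOn.inv₀ hne2)).smul
          hc.continuousOn)).const_smul (g y)
  refine ⟨contDiffAt_one_iff.2 ⟨_, _, Metric.isOpen_ball.mem_nhds hx, hcont, hd⟩, ?_⟩
  rw [(hd x hx).fderiv, ← planeTrace.integral_comp_comm (hint.mono' (hm x)
    (Eventually.of_forall fun y => hle y x hx))]
  refine integral_eq_zero_of_ae (Eventually.of_forall fun y => ?_)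
  rcases eq_or_ne (g y) 0 with h | h
  · simp [h]
  · have hne : x - y ≠ 0 := norm_pos_iff.1 (by linarith [hfar y h x hx])
    simp [planeTrace_hessKernel hne]

/-- A cut-off equal to `1` near `x` splits `g` into a compactly supported `C¹` part, which carries
the Laplacian, and a distant part, which is harmonic near `x`. -/
theorem IsSource.contDiffAt_gradPotential {g : Plane → ℝ} (hg : IsSource g) (hg1 : ContDiff ℝ 1 g)
    (x : Plane) :
    ContDiffAt ℝ 1 (gradPotential 0 g) x ∧
      planeTrace (fderiv ℝ (gradPotential 0 g) x) = 2 * Real.pi * g x := by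
  obtain ⟨C, -, hC⟩ := exists_cutoff
  obtain ⟨φ, hφ, hφc, hφ0, hφ1, hφe, -⟩ := hC (‖x‖ + 2) (by positivity)
  have hs1 : IsSource (fun y => φ y * g y) :=
    isSource_of_hasCompactSupport (hφ.continuous.mul hg1.continuous) hφc.mul_right
  have hs2 : IsSource (fun y => (1 - φ y) * g y) := by
    have hle : ∀ y, ‖1 - φ y‖ ≤ 1 := fun y => by
      rw [Real.norm_eq_abs, abs_le]
      constructor <;> linarith [hφ0 y, hφ1 y]
    have hm : AEStronglyMeasurable (fun y => 1 - φ y) :=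
      (continuous_const.sub hφ.continuous).aestronglyMeasurable
    refine ⟨hg.integrable.bdd_mul hm (Eventually.of_forall hle), ?_, fun R => ?_⟩
    · refine (hg.integrable_logWeight_mul.bdd_mul hm (Eventually.of_forall hle)).congr
        (Eventually.of_forall fun y => ?_)
      simp only
      ring
    · obtain ⟨Λ, hΛ⟩ := hg.exists_bound R
      refine ⟨Λ, fun y hy => ?_⟩
      rw [abs_mul]
      exact (mul_le_of_le_one_left (abs_nonneg _) (hle y)).trans (hΛ y hy)
  have hsum : gradPotential 0 g =
      gradPotential 0 (fun y => φ y * g y) + gradPotential 0 (fun y => (1 - φ y) * g y) := by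
    ext1 z
    simp only [Pi.add_apply, gradPotential]
    rw [← integral_add (hs1.integrable_smul_zero z) (hs2.integrable_smul_zero z)]
    refine integral_congr_ae (Eventually.of_forall fun y => ?_)
    simp only
    rw [← add_smul]
    congr 1
    ring
  have h1 := gradPotential_of_hasCompactSupport ((hφ.of_le one_le_two).mul hg1) hφc.mul_right x
  have h2 := gradPotential_of_vanishing hs2 (R := ‖x‖ + 1) (x := x) (fun y hy => by
    rw [mem_ball_zero_iff] at hy
    rw [hφe y (by linarith), sub_self, zero_mul]) (by simp)
  rw [hsum]
  refine ⟨h1.1.contDiffAt.add h2.1, ?_⟩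
  rw [fderiv_add (h1.1.differentiable one_ne_zero x) (h2.1.differentiableAt one_ne_zero), map_add,
    h1.2, h2.2, add_zero, hφe x (by linarith), one_mul]

theorem IsSource.contDiff_logPotential {g : Plane → ℝ} (hg : IsSource g) (hg1 : ContDiff ℝ 1 g) :
    ContDiff ℝ 2 (logPotential 0 g) := by
  have h : ContDiff ℝ 1 (gradPotential 0 g) :=
    contDiff_iff_contDiffAt.2 fun x => (hg.contDiffAt_gradPotential hg1 x).1
  exact (contDiff_succ_iff_hasFDerivAt (n := 1)).2
    ⟨_, (innerSL ℝ).contDiff.comp h, hg.hasFDerivAt_logPotential⟩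

theorem IsSource.laplacian_logPotential {g : Plane → ℝ} (hg : IsSource g) (hg1 : ContDiff ℝ 1 g)
    (x : Plane) : Laplacian.laplacian (logPotential 0 g) x = 2 * Real.pi * g x := by
  rw [laplacian_eq_sum_fderiv (hg.contDiff_logPotential hg1),
    ← (hg.contDiffAt_gradPotential hg1 x).2, planeTrace_apply]
  refine Finset.sum_congr rfl fun i _ => ?_
  have h1 : (fun y => fderiv ℝ (logPotential 0 g) y (EuclideanSpace.basisFun (Fin 2) ℝ i)) =
      fun y => gradPotential 0 g y i := by
    ext y
    rw [(hg.hasFDerivAt_logPotential y).fderiv]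
    simp [EuclideanSpace.inner_single_right]
  rw [h1]
  have h2 := (EuclideanSpace.proj (𝕜 := ℝ) i).hasFDerivAt.comp x
    ((hg.contDiffAt_gradPotential hg1 x).1.differentiableAt one_ne_zero).hasFDerivAt
  have h3 : (fun y => gradPotential 0 g y i) =
    (EuclideanSpace.proj (𝕜 := ℝ) i) ∘ gradPotential 0 g := rfl
  rw [h3, h2.fderiv]
  simp

/-! ### The curvature: disjoint bumps and weighted integrability -/

namespace IsRadialCutoff

variable {η : Plane → ℝ} (hη : IsRadialCutoff η)
include hη

theorem nonneg (x : Plane) : 0 ≤ η x :=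
  (Set.indicator_nonneg (fun _ _ => zero_le_one) x).trans (hη.lower x)

theorem le_one (x : Plane) : η x ≤ 1 :=
  (hη.upper x).trans (Set.indicator_le_self' (fun _ _ => zero_le_one) x)

theorem eq_one {x : Plane} (hx : ‖x‖ < 1 / 2) : η x = 1 := by
  refine le_antisymm (hη.le_one x) ?_
  have := hη.lower x
  rwa [Set.indicator_of_mem (mem_ball_zero_iff.2 hx)] at this

theorem eq_zero {x : Plane} (hx : 1 ≤ ‖x‖) : η x = 0 := by
  refine le_antisymm ?_ (hη.nonneg x)
  have := hη.upper x
  rwa [Set.indicator_of_notMem (by simpa using hx)] at this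

end IsRadialCutoff

theorem center_apply_zero (n : ℕ) : center n 0 = n := by simp [center]

theorem center_apply_one (n : ℕ) : center n 1 = 0 := by simp [center]

theorem norm_center (n : ℕ) : ‖center n‖ = n := by
  rw [← sq_eq_sq₀ (norm_nonneg _) (Nat.cast_nonneg n), plane_norm_sq, center_apply_zero,
    center_apply_one]
  ring

theorem one_le_norm_center_sub {m n : ℕ} (h : m ≠ n) : 1 ≤ ‖center m - center n‖ := by
  have h1 : ‖center m - center n‖ ^ 2 = ((m : ℝ) - n) ^ 2 := by
    rw [plane_norm_sq]
    simp [center_apply_zero, center_apply_one]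
  have h2 : (1 : ℝ) ≤ ((m : ℝ) - n) ^ 2 := by
    have h3 : (1 : ℤ) ≤ ((m : ℤ) - n) ^ 2 := by
      have : (m : ℤ) - n ≠ 0 := by omega
      have := pow_pos (abs_pos.2 this) 2
      rw [sq_abs] at this
      omega
    exact_mod_cast h3
  rw [← h1] at h2
  exact (one_le_sq_iff₀ (norm_nonneg _)).1 h2

theorem radius_pos (q : ℝ) (n : ℕ) : 0 < radius q n := Real.exp_pos _

/-- Here `n^q ≥ 2` and `e² ≥ 4`. With `1/4`, any disc of radius `1/4` meets the support of at most
one bump, the centres being at mutual distance at least `1`. -/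
theorem radius_le {q : ℝ} (hq : 1 < q) {n : ℕ} (hn : 2 ≤ n) : radius q n ≤ 1 / 4 := by
  have h1 : (2 : ℝ) ≤ n := by exact_mod_cast hn
  have h2 : (2 : ℝ) ≤ (n : ℝ) ^ q := by
    refine h1.trans ?_
    conv_lhs => rw [← Real.rpow_one (n : ℝ)]
    exact Real.rpow_le_rpow_of_exponent_le (by linarith) hq.le
  have h3 : Real.exp 1 * Real.exp 1 ≤ Real.exp ((n : ℝ) ^ q) := by
    rw [← Real.exp_add]
    exact Real.exp_le_exp.2 (by linarith)
  have h4 : (2 : ℝ) ≤ Real.exp 1 := by linarith [Real.add_one_le_exp 1]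
  unfold radius
  rw [Real.exp_neg, one_div]
  exact inv_anti₀ (by norm_num) (by nlinarith)

section

variable {η : Plane → ℝ} (hη : IsRadialCutoff η) {ℓ q : ℝ}
include hη

theorem curvatureTerm_nonneg (n : ℕ) (x : Plane) : 0 ≤ curvatureTerm η ℓ q n x :=
  mul_nonneg (mul_nonneg (by positivity) (Real.rpow_nonneg (Nat.cast_nonneg n) _)) (hη.nonneg _)

theorem curvatureTerm_le (n : ℕ) (x : Plane) :
    curvatureTerm η ℓ q n x ≤ (radius q n ^ 2)⁻¹ * (n : ℝ) ^ (-ℓ) :=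
  mul_le_of_le_one_right
    (mul_nonneg (by positivity) (Real.rpow_nonneg (Nat.cast_nonneg n) _)) (hη.le_one _)

theorem curvatureTerm_eq {n : ℕ} {x : Plane} (hx : ‖x - center n‖ < radius q n / 2) :
    curvatureTerm η ℓ q n x = (radius q n ^ 2)⁻¹ * (n : ℝ) ^ (-ℓ) := by
  have hr := radius_pos q n
  unfold curvatureTerm
  rw [hη.eq_one, mul_one]
  rw [norm_smul, norm_inv, Real.norm_of_nonneg hr.le, inv_mul_lt_iff₀ hr]
  linarith

theorem curvatureTerm_eq_zero {n : ℕ} {x : Plane} (hx : radius q n ≤ ‖x - center n‖) :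
    curvatureTerm η ℓ q n x = 0 := by
  have hr := radius_pos q n
  unfold curvatureTerm
  rw [hη.eq_zero, mul_zero]
  rwa [norm_smul, norm_inv, Real.norm_of_nonneg hr.le, ← div_eq_inv_mul, one_le_div₀ hr]

theorem contDiff_curvatureTerm (n : ℕ) : ContDiff ℝ ∞ (curvatureTerm η ℓ q n) :=
  contDiff_const.mul (hη.smooth.comp ((contDiff_id.sub contDiff_const).const_smul _))

/-- At most one term of the curvature is active on a disc of radius `1 / 4`. -/
theorem exists_forall_curvatureTerm_eq_zero (hq : 1 < q) (x : Plane) :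
    ∃ N : ℕ, ∀ y ∈ Metric.ball x (1 / 4), ∀ n : ℕ, n ≠ N → curvatureTerm η ℓ q (n + 2) y = 0 := by
  by_cases h : ∃ N : ℕ, ∃ z ∈ Metric.ball x (1 / 4), curvatureTerm η ℓ q (N + 2) z ≠ 0
  · obtain ⟨N, z, hz, hN⟩ := h
    refine ⟨N, fun y hy n hn => by_contra fun hne => ?_⟩
    have h1 := not_le.1 fun h => hN (curvatureTerm_eq_zero hη h)
    have h2 := not_le.1 fun h => hne (curvatureTerm_eq_zero hη h)
    have h3 := radius_le hq (n := n + 2) (by omega)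
    have h4 := radius_le hq (n := N + 2) (by omega)
    have h5 := one_le_norm_center_sub (m := n + 2) (n := N + 2) (by omega)
    rw [mem_ball_iff_norm] at hz hy
    -- A chain of four vectors, each of length less than `1/4`, cannot join two centres.
    have h6 : center (n + 2) - center (N + 2) =
        -(y - center (n + 2)) + (y - x) + (-(z - x) + (z - center (N + 2))) := by abel
    rw [h6] at h5
    have h7 := norm_add_le (-(y - center (n + 2)) + (y - x)) (-(z - x) + (z - center (N + 2)))
    have h8 := norm_add_le (-(y - center (n + 2))) (y - x)
    have h9 := norm_add_le (-(z - x)) (z - center (N + 2))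
    rw [norm_neg] at h8 h9
    linarith
  · push Not at h
    exact ⟨0, fun y hy n _ => h n y hy⟩

theorem exists_exoticCurvature_eq (hq : 1 < q) (x : Plane) :
    ∃ N : ℕ, ∀ y ∈ Metric.ball x (1 / 4),
      exoticCurvature η ℓ q y = -curvatureTerm η ℓ q (N + 2) y := by
  obtain ⟨N, hN⟩ := exists_forall_curvatureTerm_eq_zero hη hq x (ℓ := ℓ)
  exact ⟨N, fun y hy => by rw [exoticCurvature, tsum_eq_single N (hN y hy)]⟩

theorem summable_curvatureTerm (hq : 1 < q) (x : Plane) :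
    Summable fun n : ℕ => curvatureTerm η ℓ q (n + 2) x := by
  obtain ⟨N, hN⟩ := exists_forall_curvatureTerm_eq_zero hη hq x (ℓ := ℓ)
  exact summable_of_ne_finset_zero (s := {N}) fun n hn =>
    hN x (Metric.mem_ball_self (by norm_num)) n (by simpa using hn)

theorem contDiff_exoticCurvature (hq : 1 < q) : ContDiff ℝ ∞ (exoticCurvature η ℓ q) := by
  rw [contDiff_iff_contDiffAt]
  intro x
  obtain ⟨N, hN⟩ := exists_exoticCurvature_eq hη hq x (ℓ := ℓ)
  refine (contDiff_curvatureTerm hη (ℓ := ℓ) (q := q) (N + 2)).neg.contDiffAt.congr_of_eventuallyEq ?_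
  filter_upwards [Metric.ball_mem_nhds x (by norm_num : (0 : ℝ) < 1 / 4)] with y hy
  exact hN y hy

theorem exoticCurvature_nonpos (x : Plane) : exoticCurvature η ℓ q x ≤ 0 :=
  neg_nonpos.2 (tsum_nonneg fun _ => curvatureTerm_nonneg hη _ _)

theorem curvatureTerm_le_neg_exoticCurvature (hq : 1 < q) {n : ℕ} (hn : 2 ≤ n) (x : Plane) :
    curvatureTerm η ℓ q n x ≤ -exoticCurvature η ℓ q x := by
  obtain ⟨m, rfl⟩ := Nat.exists_eq_add_of_le' hn
  rw [exoticCurvature, neg_neg]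
  exact (summable_curvatureTerm hη hq x).le_tsum m fun _ _ => curvatureTerm_nonneg hη _ _

theorem exoticCurvature_center_neg (hq : 1 < q) {n : ℕ} (hn : 2 ≤ n) :
    exoticCurvature η ℓ q (center n) < 0 := by
  have h1 := curvatureTerm_le_neg_exoticCurvature hη hq hn (center n) (ℓ := ℓ)
  have hr := radius_pos q n
  rw [curvatureTerm_eq hη (by simpa using hr)] at h1
  have h2 : (0 : ℝ) < n := by exact_mod_cast (by omega : 0 < n)
  have : 0 < (radius q n ^ 2)⁻¹ * (n : ℝ) ^ (-ℓ) := by positivity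
  linarith

/-- Near `x`, the curvature is bounded by a single term `n^{-ℓ} / r_n^2`. -/
theorem exists_neg_exoticCurvature_le (hq : 1 < q) (x : Plane) :
    ∃ n : ℕ, 2 ≤ n ∧ ∀ y ∈ Metric.ball x (1 / 4),
      -exoticCurvature η ℓ q y ≤ (Metric.ball (center n) (radius q n)).indicator
        (fun _ => (radius q n ^ 2)⁻¹ * (n : ℝ) ^ (-ℓ)) y := by
  obtain ⟨N, hN⟩ := exists_exoticCurvature_eq hη hq x (ℓ := ℓ)
  refine ⟨N + 2, by omega, fun y hy => ?_⟩
  rw [hN y hy, neg_neg]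
  by_cases h : y ∈ Metric.ball (center (N + 2)) (radius q (N + 2))
  · rw [Set.indicator_of_mem h]
    exact curvatureTerm_le hη _ _
  · rw [Set.indicator_of_notMem h, curvatureTerm_eq_zero hη]
    rw [mem_ball_iff_norm] at h
    exact not_lt.1 h

/-- The factor `r_n^{-2}` cancels the area of the disc, and `1 + (n + 1)² ≤ 4 n²` for `n ≥ 2`
controls the weight. -/
theorem lintegral_curvatureTerm_mul_le (hq : 1 < q) {β : ℝ} (hβ : 0 ≤ β) {n : ℕ} (hn : 2 ≤ n) :
    ∫⁻ x, ENNReal.ofReal (curvatureTerm η ℓ q n x * (1 + ‖x‖ ^ 2) ^ β) ≤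
      ENNReal.ofReal (4 ^ β * Real.pi * (n : ℝ) ^ (2 * β - ℓ)) := by
  have hn' : (2 : ℝ) ≤ n := by exact_mod_cast hn
  have hn0 : (0 : ℝ) < n := by linarith
  have hr := radius_pos q n
  set A : ℝ := (radius q n ^ 2)⁻¹ * (n : ℝ) ^ (-ℓ) * (4 ^ β * (n : ℝ) ^ (2 * β)) with hA
  have hA0 : 0 ≤ A := by positivity
  have hle : ∀ x, ENNReal.ofReal (curvatureTerm η ℓ q n x * (1 + ‖x‖ ^ 2) ^ β) ≤
      (Metric.ball (center n) (radius q n)).indicator (fun _ => ENNReal.ofReal A) x := fun x => by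
    by_cases h : x ∈ Metric.ball (center n) (radius q n)
    · rw [Set.indicator_of_mem h]
      refine ENNReal.ofReal_le_ofReal (mul_le_mul (curvatureTerm_le hη n x) ?_ (by positivity)
        (by positivity))
      rw [mem_ball_iff_norm] at h
      have h1 : ‖x‖ ≤ n + 1 := by
        have := norm_le_norm_add_norm_sub' x (center n)
        rw [norm_center] at this
        linarith [radius_le hq hn]
      have h2 : 1 + ‖x‖ ^ 2 ≤ 4 * (n : ℝ) ^ 2 := by nlinarith [norm_nonneg x]
      refine (Real.rpow_le_rpow (by positivity) h2 hβ).trans_eq ?_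
      rw [Real.mul_rpow (by norm_num) (by positivity), ← Real.rpow_natCast, ← Real.rpow_mul hn0.le]
      norm_num
    · rw [Set.indicator_of_notMem h, curvatureTerm_eq_zero hη, zero_mul, ENNReal.ofReal_zero]
      rw [mem_ball_iff_norm] at h
      exact not_lt.1 h
  refine (lintegral_mono hle).trans ?_
  rw [lintegral_indicator_const Metric.isOpen_ball.measurableSet,
    EuclideanSpace.volume_ball_fin_two, ← ENNReal.ofReal_pow hr.le,
    ← ENNReal.ofReal_mul (by positivity), ← ENNReal.ofReal_mul hA0]
  refine ENNReal.ofReal_le_ofReal (le_of_eq ?_)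
  rw [hA, sub_eq_add_neg, Real.rpow_add hn0]
  field_simp

/-- The exponent condition is the summability of `n^{2β-ℓ}`; with `β = α` it reads `α < (ℓ - 1) /
2`. -/
theorem integrable_exoticCurvature_mul (hq : 1 < q) {β : ℝ} (hβ : 0 ≤ β) (h : 2 * β - ℓ < -1) :
    Integrable fun x => -exoticCurvature η ℓ q x * (1 + ‖x‖ ^ 2) ^ β := by
  have hcW : Continuous fun x : Plane => (1 + ‖x‖ ^ 2) ^ β :=
    Continuous.rpow_const (by fun_prop) fun x => Or.inl (by positivity)
  have hk : Continuous (exoticCurvature η ℓ q) := (contDiff_exoticCurvature hη hq).continuous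
  have hnn : ∀ x, 0 ≤ -exoticCurvature η ℓ q x * (1 + ‖x‖ ^ 2) ^ β := fun x =>
    mul_nonneg (neg_nonneg.2 (exoticCurvature_nonpos hη x)) (by positivity)
  refine ⟨(hk.neg.mul hcW).aestronglyMeasurable, ?_⟩
  rw [hasFiniteIntegral_iff_ofReal (Eventually.of_forall hnn)]
  have h1 : ∀ x, ENNReal.ofReal (-exoticCurvature η ℓ q x * (1 + ‖x‖ ^ 2) ^ β) =
      ∑' n : ℕ, ENNReal.ofReal (curvatureTerm η ℓ q (n + 2) x * (1 + ‖x‖ ^ 2) ^ β) := fun x => by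
    rw [exoticCurvature, neg_neg, ← tsum_mul_right]
    exact ENNReal.ofReal_tsum_of_nonneg
      (fun n => mul_nonneg (curvatureTerm_nonneg hη _ _) (by positivity))
      ((summable_curvatureTerm hη hq x).mul_right _)
  simp only [h1]
  have hm : ∀ n : ℕ, AEMeasurable fun x : Plane =>
      ENNReal.ofReal (curvatureTerm η ℓ q (n + 2) x * (1 + ‖x‖ ^ 2) ^ β) := fun n =>
    ((contDiff_curvatureTerm hη (n + 2)).continuous.mul
      hcW).measurable.ennreal_ofReal.aemeasurable
  rw [lintegral_tsum hm]
  refine (ENNReal.tsum_le_tsum fun n => lintegral_curvatureTerm_mul_le hη hq hβ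
    (by omega : 2 ≤ n + 2)).trans_lt ?_
  have hs : Summable fun n : ℕ => 4 ^ β * Real.pi * ((n + 2 : ℕ) : ℝ) ^ (2 * β - ℓ) :=
    ((summable_nat_add_iff 2).2 (Real.summable_nat_rpow.2 h)).mul_left _
  rw [← ENNReal.ofReal_tsum_of_nonneg (fun n => by positivity) hs]
  exact ENNReal.ofReal_lt_top

end

/-! ### Existence and regularity of solutions in potential form -/

theorem exp_two_mul_logWeight (α : ℝ) (x : Plane) :
    Real.exp (2 * (α * logWeight x)) = (1 + ‖x‖ ^ 2) ^ α := by
  unfold logWeight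
  rw [Real.rpow_def_of_pos (by positivity)]
  congr 1
  ring

/-- The potential of `g` for the kernel of the sphere, in terms of the logarithmic potential. -/
theorem IsSource.integral_sphericalKernel_mul {g : Plane → ℝ} (hg : IsSource g) (x : Plane) :
    ∫ y, sphericalKernel (x, y) * g y =
      (2 * Real.pi)⁻¹ * (logWeight x * ∫ y, g y) - (2 * Real.pi)⁻¹ * logPotential 0 g x := by
  rw [← mul_sub, logPotential, ← integral_const_mul,
    ← integral_sub (hg.integrable.const_mul _) (hg.integrable_logPotential x), ← integral_const_mul]
  refine integral_congr_ae ?_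
  filter_upwards [Measure.ae_ne volume x] with y hy
  rw [sphericalKernel_eq (z := (x, y)) hy.symm, logKernel_zero]
  ring

/-- `g` is the density `k e^{2u}` of a solution `u` of `Δu = k e^{2u}` with total mass `2 * π * α`, where
`u` is `c` plus the logarithmic potential of `g / (2 * π)`. -/
structure IsPotentialSolution (k : Plane → ℝ) (α c : ℝ) (g : Plane → ℝ) : Prop where
  source : IsSource g
  nonneg : ∀ x, 0 ≤ g x
  mass : ∫ x, g x = 2 * Real.pi * α
  eq : ∀ x, g x = k x * Real.exp (2 * (c + (2 * Real.pi)⁻¹ * logPotential 0 g x))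
  le : ∀ x, c + (2 * Real.pi)⁻¹ * logPotential 0 g x ≤ c + α * logWeight x

/-- Take the Gibbs density of mass `2πα` for the spherical kernel and the measure `k (1 + |x|²)^α
dx`. The weight `(1 + |x|²)^α` is `e^{2α logWeight}`, which is what converts the spherical potential
into the planar one. -/
theorem exists_isPotentialSolution {k : Plane → ℝ} (hk : Continuous k) (hk0 : ∀ x, 0 ≤ k x)
    {x₀ : Plane} (hx₀ : 0 < k x₀) {α : ℝ} (hα : 0 < α)
    (h1 : Integrable fun x => k x * (1 + ‖x‖ ^ 2) ^ α)
    (h2 : Integrable fun x => logWeight x * (k x * (1 + ‖x‖ ^ 2) ^ α)) :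
    ∃ (c : ℝ) (g : Plane → ℝ), IsPotentialSolution k α c g := by
  set ρ : Plane → ℝ := fun x => k x * (1 + ‖x‖ ^ 2) ^ α with hρ
  have hcρ : Continuous ρ :=
    hk.mul (Continuous.rpow_const (by fun_prop) fun x => Or.inl (by positivity))
  have hρ0 : ∀ x, 0 ≤ ρ x := fun x => mul_nonneg (hk0 x) (by positivity)
  have hmρ : Measurable fun x => ENNReal.ofReal (ρ x) := hcρ.measurable.ennreal_ofReal
  set μ : Measure Plane := volume.withDensity fun x => ENNReal.ofReal (ρ x) with hμ
  have : IsFiniteMeasure μ := isFiniteMeasure_withDensity_ofReal h1.2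
  have hμ0 : μ ≠ 0 := fun h0 => by
    have h3 : (fun x => ENNReal.ofReal (ρ x)) =ᵐ[volume] 0 :=
      (withDensity_eq_zero_iff hmρ.aemeasurable).1 h0
    have h4 : ρ =ᵐ[volume] fun _ => 0 := by
      filter_upwards [h3] with x hx
      exact le_antisymm (ENNReal.ofReal_eq_zero.1 hx) (hρ0 x)
    have h5 := Continuous.ae_eq_iff_eq volume hcρ continuous_const |>.1 h4
    have h6 : 0 < ρ x₀ := mul_pos hx₀ (by positivity)
    exact h6.ne' (congrFun h5 x₀)
  have hM := isEnergyKernel_sphericalKernel hcρ hρ0 h1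
  obtain ⟨f, c, hf, hfe⟩ := exists_gibbs_density hM hμ0 (by positivity : 0 < 2 * Real.pi * α)
  have hmf : Measurable fun x => ENNReal.ofReal (f x) := hf.measurable.ennreal_ofReal
  set P : Plane → ℝ := fun x => (kernelPotential μ (fun z => ENNReal.ofReal (sphericalKernel z))
    (fun x => ENNReal.ofReal (f x)) x).toReal with hP
  have mP : Measurable P := (measurable_kernelPotential hM.measurable hmf).ennreal_toReal
  have P0 : ∀ x, 0 ≤ P x := fun x => ENNReal.toReal_nonneg
  -- The Gibbs equation holds only almost everywhere. Since the potential does not change when `f`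
  -- is replaced by `f'`, the latter satisfies the equation at every point.
  set f' : Plane → ℝ := fun x => Real.exp (2 * (c - P x)) with hf'
  have mf' : Measurable f' := (((measurable_const.sub mP).const_mul 2)).exp
  set g : Plane → ℝ := fun x => f' x * ρ x with hg
  have mg : Measurable g := mf'.mul hcρ.measurable
  have g0 : ∀ x, 0 ≤ g x := fun x => mul_nonneg (Real.exp_pos _).le (hρ0 x)
  have gle : ∀ x, g x ≤ Real.exp (2 * c) * ρ x := fun x =>
    mul_le_mul_of_nonneg_right (Real.exp_le_exp.2 (by linarith [P0 x])) (hρ0 x)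
  have hs : IsSource g := by
    refine ⟨(h1.const_mul (Real.exp (2 * c))).mono' mg.aestronglyMeasurable
      (Eventually.of_forall fun x => ?_), (h2.const_mul (Real.exp (2 * c))).mono'
      (continuous_logWeight.measurable.mul mg).aestronglyMeasurable
      (Eventually.of_forall fun x => ?_), fun R => ?_⟩
    · rw [Real.norm_of_nonneg (g0 x)]
      exact gle x
    · rw [Real.norm_of_nonneg (mul_nonneg (logWeight_nonneg x) (g0 x))]
      have := mul_le_mul_of_nonneg_left (gle x) (logWeight_nonneg x)
      linarith
    · obtain ⟨C, hC⟩ := (isCompact_closedBall (0 : Plane) R).exists_bound_of_continuousOn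
        hcρ.continuousOn
      refine ⟨Real.exp (2 * c) * C, fun y hy => ?_⟩
      rw [abs_of_nonneg (g0 y)]
      refine (gle y).trans (mul_le_mul_of_nonneg_left ?_ (Real.exp_pos _).le)
      exact (le_abs_self _).trans (hC y (Metric.ball_subset_closedBall hy))
  have hconv : ∀ H : Plane → ℝ≥0∞, Measurable H → ∫⁻ y, H y * ENNReal.ofReal (f y) ∂μ =
      ∫⁻ y, H y * ENNReal.ofReal (g y) := fun H hH => by
    have h3 : ∫⁻ y, H y * ENNReal.ofReal (f y) ∂μ = ∫⁻ y, H y * ENNReal.ofReal (f' y) ∂μ :=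
      lintegral_congr_ae (by filter_upwards [hfe] with y hy; rw [hy])
    have h4 : Measurable fun y => H y * ENNReal.ofReal (f' y) := hH.mul mf'.ennreal_ofReal
    rw [h3, lintegral_withDensity_eq_lintegral_mul _ hmρ h4]
    refine lintegral_congr fun y => ?_
    simp only [Pi.mul_apply, hg]
    rw [ENNReal.ofReal_mul (Real.exp_pos _).le]
    ring
  have hmass : ∫ x, g x = 2 * Real.pi * α := by
    rw [integral_eq_lintegral_of_nonneg_ae (Eventually.of_forall g0) mg.aestronglyMeasurable]
    have h3 := hconv 1 measurable_const
    simp only [Pi.one_apply, one_mul] at h3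
    rw [← h3, hf.mass, ENNReal.toReal_ofReal (by positivity)]
  have hPeq : ∀ x, P x = ∫ y, sphericalKernel (x, y) * g y := fun x => by
    have mx : Measurable fun y => sphericalKernel (x, y) :=
      measurable_sphericalKernel.comp measurable_prodMk_left
    rw [integral_eq_lintegral_of_nonneg_ae
      (Eventually.of_forall fun y => mul_nonneg (sphericalKernel_nonneg _) (g0 y))
      (mx.mul mg).aestronglyMeasurable, hP]
    simp only [kernelPotential]
    rw [hconv _ mx.ennreal_ofReal]
    simp only [← ENNReal.ofReal_mul (sphericalKernel_nonneg _)]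
  have hpot : ∀ x, c + (2 * Real.pi)⁻¹ * logPotential 0 g x = c - P x + α * logWeight x :=
    fun x => by
    rw [hPeq, hs.integral_sphericalKernel_mul, hmass]
    have := Real.pi_ne_zero
    field_simp
    ring
  refine ⟨c, g, hs, g0, hmass, fun x => ?_, fun x => ?_⟩
  · rw [hpot x, mul_add, Real.exp_add, exp_two_mul_logWeight]
    simp only [hg, hf', hρ]
    ring
  · rw [hpot x]
    linarith [P0 x]

namespace IsPotentialSolution

variable {k g : Plane → ℝ} {α c : ℝ} (h : IsPotentialSolution k α c g)
include h

/-- Bootstrap: a bounded density has a `C¹` potential, so `k e^{2u}` is `C¹`, and this in turn makes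
the potential `C²`. -/
theorem contDiff_source (hk : ContDiff ℝ 1 k) : ContDiff ℝ 1 g := by
  have h1 := h.source.contDiff_one_logPotential
  have h2 : ContDiff ℝ 1 fun x =>
      k x * Real.exp (2 * (c + (2 * Real.pi)⁻¹ * logPotential 0 g x)) :=
    hk.mul (contDiff_const.mul (contDiff_const.add (contDiff_const.mul h1))).exp
  rwa [← funext h.eq] at h2

theorem contDiff (hk : ContDiff ℝ 1 k) :
    ContDiff ℝ 2 fun x => c + (2 * Real.pi)⁻¹ * logPotential 0 g x :=
  contDiff_const.add (contDiff_const.mul (h.source.contDiff_logPotential (h.contDiff_source hk)))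

theorem laplacian_eq (hk : ContDiff ℝ 1 k) (x : Plane) :
    Laplacian.laplacian (fun x => c + (2 * Real.pi)⁻¹ * logPotential 0 g x) x = g x := by
  have h1 := h.source.contDiff_logPotential (h.contDiff_source hk)
  have h2 : (fun x => c + (2 * Real.pi)⁻¹ * logPotential 0 g x) =
      (fun _ => c) + (2 * Real.pi)⁻¹ • logPotential 0 g := rfl
  have h3 : ContDiff ℝ 2 ((2 * Real.pi)⁻¹ • logPotential 0 g) :=
    show ContDiff ℝ 2 fun y => (2 * Real.pi)⁻¹ • logPotential 0 g y from h1.const_smul _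
  rw [h2, ContDiffAt.laplacian_add contDiffAt_const h3.contDiffAt,
    InnerProductSpace.laplacian_smul _ h1.contDiffAt, h.source.laplacian_logPotential
      (h.contDiff_source hk)]
  have := Real.pi_ne_zero
  simp
  field_simp

theorem isCurvatureSolution (hk : ContDiff ℝ 1 k) :
    IsCurvatureSolution (fun x => -k x) fun x => c + (2 * Real.pi)⁻¹ * logPotential 0 g x :=
  ⟨h.contDiff hk, fun x => by
    rw [h.laplacian_eq hk, h.eq]
    have := h.eq x
    rw [← this]
    linarith⟩

end IsPotentialSolution

/-! ### Near and far parts of the potential -/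

/-- The singular part of the logarithmic kernel. -/
noncomputable def nearLog : Plane → ℝ :=
  (Metric.ball (0 : Plane) (1 / 4)).indicator fun z => -Real.log ‖z‖

/-- The singular part of the spherical potential. -/
noncomputable def nearPotential (g : Plane → ℝ) (x : Plane) : ℝ :=
  (2 * Real.pi)⁻¹ * ∫ y, g y * nearLog (x - y)

/-- The regular part of the kernel of the sphere, up to the factor `2 * π`. -/
noncomputable def farKernel (x y : Plane) : ℝ :=
  logWeight x + logWeight y -
    (Metric.ball (0 : Plane) (1 / 4))ᶜ.indicator (fun z => Real.log ‖z‖) (x - y)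

/-- The regular part of the spherical potential. -/
noncomputable def farPotential (g : Plane → ℝ) (x : Plane) : ℝ :=
  (2 * Real.pi)⁻¹ * ∫ y, g y * farKernel x y

theorem nearLog_eq {z : Plane} (hz : ‖z‖ < 1 / 4) : nearLog z = -Real.log ‖z‖ :=
  Set.indicator_of_mem (mem_ball_zero_iff.2 hz) _

theorem nearLog_eq_zero {z : Plane} (hz : 1 / 4 ≤ ‖z‖) : nearLog z = 0 :=
  Set.indicator_of_notMem (by simpa using hz) _

theorem nearLog_nonneg (z : Plane) : 0 ≤ nearLog z :=
  Set.indicator_nonneg (fun z hz => by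
    rw [mem_ball_zero_iff] at hz
    exact neg_nonneg.2 (Real.log_nonpos (norm_nonneg _) (by linarith))) z

theorem measurable_nearLog : Measurable nearLog :=
  (by fun_prop : Measurable fun z : Plane => -Real.log ‖z‖).indicator
    Metric.isOpen_ball.measurableSet

theorem nearLog_le_singularity (z : Plane) : nearLog z ≤ singularity z := by
  rcases lt_or_ge ‖z‖ (1 / 4) with h | h
  · rw [nearLog_eq h]
    exact neg_log_norm_le_singularity z
  · rw [nearLog_eq_zero h]
    exact singularity_nonneg z

theorem integrable_nearLog_sq : Integrable fun z => nearLog z ^ 2 := by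
  have h1 : Integrable ((Metric.ball (0 : Plane) (1 / 4)).indicator singularity) :=
    (integrable_indicator_iff Metric.isOpen_ball.measurableSet).2 (integrableOn_singularity _)
  refine (h1.const_mul (16 / 9)).mono' (measurable_nearLog.pow_const 2).aestronglyMeasurable
    (Eventually.of_forall fun z => ?_)
  rw [Real.norm_of_nonneg (sq_nonneg _)]
  rcases lt_or_ge ‖z‖ (1 / 4) with h | h
  · have h2 := Real.log_le_rpow_div (inv_nonneg.2 (norm_nonneg z)) (by norm_num : (0 : ℝ) < 3 / 4)
    rw [Set.indicator_of_mem (mem_ball_zero_iff.2 h)]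
    rw [Real.log_inv, ← nearLog_eq h] at h2
    have h3 := pow_le_pow_left₀ (nearLog_nonneg z) h2 2
    have h4 : (‖z‖⁻¹ ^ (3 / 4 : ℝ)) ^ 2 = singularity z := by
      rw [← Real.rpow_natCast, ← Real.rpow_mul (inv_nonneg.2 (norm_nonneg z)),
        Real.inv_rpow (norm_nonneg z), ← Real.rpow_neg (norm_nonneg z)]
      norm_num [singularity]
    rw [div_pow, h4] at h3
    norm_num at h3
    linarith
  · rw [nearLog_eq_zero h, Set.indicator_of_notMem (by simpa using h)]
    simp

theorem log_norm_indicator_le (x y : Plane) :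
    (Metric.ball (0 : Plane) (1 / 4))ᶜ.indicator (fun z => Real.log ‖z‖) (x - y) ≤
      logWeight x + logWeight y := by
  by_cases h : x - y ∈ Metric.ball (0 : Plane) (1 / 4)
  · rw [Set.indicator_of_notMem (by simpa using h)]
    exact add_nonneg (logWeight_nonneg x) (logWeight_nonneg y)
  · rw [Set.indicator_of_mem h]
    have hne : x ≠ y := fun he => h (by simp [he])
    have h6 := sphericalKernel_nonneg (x, y)
    rw [sphericalKernel_eq (z := (x, y)) hne] at h6
    have := (mul_nonneg_iff_of_pos_left (by positivity : 0 < (2 * Real.pi)⁻¹)).1 h6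
    simp only at this
    linarith

theorem farKernel_nonneg (x y : Plane) : 0 ≤ farKernel x y :=
  sub_nonneg.2 (log_norm_indicator_le x y)

theorem logWeight_le_of_norm_le {x y : Plane} {r : ℝ} (hr : 0 < r)
    (h : 1 + ‖x‖ ^ 2 ≤ (8 * r) ^ 2 * (1 + ‖y‖ ^ 2)) :
    logWeight x ≤ Real.log 8 + Real.log r + logWeight y := by
  have h1 := Real.log_le_log (by positivity) h
  rw [Real.log_mul (by positivity) (by positivity), Real.log_pow,
    Real.log_mul (by norm_num) hr.ne'] at h1
  unfold logWeight
  push_cast at h1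
  linarith

/-- The bound is independent of `x`, as dominated convergence at infinity requires. It compares `1 +
|x|²` with `(8r)² (1 + |y|²)`, for `r = 1` inside the cut and `r = |x - y| ≥ 1/4` outside it. -/
theorem farKernel_le (x y : Plane) : farKernel x y ≤ Real.log 8 + 2 * logWeight y := by
  unfold farKernel
  have h0 : ‖x‖ ^ 2 ≤ 2 * ‖x - y‖ ^ 2 + 2 * ‖y‖ ^ 2 := by
    have := norm_le_norm_sub_add x y
    nlinarith [norm_nonneg x, sq_nonneg (‖x - y‖ - ‖y‖)]
  by_cases h : x - y ∈ Metric.ball (0 : Plane) (1 / 4)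
  · rw [Set.indicator_of_notMem (by simpa using h)]
    rw [mem_ball_zero_iff] at h
    have h1 := logWeight_le_of_norm_le (x := x) (y := y) one_pos (by
      nlinarith [norm_nonneg (x - y), sq_nonneg ‖y‖])
    rw [Real.log_one] at h1
    linarith
  · rw [Set.indicator_of_mem h]
    rw [mem_ball_zero_iff, not_lt] at h
    have h1 := logWeight_le_of_norm_le (x := x) (y := y) (r := ‖x - y‖) (by linarith) (by
      have h2 : 1 / 16 ≤ ‖x - y‖ ^ 2 := by nlinarith
      nlinarith [mul_nonneg (sq_nonneg ‖x - y‖) (sq_nonneg ‖y‖),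
        mul_le_mul_of_nonneg_right h2 (sq_nonneg ‖y‖)])
    linarith

theorem sphericalKernel_eq_add {x y : Plane} (h : x ≠ y) :
    sphericalKernel (x, y) = (2 * Real.pi)⁻¹ * farKernel x y + (2 * Real.pi)⁻¹ * nearLog (x - y) := by
  rw [sphericalKernel_eq (z := (x, y)) h, ← mul_add]
  congr 1
  unfold farKernel
  by_cases h : x - y ∈ Metric.ball (0 : Plane) (1 / 4)
  · rw [Set.indicator_of_notMem (by simpa using h), nearLog_eq (mem_ball_zero_iff.1 h)]
    ring
  · rw [Set.indicator_of_mem h, nearLog_eq_zero (by simpa using h)]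
    ring

theorem tendsto_logWeight_sub_log_norm :
    Tendsto (fun x : Plane => logWeight x - Real.log ‖x‖) (cocompact Plane) (𝓝 0) := by
  have h2 : Tendsto (fun x : Plane => ‖x‖ ^ 2) (cocompact Plane) atTop :=
    (tendsto_pow_atTop two_ne_zero).comp tendsto_norm_cocompact_atTop
  have h3 := ((Real.tendsto_log_comp_add_sub_log 1).comp h2).div_const 2
  rw [zero_div] at h3
  refine h3.congr fun x => ?_
  simp only [Function.comp_apply, logWeight, Real.log_pow]
  rw [add_comm]
  push_cast
  ring

/-- For fixed `y`, both `logWeight x - log |x|` and `log |x| - log |x - y|` tend to `0`. -/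
theorem tendsto_farKernel (y : Plane) :
    Tendsto (fun x => farKernel x y) (cocompact Plane) (𝓝 (logWeight y)) := by
  have hn : Tendsto (fun x : Plane => ‖x‖) (cocompact Plane) atTop := tendsto_norm_cocompact_atTop
  have h1 := tendsto_logWeight_sub_log_norm
  have h2 : Tendsto (fun x : Plane => Real.log ‖x‖ - Real.log ‖x - y‖) (cocompact Plane) (𝓝 0) := by
    have hu := ((Real.tendsto_log_comp_add_sub_log (-‖y‖)).comp hn).neg
    have hl := ((Real.tendsto_log_comp_add_sub_log ‖y‖).comp hn).neg
    rw [neg_zero] at hu hl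
    refine tendsto_of_tendsto_of_tendsto_of_le_of_le' hl hu ?_ ?_
    · filter_upwards [hn.eventually_gt_atTop ‖y‖] with x hx
      simp only [Function.comp_apply]
      have h4 : 0 < ‖x - y‖ := by linarith [norm_sub_norm_le x y]
      have := Real.log_le_log h4 (norm_sub_le x y)
      linarith
    · filter_upwards [hn.eventually_gt_atTop ‖y‖] with x hx
      simp only [Function.comp_apply]
      have := Real.log_le_log (by linarith) (norm_sub_norm_le x y)
      rw [← sub_eq_add_neg]
      linarith
  have h3 := (h1.add h2).add_const (logWeight y)
  rw [add_zero, zero_add] at h3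
  refine h3.congr' ?_
  filter_upwards [hn.eventually_gt_atTop (‖y‖ + 1 / 4)] with x hx
  unfold farKernel
  rw [Set.indicator_of_mem]
  · ring
  · have := norm_sub_norm_le x y
    simp only [Set.mem_compl_iff, mem_ball_zero_iff, not_lt]
    linarith

theorem measurable_farKernel (x : Plane) : Measurable (farKernel x) := by
  have h : Measurable ((Metric.ball (0 : Plane) (1 / 4))ᶜ.indicator fun z : Plane => Real.log ‖z‖) :=
    (by fun_prop : Measurable fun z : Plane => Real.log ‖z‖).indicator
      Metric.isOpen_ball.measurableSet.compl
  exact (measurable_const.add continuous_logWeight.measurable).sub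
    (h.comp (measurable_const.sub measurable_id))

theorem nearPotential_nonneg {g : Plane → ℝ} (hg : ∀ x, 0 ≤ g x) (x : Plane) :
    0 ≤ nearPotential g x :=
  mul_nonneg (by positivity) (integral_nonneg fun y => mul_nonneg (hg y) (nearLog_nonneg _))

theorem norm_mul_farKernel_le (g : Plane → ℝ) (x y : Plane) :
    ‖g y * farKernel x y‖ ≤ Real.log 8 * |g y| + 2 * |logWeight y * g y| := by
  rw [norm_mul, Real.norm_eq_abs, Real.norm_of_nonneg (farKernel_nonneg _ _), abs_mul,
    abs_of_nonneg (logWeight_nonneg y)]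
  have := mul_le_mul_of_nonneg_left (farKernel_le x y) (abs_nonneg (g y))
  linarith

namespace IsSource

variable {g : Plane → ℝ} (hg : IsSource g)
include hg

theorem integrable_mul_nearLog (x : Plane) : Integrable fun y => g y * nearLog (x - y) := by
  refine (hg.integrable_singularity x).mono' (hg.integrable.aestronglyMeasurable.mul
    (measurable_nearLog.comp (measurable_const.sub measurable_id)).aestronglyMeasurable)
    (Eventually.of_forall fun y => ?_)
  rw [norm_mul, Real.norm_eq_abs, Real.norm_of_nonneg (nearLog_nonneg _), mul_comm]
  exact mul_le_mul_of_nonneg_right (nearLog_le_singularity _) (abs_nonneg _)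

theorem integrable_bound :
    Integrable fun y => Real.log 8 * |g y| + 2 * |logWeight y * g y| :=
  (hg.integrable.abs.const_mul _).add (hg.integrable_logWeight_mul.abs.const_mul _)

theorem aestronglyMeasurable_mul_farKernel (x : Plane) :
    AEStronglyMeasurable fun y => g y * farKernel x y :=
  hg.integrable.aestronglyMeasurable.mul (measurable_farKernel x).aestronglyMeasurable

theorem integral_sphericalKernel_eq_add (x : Plane) :
    ∫ y, sphericalKernel (x, y) * g y = farPotential g x + nearPotential g x := by
  unfold farPotential nearPotential
  rw [← mul_add, ← integral_add (hg.integrable_bound.mono' (hg.aestronglyMeasurable_mul_farKernel x)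
    (Eventually.of_forall (norm_mul_farKernel_le g x))) (hg.integrable_mul_nearLog x),
    ← integral_const_mul]
  refine integral_congr_ae ?_
  filter_upwards [Measure.ae_ne volume x] with y hy
  rw [sphericalKernel_eq_add hy.symm]
  ring

theorem exists_abs_farPotential_le : ∃ C : ℝ, ∀ x, |farPotential g x| ≤ C := by
  refine ⟨(2 * Real.pi)⁻¹ * ∫ y, (Real.log 8 * |g y| + 2 * |logWeight y * g y|), fun x => ?_⟩
  unfold farPotential
  rw [abs_mul, abs_of_nonneg (by positivity : 0 ≤ (2 * Real.pi)⁻¹)]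
  refine mul_le_mul_of_nonneg_left ?_ (by positivity)
  exact norm_integral_le_of_norm_le hg.integrable_bound
    (Eventually.of_forall (norm_mul_farKernel_le g x))

theorem tendsto_farPotential :
    Tendsto (farPotential g) (cocompact Plane)
      (𝓝 ((2 * Real.pi)⁻¹ * ∫ y, g y * logWeight y)) := by
  have : (cocompact Plane).IsCountablyGenerated := by
    rw [← Metric.cobounded_eq_cocompact, ← comap_norm_atTop]
    infer_instance
  refine Tendsto.const_mul _ (tendsto_integral_filter_of_dominated_convergence _
    (Eventually.of_forall hg.aestronglyMeasurable_mul_farKernel)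
    (Eventually.of_forall fun x => Eventually.of_forall (norm_mul_farKernel_le g x))
    hg.integrable_bound (Eventually.of_forall fun y => (tendsto_farKernel y).const_mul (g y)))

/-- Cauchy–Schwarz in the measure `g dy` bounds the square by the mass times `g * nearLog²`, a
convolution of integrable functions. -/
theorem integrable_nearPotential_sq (h0 : ∀ x, 0 ≤ g x) (hm : 0 < ∫ x, g x) :
    Integrable fun x => nearPotential g x ^ 2 := by
  have hκ : Integrable nearLog := by
    have h1 : Integrable ((Metric.ball (0 : Plane) (1 / 4)).indicator singularity) :=
      (integrable_indicator_iff Metric.isOpen_ball.measurableSet).2 (integrableOn_singularity _)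
    refine h1.mono' measurable_nearLog.aestronglyMeasurable (Eventually.of_forall fun z => ?_)
    rw [Real.norm_of_nonneg (nearLog_nonneg z)]
    by_cases h : z ∈ Metric.ball (0 : Plane) (1 / 4)
    · rw [Set.indicator_of_mem h]
      exact nearLog_le_singularity z
    · rw [Set.indicator_of_notMem h, nearLog_eq_zero (by simpa using h)]
  set L := ContinuousLinearMap.mul ℝ ℝ with hL
  have i1 := hg.integrable.integrable_convolution L hκ
  have i2 := hg.integrable.integrable_convolution L integrable_nearLog_sq
  have hex := hg.integrable.ae_convolution_exists L integrable_nearLog_sq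
  have hN : nearPotential g = fun x => (2 * Real.pi)⁻¹ * (convolution g nearLog L volume) x := by
    ext x
    rw [nearPotential, hL, convolution_mul]
  simp only [hN]
  refine (i2.const_mul ((2 * Real.pi)⁻¹ ^ 2 * ∫ x, g x)).mono'
    (i1.aestronglyMeasurable.const_mul _ |>.pow 2) ?_
  filter_upwards [hex] with x hx
  rw [Real.norm_of_nonneg (sq_nonneg _), mul_pow, mul_assoc]
  refine mul_le_mul_of_nonneg_left ?_ (sq_nonneg _)
  have j1 := hg.integrable_mul_nearLog x
  have j2 : Integrable fun y => g y * nearLog (x - y) ^ 2 := hx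
  rw [hL, convolution_mul, convolution_mul]
  set m := ∫ x, g x with hmdef
  set A := ∫ y, g y * nearLog (x - y) with hA
  -- Cauchy–Schwarz as a variance inequality: the square is centred at the mean, and a factor `m >
  -- 0` is divided out at the end.
  have h1 : 0 ≤ ∫ y, g y * (m * nearLog (x - y) - A) ^ 2 :=
    integral_nonneg fun y => mul_nonneg (h0 y) (sq_nonneg _)
  have h2 : ∀ y, g y * (m * nearLog (x - y) - A) ^ 2 =
      m ^ 2 * (g y * nearLog (x - y) ^ 2) - 2 * m * A * (g y * nearLog (x - y)) + A ^ 2 * g y :=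
    fun y => by ring
  have j3 : Integrable fun y => m ^ 2 * (g y * nearLog (x - y) ^ 2) -
      2 * m * A * (g y * nearLog (x - y)) := (j2.const_mul _).sub (j1.const_mul _)
  simp only [h2] at h1
  rw [integral_add j3 (hg.integrable.const_mul _), integral_sub (j2.const_mul _) (j1.const_mul _), integral_const_mul, integral_const_mul,
    integral_const_mul, ← hA, ← hmdef] at h1
  have h3 : 0 ≤ m * (m * (∫ y, g y * nearLog (x - y) ^ 2) - A ^ 2) := by linarith
  have := (mul_nonneg_iff_of_pos_left hm).1 h3
  linarith

end IsSource

/-! ### Caccioppoli's inequality and the energy condition -/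

theorem integrable_of_eq_zero_off_tsupport {φ f : Plane → ℝ} (hc : HasCompactSupport φ)
    (hf : Continuous f) (h : ∀ x, φ x = 0 → ∇ φ x = 0 → f x = 0) : Integrable f := by
  refine hf.integrable_of_hasCompactSupport (HasCompactSupport.intro hc fun x hx =>
    h x (image_eq_zero_of_notMem_tsupport hx) ?_)
  have : fderiv ℝ φ x = 0 := by
    by_contra hne
    exact hx (support_fderiv_subset ℝ hne)
  rw [gradient, this, map_zero]

/-- Caccioppoli's inequality. -/
theorem integral_sq_mul_norm_gradient_sq_le {φ w : Plane → ℝ} (hφ : ContDiff ℝ 1 φ)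
    (hc : HasCompactSupport φ) (h1 : ∀ x, φ x ^ 2 ≤ 1) (hw : ContDiff ℝ 2 w)
    (hi : Integrable fun x => w x * Laplacian.laplacian w x) :
    ∫ x, φ x ^ 2 * ‖∇ w x‖ ^ 2 ≤
      2 * (∫ x, |w x * Laplacian.laplacian w x|) + 4 * ∫ x, w x ^ 2 * ‖∇ φ x‖ ^ 2 := by
  have hw1 : ContDiff ℝ 1 w := hw.of_le (by norm_num)
  have cw := continuous_gradient hw1
  have cφ := continuous_gradient hφ
  have hcw : HasCompactSupport fun x => φ x ^ 2 * w x := HasCompactSupport.intro hc fun x hx => by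
    rw [image_eq_zero_of_notMem_tsupport hx]
    ring
  have h0 := integral_mul_laplacian ((hφ.pow 2).mul hw1) hcw hw
  have hgrad : ∀ x, ∇ (fun y => φ y ^ 2 * w y) x = φ x ^ 2 • ∇ w x + (2 * φ x * w x) • ∇ φ x :=
    fun x => by
    have dφ := hφ.differentiable one_ne_zero x
    have e1 : (fun y => φ y ^ 2 * w y) = fun y => φ y * (φ y * w y) := by
      ext y
      ring
    rw [e1, gradient_mul_apply dφ (dφ.fun_mul (hw1.differentiable one_ne_zero x)),
      gradient_mul_apply dφ (hw1.differentiable one_ne_zero x)]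
    module
  simp only [hgrad, inner_add_left, real_inner_smul_left, real_inner_self_eq_norm_sq] at h0
  have iE : Integrable fun x => φ x ^ 2 * ‖∇ w x‖ ^ 2 :=
    integrable_of_eq_zero_off_tsupport hc ((hφ.continuous.pow 2).mul (cw.norm.pow 2))
      fun x hx _ => by simp [hx]
  have iX : Integrable fun x => 2 * φ x * w x * ⟪∇ φ x, ∇ w x⟫ :=
    integrable_of_eq_zero_off_tsupport hc
      (((continuous_const.mul hφ.continuous).mul hw1.continuous).mul (cφ.inner cw))
      fun x hx _ => by simp [hx]
  have iB : Integrable fun x => w x ^ 2 * ‖∇ φ x‖ ^ 2 :=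
    integrable_of_eq_zero_off_tsupport hc ((hw1.continuous.pow 2).mul (cφ.norm.pow 2))
      fun x _ hx => by simp [hx]
  rw [integral_add iE iX] at h0
  have hX : -∫ x, 2 * φ x * w x * ⟪∇ φ x, ∇ w x⟫ ≤
      2⁻¹ * (∫ x, φ x ^ 2 * ‖∇ w x‖ ^ 2) + 2 * ∫ x, w x ^ 2 * ‖∇ φ x‖ ^ 2 := by
    rw [← integral_neg, ← integral_const_mul, ← integral_const_mul,
      ← integral_add (iE.const_mul _) (iB.const_mul _)]
    refine integral_mono iX.neg ((iE.const_mul _).add (iB.const_mul _)) fun x => ?_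
    have h2 := abs_real_inner_le_norm (∇ φ x) (∇ w x)
    have h3 : -(2 * φ x * w x * ⟪∇ φ x, ∇ w x⟫) ≤
        2 * (|φ x| * ‖∇ w x‖) * (|w x| * ‖∇ φ x‖) := by
      refine (neg_le_abs _).trans ?_
      rw [abs_mul, abs_mul, abs_mul, abs_two]
      have := mul_le_mul_of_nonneg_left h2
        (mul_nonneg (mul_nonneg zero_le_two (abs_nonneg (φ x))) (abs_nonneg (w x)))
      linarith
    -- The weights in Young's inequality leave half of the energy on the right, to be absorbed on
    -- the left.
    have h4 := sq_nonneg (|φ x| * ‖∇ w x‖ - 2 * (|w x| * ‖∇ φ x‖))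
    have h5 : (|φ x| * ‖∇ w x‖) ^ 2 = φ x ^ 2 * ‖∇ w x‖ ^ 2 := by rw [mul_pow, sq_abs]
    have h6 : (|w x| * ‖∇ φ x‖) ^ 2 = w x ^ 2 * ‖∇ φ x‖ ^ 2 := by rw [mul_pow, sq_abs]
    simp only
    nlinarith
  have hL : -∫ x, φ x ^ 2 * w x * Laplacian.laplacian w x ≤
      ∫ x, |w x * Laplacian.laplacian w x| := by
    refine (neg_le_abs _).trans ?_
    rw [← Real.norm_eq_abs]
    refine norm_integral_le_of_norm_le hi.abs (Eventually.of_forall fun x => ?_)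
    rw [mul_assoc, norm_mul, Real.norm_of_nonneg (sq_nonneg _), Real.norm_eq_abs]
    exact mul_le_of_le_one_left (abs_nonneg _) (h1 x)
  linarith

/-- Caccioppoli's inequality with cut-offs at scale `R`. The constant part of `w²` contributes at
most `A (C/R)²` times the area `4πR²`, independent of `R`; the integrable part is harmless for `R ≥
1`. -/
theorem integrable_norm_gradient_sq {w G : Plane → ℝ} (hw : ContDiff ℝ 2 w)
    (hi : Integrable fun x => w x * Laplacian.laplacian w x) (hG : Integrable G) {A : ℝ}
    (hwG : ∀ x, w x ^ 2 ≤ A + G x) : Integrable fun x => ‖∇ w x‖ ^ 2 := by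
  obtain ⟨C, hC0, hC⟩ := exists_cutoff
  have cw := continuous_gradient (hw.of_le (by norm_num : (1 : WithTop ℕ∞) ≤ 2))
  have cov : AECover (volume : Measure Plane) atTop fun n : ℕ => Metric.ball (0 : Plane) (n + 1 : ℝ) :=
    aecover_ball (tendsto_atTop_add_const_right _ _ tendsto_natCast_atTop_atTop)
  have hloc : ∀ R : ℝ, IntegrableOn (fun x => ‖∇ w x‖ ^ 2) (Metric.ball (0 : Plane) R) := fun R =>
    ((cw.norm.pow 2).continuousOn.integrableOn_compact
      (isCompact_closedBall (0 : Plane) R)).mono_set Metric.ball_subset_closedBall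
  refine cov.integrable_of_integral_bounded_of_nonneg_ae
    (2 * (∫ x, |w x * Laplacian.laplacian w x|) +
      4 * (C ^ 2 * (A * (4 * Real.pi) + ∫ x, |G x|))) (fun n => hloc _)
    (Eventually.of_forall fun x => sq_nonneg _) (Eventually.of_forall fun n => ?_)
  set R : ℝ := (n : ℝ) + 1 with hR
  have hR1 : 1 ≤ R := by
    have := Nat.cast_nonneg (α := ℝ) n
    linarith
  have hR0 : 0 < R := by linarith
  obtain ⟨φ, hφ, hc, hφ0, hφ1, hφe, hφz, -, hgz, hgb⟩ := hC R hR0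
  have hφ' : ContDiff ℝ 1 φ := hφ.of_le (by norm_num)
  have hsq : ∀ x, φ x ^ 2 ≤ 1 := fun x => pow_le_one₀ (hφ0 x) (hφ1 x)
  have hmain := integral_sq_mul_norm_gradient_sq_le hφ' hc hsq hw hi
  have iE : Integrable fun x => φ x ^ 2 * ‖∇ w x‖ ^ 2 :=
    integrable_of_eq_zero_off_tsupport hc ((hφ.continuous.pow 2).mul (cw.norm.pow 2))
      fun x hx _ => by simp [hx]
  have hleft : ∫ x in Metric.ball (0 : Plane) R, ‖∇ w x‖ ^ 2 ≤ ∫ x, φ x ^ 2 * ‖∇ w x‖ ^ 2 := by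
    rw [← integral_indicator Metric.isOpen_ball.measurableSet]
    refine integral_mono ((integrable_indicator_iff Metric.isOpen_ball.measurableSet).2 (hloc R))
      iE fun x => ?_
    by_cases hx : x ∈ Metric.ball (0 : Plane) R
    · simp only [Set.indicator_of_mem hx]
      rw [hφe x (mem_ball_zero_iff.1 hx).le]
      simp
    · simp only [Set.indicator_of_notMem hx]
      positivity
  have hright : ∫ x, w x ^ 2 * ‖∇ φ x‖ ^ 2 ≤ C ^ 2 * (A * (4 * Real.pi) + ∫ x, |G x|) := by
    set B := Metric.closedBall (0 : Plane) (2 * R) with hB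
    have hBm : MeasurableSet B := Metric.isClosed_closedBall.measurableSet
    have iA : Integrable (B.indicator fun _ => A) :=
      (integrable_indicator_iff hBm).2 (integrableOn_const measure_closedBall_lt_top.ne)
    have hvol : ∫ x, B.indicator (fun _ => A) x = A * (4 * Real.pi * R ^ 2) := by
      rw [integral_indicator hBm, setIntegral_const, hB, measureReal_def,
        EuclideanSpace.volume_closedBall_fin_two, ← ENNReal.ofReal_pow (by positivity),
        ← ENNReal.ofReal_mul (by positivity), ENNReal.toReal_ofReal (by positivity), smul_eq_mul]
      ring
    calc ∫ x, w x ^ 2 * ‖∇ φ x‖ ^ 2 ≤ ∫ x, (C / R) ^ 2 * (B.indicator (fun _ => A) x + |G x|) := by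
          refine integral_mono_of_nonneg (Eventually.of_forall fun x => by positivity)
            ((iA.add hG.abs).const_mul _) (Eventually.of_forall fun x => ?_)
          simp only
          by_cases hx : x ∈ B
          · rw [Set.indicator_of_mem hx, mul_comm]
            refine mul_le_mul (pow_le_pow_left₀ (norm_nonneg _) (hgb x) 2)
              ((hwG x).trans (by linarith [le_abs_self (G x)])) (sq_nonneg _) (sq_nonneg _)
          · rw [hgz x (by simpa [hB] using hx), Set.indicator_of_notMem hx]
            simp only [norm_zero, ne_eq, OfNat.ofNat_ne_zero, not_false_eq_true, zero_pow, mul_zero]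
            positivity
      _ = C ^ 2 * (A * (4 * Real.pi) + (∫ x, |G x|) / R ^ 2) := by
          rw [integral_const_mul, integral_add iA hG.abs, hvol]
          field_simp
      _ ≤ _ := by
          have h2 : 0 ≤ ∫ x, |G x| := integral_nonneg fun x => abs_nonneg _
          have h3 := div_le_self h2 (one_le_pow₀ (n := 2) hR1)
          exact mul_le_mul_of_nonneg_left (by linarith) (sq_nonneg C)
  linarith

theorem logWeight_eq_logKernel : logWeight = logKernel 1 := by
  ext x
  rw [logWeight, logKernel, add_comm]

theorem integrableOn_singularity_sq :
    IntegrableOn (fun x => singularity x ^ 2) (Metric.ball (0 : Plane) 1)ᶜ := by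
  have h := integrable_rpow_neg_one_add_norm_sq (E := Plane) (μ := volume) (r := 3)
    (by simp; norm_num)
  refine Integrable.mono' (h.const_mul (2 ^ (3 / 2 : ℝ))).integrableOn
    (measurable_singularity.pow_const 2).aestronglyMeasurable ?_
  filter_upwards [ae_restrict_mem Metric.isOpen_ball.measurableSet.compl] with x hx
  have h1 : 1 ≤ ‖x‖ := by simpa using hx
  have h0 : 0 < ‖x‖ := by linarith
  have h2 : 1 + ‖x‖ ^ 2 ≤ 2 * ‖x‖ ^ 2 := by nlinarith
  rw [Real.norm_of_nonneg (sq_nonneg _)]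
  have h3 : singularity x ^ 2 = 2 ^ (3 / 2 : ℝ) * (2 * ‖x‖ ^ 2) ^ (-3 / 2 : ℝ) := by
    rw [Real.mul_rpow (by norm_num) (by positivity), ← mul_assoc, ← Real.rpow_add (by norm_num),
      singularity, ← Real.rpow_natCast, ← Real.rpow_mul h0.le, ← Real.rpow_natCast,
      ← Real.rpow_mul h0.le]
    norm_num
  rw [h3]
  exact mul_le_mul_of_nonneg_left
    (Real.rpow_le_rpow_of_nonpos (by positivity) h2 (by norm_num)) (by positivity)

/-- Passing from `logWeight` to `log |x|` changes the gradient by `O(|x|^{-3/2})`, which is square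
integrable away from the origin. -/
theorem integrableOn_norm_gradient_remainder {u : Plane → ℝ} (hu : ContDiff ℝ 2 u) {α : ℝ}
    (h : Integrable fun x => ‖∇ (fun y => u y - α * logWeight y) x‖ ^ 2) :
    IntegrableOn (fun x => ‖∇ (remainder u α) x‖ ^ 2) (Metric.ball (0 : Plane) 1)ᶜ := by
  have hm : AEStronglyMeasurable (fun x => ‖∇ (remainder u α) x‖ ^ 2) := by
    have hmr : Measurable (fderiv ℝ (remainder u α)) := measurable_fderiv ℝ _
    exact ((((InnerProductSpace.toDual ℝ Plane).symm.continuous.measurable).comp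
      hmr).norm.pow_const 2).aestronglyMeasurable
  refine Integrable.mono' ((h.integrableOn.const_mul 2).add
    (integrableOn_singularity_sq.const_mul (2 * α ^ 2))) hm.restrict ?_
  filter_upwards [ae_restrict_mem Metric.isOpen_ball.measurableSet.compl] with x hx
  have h1 : 1 ≤ ‖x‖ := by simpa using hx
  have h0 : x ≠ 0 := norm_pos_iff.1 (by linarith)
  have du : DifferentiableAt ℝ u x := hu.differentiable (by norm_num) x
  have dl : ∀ a : ℝ, 0 ≤ a → HasFDerivAt (logKernel a) (innerSL ℝ (gradKernel a x)) x :=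
    fun a ha => hasFDerivAt_logKernel (by positivity)
  have hgr : ∀ a : ℝ, 0 ≤ a → ∇ (fun y => u y - α * logKernel a y) x = ∇ u x - α • gradKernel a x :=
    fun a ha => by
    rw [gradient_sub_apply du ((dl a ha).differentiableAt.const_mul α), ← gradient_logKernel
      (a := a) (by positivity)]
    congr 1
    rw [gradient_mul_apply (differentiableAt_const α) (dl a ha).differentiableAt]
    simp [gradient]
  have e1 : remainder u α = fun y => u y - α * logKernel 0 y := by
    ext y
    rw [remainder, logKernel_zero]
  have h2 := norm_gradKernel_sub_le one_pos x
  rw [one_pow, one_mul] at h2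
  simp only [Pi.add_apply]
  rw [logWeight_eq_logKernel, hgr 1 zero_le_one, Real.norm_of_nonneg (sq_nonneg _), e1,
    hgr 0 le_rfl]
  have e2 : ∇ u x - α • gradKernel 0 x =
      (∇ u x - α • gradKernel 1 x) - (-(α • (gradKernel 1 x - gradKernel 0 x))) := by module
  rw [e2]
  refine (norm_sub_sq_le_two_mul _ _).trans ?_
  rw [norm_neg, norm_smul, mul_pow, Real.norm_eq_abs, sq_abs]
  have h3 := mul_le_mul_of_nonneg_left (pow_le_pow_left₀ (norm_nonneg _) h2 2) (sq_nonneg α)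
  linarith

namespace IsPotentialSolution

variable {k g : Plane → ℝ} {α c : ℝ} (h : IsPotentialSolution k α c g)
include h

/-- The mass is exactly `2πα`, so the `logWeight x` terms of the spherical potential add up to `α
logWeight x`. -/
theorem sub_eq (x : Plane) :
    c + (2 * Real.pi)⁻¹ * logPotential 0 g x - α * logWeight x =
      c - (farPotential g x + nearPotential g x) := by
  rw [← h.source.integral_sphericalKernel_eq_add, h.source.integral_sphericalKernel_mul, h.mass]
  have := Real.pi_ne_zero
  field_simp
  ring

/-- For `w = u - α logWeight`, `w` is bounded up to the near potential, which lies in `L²`, and `w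
Δw` is integrable; the global energy bound then applies. -/
theorem integrableOn_norm_gradient_remainder (hα : 0 < α) (hk : ContDiff ℝ 1 k)
    (hk0 : ∀ x, 0 ≤ k x) (hi : Integrable fun x => k x * (1 + ‖x‖ ^ 2) ^ α) :
    IntegrableOn (fun x => ‖∇ (remainder (fun x => c + (2 * Real.pi)⁻¹ * logPotential 0 g x) α) x‖
      ^ 2) (Metric.ball (0 : Plane) 1)ᶜ := by
  have hu := h.contDiff hk
  set u : Plane → ℝ := fun x => c + (2 * Real.pi)⁻¹ * logPotential 0 g x with hudef
  refine _root_.integrableOn_norm_gradient_remainder hu ?_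
  have hωc : ContDiff ℝ 2 logWeight := logWeight_eq_logKernel ▸ contDiff_logKernel one_pos
  set w : Plane → ℝ := fun x => u x - α * logWeight x with hwdef
  have hw : ContDiff ℝ 2 w := hu.sub (contDiff_const.mul hωc)
  obtain ⟨C, hC⟩ := h.source.exists_abs_farPotential_le
  have hm : 0 < ∫ x, g x := by
    rw [h.mass]
    positivity
  have hN2 := h.source.integrable_nearPotential_sq h.nonneg hm
  have hwabs : ∀ x, |w x| ≤ |c| + C + nearPotential g x := fun x => by
    have h1 := nearPotential_nonneg h.nonneg x
    have h2 := hC x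
    have h3 : w x = c - (farPotential g x + nearPotential g x) := h.sub_eq x
    rw [abs_le] at h2 ⊢
    have h4 := neg_abs_le c
    have h5 := le_abs_self c
    constructor <;> linarith
  have hC0 : 0 ≤ C := (abs_nonneg _).trans (hC 0)
  have hlap : ∀ x, Laplacian.laplacian w x = g x - α * (2 / (‖x‖ ^ 2 + 1) ^ 2) := fun x => by
    have e1 : w = u + (-α) • logWeight := by
      ext y
      simp [hwdef, sub_eq_add_neg]
    have h3 : ContDiff ℝ 2 ((-α) • logWeight) :=
      show ContDiff ℝ 2 fun y => (-α) • logWeight y from hωc.const_smul _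
    rw [e1, ContDiffAt.laplacian_add hu.contDiffAt h3.contDiffAt,
      InnerProductSpace.laplacian_smul _ hωc.contDiffAt, h.laplacian_eq hk, logWeight_eq_logKernel,
      laplacian_logKernel one_pos]
    simp [sub_eq_add_neg]
  refine integrable_norm_gradient_sq hw ?_ (hN2.const_mul 2) (A := 2 * (|c| + C) ^ 2)
    fun x => ?_
  · refine Integrable.mono' ((hi.const_mul (1 + |c| * Real.exp (2 * |c|))).add
      (((integrable_two_div_sq.const_mul (|c| + C + 1)).add (hN2.const_mul 2)).const_mul α))
      (hw.continuous.mul (continuous_laplacian hw)).aestronglyMeasurable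
      (Eventually.of_forall fun x => ?_)
    rw [hlap, norm_mul, Real.norm_eq_abs]
    -- Since `g = e^{2w} k (1 + |x|²)^α`, it suffices that `|w| e^{2w}` be bounded. It is, because
    -- `w ≤ c` and `t e^{-2t} ≤ 1` for `t ≥ 0`.
    have hb : |w x| * g x ≤ (1 + |c| * Real.exp (2 * |c|)) * (k x * (1 + ‖x‖ ^ 2) ^ α) := by
      have e2 : g x = Real.exp (2 * w x) * (k x * (1 + ‖x‖ ^ 2) ^ α) := by
        rw [h.eq x, ← exp_two_mul_logWeight]
        have : 2 * (c + (2 * Real.pi)⁻¹ * logPotential 0 g x) = 2 * w x + 2 * (α * logWeight x) := by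
          simp only [hwdef, hudef]
          ring
        rw [this, Real.exp_add]
        ring
      rw [e2, ← mul_assoc]
      refine mul_le_mul_of_nonneg_right ?_ (mul_nonneg (hk0 x) (by positivity))
      rcases le_total 0 (w x) with h0 | h0
      · have h1 : w x ≤ |c| := by
          have := h.le x
          refine le_trans ?_ (le_abs_self c)
          simp only [hwdef, hudef]
          linarith
        rw [abs_of_nonneg h0]
        have := mul_le_mul h1 (Real.exp_le_exp.2 (by linarith : 2 * w x ≤ 2 * |c|))
          (Real.exp_pos _).le (abs_nonneg c)
        linarith
      · rw [abs_of_nonpos h0]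
        have h1 : -w x ≤ Real.exp (-(2 * w x)) := by linarith [Real.add_one_le_exp (-(2 * w x))]
        have h2 := mul_le_mul_of_nonneg_right h1 (Real.exp_pos (2 * w x)).le
        rw [← Real.exp_add, neg_add_cancel, Real.exp_zero] at h2
        have : 0 ≤ |c| * Real.exp (2 * |c|) := by positivity
        linarith
    have hq : |w x| * (2 / (‖x‖ ^ 2 + 1) ^ 2) ≤
        (|c| + C + 1) * (2 / (‖x‖ ^ 2 + 1) ^ 2) + 2 * nearPotential g x ^ 2 := by
      have h1 : 2 / (‖x‖ ^ 2 + 1) ^ 2 ≤ 2 := by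
        rw [div_le_iff₀ (by positivity)]
        nlinarith [sq_nonneg ‖x‖, sq_nonneg (‖x‖ ^ 2)]
      have h2 : 0 ≤ 2 / (‖x‖ ^ 2 + 1) ^ 2 := by positivity
      have h3 : |w x| ≤ |c| + C + 1 + nearPotential g x ^ 2 := by
        nlinarith [hwabs x, sq_nonneg (nearPotential g x - 1)]
      have h4 := mul_le_mul_of_nonneg_right h3 h2
      have h5 := mul_le_mul_of_nonneg_left h1 (sq_nonneg (nearPotential g x))
      linarith
    have h6 : ‖g x - α * (2 / (‖x‖ ^ 2 + 1) ^ 2)‖ ≤ g x + α * (2 / (‖x‖ ^ 2 + 1) ^ 2) := by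
      refine (norm_sub_le _ _).trans_eq ?_
      rw [Real.norm_of_nonneg (h.nonneg x), Real.norm_of_nonneg (by positivity)]
    have h7 := mul_le_mul_of_nonneg_left h6 (abs_nonneg (w x))
    have h8 := mul_le_mul_of_nonneg_left hq hα.le
    simp only [Pi.add_apply]
    linarith
  · have h1 := pow_le_pow_left₀ (abs_nonneg _) (hwabs x) 2
    rw [sq_abs] at h1
    nlinarith [sq_nonneg (|c| + C - nearPotential g x)]

end IsPotentialSolution

/-! ### Size of the near potential and asymptotics -/

/-- After scaling by `r`, the logarithm splits into the constant `-log r` and an integrable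
remainder. The bound is uniform in `x`, so it holds also off the centre of the disc. -/
theorem integral_ball_nearLog_le (x a : Plane) {r : ℝ} (hr : 0 < r) (hr1 : r ≤ 1) :
    IntegrableOn (fun y => nearLog (x - y)) (Metric.ball a r) ∧
    ∫ y in Metric.ball a r, nearLog (x - y) ≤
      r ^ 2 * (Real.pi * -Real.log r + singularityMass) := by
  set s : Plane → ℝ := (Metric.ball (0 : Plane) 1).indicator singularity with hs
  have is : Integrable s :=
    (integrable_indicator_iff Metric.isOpen_ball.measurableSet).2 (integrableOn_singularity 1)
  have s0 : ∀ z, 0 ≤ s z := Set.indicator_nonneg fun z _ => singularity_nonneg z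
  have is1 : Integrable fun z => s (r⁻¹ • z) := is.comp_smul (inv_ne_zero hr.ne')
  have is2 : Integrable fun y => s (r⁻¹ • (x - y)) := is1.comp_sub_left x
  have hlog : 0 ≤ -Real.log r := neg_nonneg.2 (Real.log_nonpos hr.le hr1)
  have hle : ∀ z, nearLog z ≤ -Real.log r + s (r⁻¹ • z) := fun z => by
    rcases lt_or_ge ‖z‖ (1 / 4) with h | h
    · rw [nearLog_eq h]
      have hz : ‖r⁻¹ • z‖ = ‖z‖ / r := by
        rw [norm_smul, norm_inv, Real.norm_of_nonneg hr.le, inv_mul_eq_div]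
      rcases lt_or_ge ‖z‖ r with h1 | h1
      · rw [hs, Set.indicator_of_mem (by rwa [mem_ball_zero_iff, hz, div_lt_one hr])]
        rcases eq_or_ne z 0 with rfl | h0
        · simp only [norm_zero, Real.log_zero, neg_zero]
          exact add_nonneg hlog (singularity_nonneg _)
        · have h2 := neg_log_norm_le_singularity (r⁻¹ • z)
          rw [hz, Real.log_div (norm_ne_zero_iff.2 h0) hr.ne'] at h2
          linarith
      · have := Real.log_le_log hr h1
        linarith [s0 (r⁻¹ • z)]
    · rw [nearLog_eq_zero h]
      exact add_nonneg hlog (s0 _)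
  have ic : IntegrableOn (fun _ : Plane => -Real.log r) (Metric.ball a r) :=
    integrableOn_const measure_ball_lt_top.ne
  have ib : IntegrableOn (fun y => -Real.log r + s (r⁻¹ • (x - y))) (Metric.ball a r) :=
    ic.add is2.integrableOn
  have i1 : IntegrableOn (fun y => nearLog (x - y)) (Metric.ball a r) :=
    Integrable.mono' ib
      (measurable_nearLog.comp (measurable_const.sub measurable_id)).aestronglyMeasurable
      (Eventually.of_forall fun y => by
        rw [Real.norm_of_nonneg (nearLog_nonneg _)]
        exact hle _)
  refine ⟨i1, (integral_mono i1 ib fun y => hle _).trans ?_⟩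
  have hsm : ∫ y, s (r⁻¹ • (x - y)) = r ^ 2 * singularityMass := by
    rw [integral_sub_left_eq_self (fun z => s (r⁻¹ • z)) volume x, Measure.integral_comp_smul,
      finrank_euclideanSpace_fin, hs, integral_indicator Metric.isOpen_ball.measurableSet,
      inv_pow, inv_inv, abs_of_nonneg (by positivity)]
    rfl
  have h3 : ∫ y in Metric.ball a r, s (r⁻¹ • (x - y)) ≤ r ^ 2 * singularityMass :=
    hsm ▸ setIntegral_le_integral is2 (Eventually.of_forall fun y => s0 _)
  rw [integral_add ic is2.integrableOn, setIntegral_const,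
    measureReal_def, EuclideanSpace.volume_ball_fin_two, ← ENNReal.ofReal_pow hr.le,
    ← ENNReal.ofReal_mul (by positivity), ENNReal.toReal_ofReal (by positivity), smul_eq_mul]
  linarith

theorem log_radius (q : ℝ) (n : ℕ) : -Real.log (radius q n) = (n : ℝ) ^ q := by
  rw [radius, Real.log_exp, neg_neg]

theorem center_add (m n : ℕ) : center m + center n = center (m + n) := by
  ext i
  fin_cases i <;> simp [center]

theorem tendsto_center : Tendsto center atTop (cocompact Plane) := by
  rw [← Metric.cobounded_eq_cocompact, ← tendsto_norm_atTop_iff_cobounded]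
  simp only [norm_center]
  exact tendsto_natCast_atTop_atTop

namespace IsPotentialSolution

section

variable {k g : Plane → ℝ} {α c : ℝ} (h : IsPotentialSolution k α c g)
include h

theorem le_exp_mul (hk0 : ∀ x, 0 ≤ k x) (x : Plane) :
    g x ≤ Real.exp (2 * c) * (1 + ‖x‖ ^ 2) ^ α * k x := by
  have h1 := Real.exp_le_exp.2 (mul_le_mul_of_nonneg_left (h.le x) zero_le_two)
  rw [mul_add 2 c (α * logWeight x), Real.exp_add, exp_two_mul_logWeight] at h1
  rw [h.eq x, mul_comm]
  exact mul_le_mul_of_nonneg_right h1 (hk0 x)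

/-- Reduces every asymptotic question about `u - α log |x|` to the behaviour of `nearPotential g` at
infinity. -/
theorem tendsto_remainder_add_nearPotential :
    ∃ e : ℝ, Tendsto (fun x => remainder (fun x => c + (2 * Real.pi)⁻¹ * logPotential 0 g x) α x +
      nearPotential g x) (cocompact Plane) (𝓝 e) := by
  have h1 := (tendsto_const_nhds (x := c)).sub h.source.tendsto_farPotential
  refine ⟨_, (h1.add (tendsto_logWeight_sub_log_norm.const_mul α)).congr fun x => ?_⟩
  have := h.sub_eq x
  simp only [remainder]
  linarith

end

section

variable {η : Plane → ℝ} {ℓ q α c : ℝ} {g : Plane → ℝ}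

/-- The near potential sees at most one bump. There `g` is at most of order `n^{2α-ℓ} r_n^{-2}`, the
area cancels `r_n^{-2}`, and `log (1/r_n) = n^q` gives the exponent. -/
theorem nearPotential_eq_zero_or_le (hη : IsRadialCutoff η) (hq : 1 < q) (hα : 0 < α)
    (h : IsPotentialSolution (fun x => -exoticCurvature η ℓ q x) α c g) :
    ∃ C : ℝ, 0 ≤ C ∧ ∀ x, nearPotential g x = 0 ∨ ∃ n : ℕ, 2 ≤ n ∧ ‖x - center n‖ ≤ 1 / 2 ∧
      nearPotential g x ≤ C * (n : ℝ) ^ (2 * α - ℓ + q) := by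
  have hk0 : ∀ x, 0 ≤ -exoticCurvature η ℓ q x := fun x =>
    neg_nonneg.2 (exoticCurvature_nonpos hη x)
  have hS := singularityMass_nonneg
  have hpi := Real.pi_pos
  set C := (2 * Real.pi)⁻¹ * (Real.exp (2 * c) * 4 ^ α * (Real.pi + singularityMass)) with hC
  refine ⟨C, by positivity, fun x => ?_⟩
  obtain ⟨n, hn, hb⟩ := exists_neg_exoticCurvature_le hη hq x (ℓ := ℓ)
  have hn2 : (2 : ℝ) ≤ n := by exact_mod_cast hn
  have hn0 : (0 : ℝ) < n := by linarith
  have hr := radius_pos q n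
  have hr4 := radius_le hq hn
  set A : ℝ := Real.exp (2 * c) * (4 ^ α * (n : ℝ) ^ (2 * α)) *
    ((radius q n ^ 2)⁻¹ * (n : ℝ) ^ (-ℓ)) with hA
  have hA0 : 0 ≤ A := by positivity
  have hg : ∀ y, g y * nearLog (x - y) ≤
      (Metric.ball (center n) (radius q n)).indicator (fun y => A * nearLog (x - y)) y := fun y => by
    rcases lt_or_ge ‖x - y‖ (1 / 4) with h1 | h1
    · have hb' := hb y (mem_ball_iff_norm'.2 h1)
      have hle := h.le_exp_mul hk0 y
      by_cases h2 : y ∈ Metric.ball (center n) (radius q n)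
      · rw [Set.indicator_of_mem h2] at hb' ⊢
        refine mul_le_mul_of_nonneg_right (hle.trans ?_) (nearLog_nonneg _)
        rw [hA]
        refine mul_le_mul (mul_le_mul_of_nonneg_left ?_ (Real.exp_pos _).le) hb' (hk0 y)
          (by positivity)
        rw [mem_ball_iff_norm] at h2
        have h3 : ‖y‖ ≤ n + 1 := by
          have := norm_le_norm_add_norm_sub' y (center n)
          rw [norm_center] at this
          linarith
        have h4 : 1 + ‖y‖ ^ 2 ≤ 4 * (n : ℝ) ^ 2 := by nlinarith [norm_nonneg y]
        refine (Real.rpow_le_rpow (by positivity) h4 hα.le).trans_eq ?_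
        rw [Real.mul_rpow (by norm_num) (by positivity), ← Real.rpow_natCast,
          ← Real.rpow_mul hn0.le]
        norm_num
      · rw [Set.indicator_of_notMem h2] at hb' ⊢
        have h5 : -exoticCurvature η ℓ q y = 0 := le_antisymm hb' (hk0 y)
        rw [h.eq y, h5]
        simp
    · rw [nearLog_eq_zero h1, mul_zero]
      refine Set.indicator_nonneg (fun y _ => mul_nonneg hA0 (nearLog_nonneg _)) y
  -- The threshold is the range `1/4` of `nearLog` plus the largest radius `1/4` of a bump.
  by_cases hx : ‖x - center n‖ ≤ 1 / 2
  · refine Or.inr ⟨n, hn, hx, ?_⟩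
    obtain ⟨i1, i2⟩ := integral_ball_nearLog_le x (center n) hr (by linarith)
    have h1 : ∫ y, g y * nearLog (x - y) ≤
        A * (radius q n ^ 2 * (Real.pi * -Real.log (radius q n) + singularityMass)) := by
      refine (integral_mono (h.source.integrable_mul_nearLog x)
        ((integrable_indicator_iff Metric.isOpen_ball.measurableSet).2 (i1.const_mul A)) hg).trans ?_
      rw [integral_indicator Metric.isOpen_ball.measurableSet, integral_const_mul]
      exact mul_le_mul_of_nonneg_left i2 hA0
    have hnq : 1 ≤ (n : ℝ) ^ q := Real.one_le_rpow (by linarith) (by linarith)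
    have h2 : A * (radius q n ^ 2 * (Real.pi * -Real.log (radius q n) + singularityMass)) ≤
        Real.exp (2 * c) * 4 ^ α * (Real.pi + singularityMass) * (n : ℝ) ^ (2 * α - ℓ + q) := by
      rw [log_radius, Real.rpow_add hn0, sub_eq_add_neg, Real.rpow_add hn0]
      have e1 : A * (radius q n ^ 2 * (Real.pi * (n : ℝ) ^ q + singularityMass)) =
          Real.exp (2 * c) * 4 ^ α * ((n : ℝ) ^ (2 * α) * (n : ℝ) ^ (-ℓ)) *
            (Real.pi * (n : ℝ) ^ q + singularityMass) := by
        rw [hA]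
        field_simp
      rw [e1]
      have h3 : Real.pi * (n : ℝ) ^ q + singularityMass ≤
          (Real.pi + singularityMass) * (n : ℝ) ^ q := by nlinarith
      refine (mul_le_mul_of_nonneg_left h3 (by positivity)).trans_eq ?_
      ring
    rw [nearPotential, hC, mul_assoc]
    exact mul_le_mul_of_nonneg_left (h1.trans h2) (by positivity)
  · refine Or.inl ?_
    have h1 : ∀ y, g y * nearLog (x - y) = 0 := fun y => by
      refine le_antisymm ?_ (mul_nonneg (h.nonneg y) (nearLog_nonneg _))
      by_cases h2 : y ∈ Metric.ball (center n) (radius q n)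
      · rw [nearLog_eq_zero, mul_zero]
        rw [mem_ball_iff_norm] at h2
        by_contra h3
        have := norm_add_le (x - y) (y - center n)
        rw [sub_add_sub_cancel] at this
        exact hx (by linarith)
      · have := hg y
        rwa [Set.indicator_of_notMem h2] at this
    simp [nearPotential, h1]

/-- On the half disc `η = 1` and `-log |a_n - y| ≥ n^q`. The assumed growth bounds `e^{2u}` below by
a multiple of `|y|^{2α}`, which the general upper bound on `u` cannot provide. -/
theorem le_nearPotential_center (hη : IsRadialCutoff η) (hq : 1 < q) (hα : 0 < α)
    (h : IsPotentialSolution (fun x => -exoticCurvature η ℓ q x) α c g)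
    (hlog : HasLogGrowth (fun x => c + (2 * Real.pi)⁻¹ * logPotential 0 g x) α) :
    ∃ C : ℝ, 0 < C ∧ ∀ᶠ n : ℕ in atTop,
      C * (n : ℝ) ^ (2 * α - ℓ + q) ≤ nearPotential g (center n) := by
  obtain ⟨B, hB⟩ := hlog.bound
  rw [← Metric.cobounded_eq_cocompact, ← comap_norm_atTop, eventually_comap,
    eventually_atTop] at hB
  obtain ⟨R, hR⟩ := hB
  have hpi := Real.pi_pos
  -- `π / 4` comes from the area of the disc of radius `r_n / 2`, `e^{-2B}` from the remainder
  -- bound, and `2^{-2α}` from `|y| ≥ n / 2`.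
  refine ⟨(2 * Real.pi)⁻¹ * (Real.pi / 4 * (Real.exp (-(2 * B)) * 2⁻¹ ^ (2 * α))), by positivity, ?_⟩
  filter_upwards [eventually_ge_atTop 2, tendsto_natCast_atTop_atTop.eventually_ge_atTop (R + 1)]
    with n hn hnR
  have hn2 : (2 : ℝ) ≤ n := by exact_mod_cast hn
  have hn0 : (0 : ℝ) < n := by linarith
  have hr := radius_pos q n
  have hr4 := radius_le hq hn
  set b := Metric.ball (center n) (radius q n / 2) with hb
  set A : ℝ := (radius q n ^ 2)⁻¹ * (n : ℝ) ^ (-ℓ) *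
    (Real.exp (-(2 * B)) * (2⁻¹ ^ (2 * α) * (n : ℝ) ^ (2 * α))) * (n : ℝ) ^ q with hA
  -- The centre is excluded because `Real.log 0 = 0` makes `nearLog` vanish there.
  have hle : ∀ᵐ y ∂volume, b.indicator (fun _ => A) y ≤ g y * nearLog (center n - y) := by
    filter_upwards [Measure.ae_ne volume (center n)] with y hne
    by_cases hy : y ∈ b
    · rw [Set.indicator_of_mem hy]
      rw [hb, mem_ball_iff_norm] at hy
      have hy' : ‖center n - y‖ < radius q n / 2 := by rwa [norm_sub_rev]
      have hpos : 0 < ‖center n - y‖ := norm_pos_iff.2 (sub_ne_zero.2 hne.symm)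
      have hyn : (n : ℝ) / 2 ≤ ‖y‖ ∧ R ≤ ‖y‖ := by
        have := norm_sub_norm_le (center n) y
        rw [norm_center] at this
        constructor <;> linarith
      have hlow := (abs_le.1 (hR _ hyn.2 y rfl |>.trans_eq' (Real.norm_eq_abs _) |>.trans
        (by simp : B * ‖(1 : ℝ)‖ ≤ B))).1
      refine mul_le_mul ?_ ?_ (by positivity) (h.nonneg y)
      · rw [h.eq y]
        refine mul_le_mul ?_ ?_ (by positivity) (neg_nonneg.2 (exoticCurvature_nonpos hη y))
        · rw [← curvatureTerm_eq hη hy]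
          exact curvatureTerm_le_neg_exoticCurvature hη hq hn y
        · have hy0 : 0 < ‖y‖ := by linarith [hyn.1]
          have e1 : Real.exp (-(2 * B)) * ‖y‖ ^ (2 * α) =
              Real.exp (2 * (-B + α * Real.log ‖y‖)) := by
            rw [Real.rpow_def_of_pos hy0, ← Real.exp_add]
            congr 1
            ring
          rw [← Real.mul_rpow (by norm_num) hn0.le]
          refine (mul_le_mul_of_nonneg_left (Real.rpow_le_rpow (by positivity)
            (by linarith [hyn.1] : 2⁻¹ * (n : ℝ) ≤ ‖y‖) (by linarith))
            (Real.exp_pos _).le).trans ?_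
          rw [e1]
          refine Real.exp_le_exp.2 ?_
          simp only [remainder] at hlow
          linarith
      · rw [nearLog_eq (by linarith), ← log_radius]
        exact neg_le_neg (Real.log_le_log hpos (by linarith))
    · rw [Set.indicator_of_notMem hy]
      exact mul_nonneg (h.nonneg y) (nearLog_nonneg _)
  have hint : ∫ y, b.indicator (fun _ => A) y = Real.pi / 4 * radius q n ^ 2 * A := by
    rw [integral_indicator Metric.isOpen_ball.measurableSet, setIntegral_const,
      measureReal_def, EuclideanSpace.volume_ball_fin_two, ← ENNReal.ofReal_pow (by positivity),
      ← ENNReal.ofReal_mul (by positivity), ENNReal.toReal_ofReal (by positivity), smul_eq_mul]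
    ring
  have h1 := integral_mono_ae ((integrable_indicator_iff Metric.isOpen_ball.measurableSet).2
    (integrableOn_const measure_ball_lt_top.ne)) (h.source.integrable_mul_nearLog (center n)) hle
  rw [hint] at h1
  have e2 : Real.pi / 4 * radius q n ^ 2 * A =
      Real.pi / 4 * (Real.exp (-(2 * B)) * 2⁻¹ ^ (2 * α)) * (n : ℝ) ^ (2 * α - ℓ + q) := by
    rw [hA, Real.rpow_add hn0, sub_eq_add_neg, Real.rpow_add hn0]
    field_simp
  rw [e2] at h1
  rw [nearPotential, mul_assoc]
  exact mul_le_mul_of_nonneg_left h1 (by positivity)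

theorem hasUniformLogGrowth (hη : IsRadialCutoff η) (hq : 1 < q) (hα : 0 < α)
    (h : IsPotentialSolution (fun x => -exoticCurvature η ℓ q x) α c g)
    (hlt : α < (ℓ - q) / 2) :
    HasUniformLogGrowth (fun x => c + (2 * Real.pi)⁻¹ * logPotential 0 g x) α := by
  obtain ⟨C, hC, hb⟩ := h.nearPotential_eq_zero_or_le hη hq hα
  have hn : Tendsto (fun x : Plane => ‖x‖) (cocompact Plane) atTop := tendsto_norm_cocompact_atTop
  have hN : Tendsto (nearPotential g) (cocompact Plane) (𝓝 0) := by
    have h1 : Tendsto (fun x : Plane => C * (‖x‖ + -1) ^ (-(ℓ - q - 2 * α))) (cocompact Plane)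
        (𝓝 0) := by
      simpa using ((tendsto_rpow_neg_atTop (by linarith : 0 < ℓ - q - 2 * α)).comp
        (tendsto_atTop_add_const_right _ (-1) hn)).const_mul C
    refine squeeze_zero' (Eventually.of_forall (nearPotential_nonneg h.nonneg)) ?_ h1
    filter_upwards [hn.eventually_gt_atTop 1] with x hx
    have hx1 : 0 < ‖x‖ + -1 := by linarith
    rcases hb x with h0 | ⟨n, -, hxn, hle⟩
    · rw [h0]
      positivity
    · refine hle.trans (mul_le_mul_of_nonneg_left ?_ hC)
      have h2 : ‖x‖ + -1 ≤ n := by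
        have := norm_le_norm_add_norm_sub' x (center n)
        rw [norm_center] at this
        linarith
      have e1 : 2 * α - ℓ + q = -(ℓ - q - 2 * α) := by ring
      rw [e1]
      exact Real.rpow_le_rpow_of_nonpos hx1 h2 (by linarith)
  obtain ⟨e, he⟩ := h.tendsto_remainder_add_nearPotential
  refine ⟨e - 0, (he.sub hN).congr fun x => ?_⟩
  ring

/-- At the critical value the exponent is `0`, so the near potential is bounded. It has no limit: it
vanishes at `-a_n`, far from every bump, and is bounded below at `a_n`. -/
theorem hasLogGrowth_and_not_hasUniformLogGrowth (hη : IsRadialCutoff η) (hq : 1 < q) (hα : 0 < α)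
    (h : IsPotentialSolution (fun x => -exoticCurvature η ℓ q x) α c g)
    (heq : α = (ℓ - q) / 2) :
    HasLogGrowth (fun x => c + (2 * Real.pi)⁻¹ * logPotential 0 g x) α ∧
      ¬ HasUniformLogGrowth (fun x => c + (2 * Real.pi)⁻¹ * logPotential 0 g x) α := by
  obtain ⟨C, hC, hb⟩ := h.nearPotential_eq_zero_or_le hη hq hα
  have e0 : 2 * α - ℓ + q = 0 := by rw [heq]; ring
  simp only [e0, Real.rpow_zero, mul_one] at hb
  obtain ⟨e, he⟩ := h.tendsto_remainder_add_nearPotential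
  have hN : nearPotential g =O[cocompact Plane] fun _ => (1 : ℝ) := by
    refine IsBigO.of_bound C (Eventually.of_forall fun x => ?_)
    rw [Real.norm_of_nonneg (nearPotential_nonneg h.nonneg x), norm_one, mul_one]
    rcases hb x with h0 | ⟨n, -, -, hle⟩
    · rw [h0]
      exact hC
    · exact hle
  have hlog : HasLogGrowth (fun x => c + (2 * Real.pi)⁻¹ * logPotential 0 g x) α :=
    ((he.isBigO_one ℝ).sub hN).congr_left fun x => by ring
  refine ⟨hlog, fun ⟨e', he'⟩ => ?_⟩
  have hlim : Tendsto (nearPotential g) (cocompact Plane) (𝓝 (e - e')) :=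
    (he.sub he').congr fun x => by ring
  have hneg : Tendsto (fun n => -center n) atTop (cocompact Plane) := by
    rw [← Metric.cobounded_eq_cocompact, ← tendsto_norm_atTop_iff_cobounded]
    simp only [norm_neg, norm_center]
    exact tendsto_natCast_atTop_atTop
  have hzero : ∀ n, nearPotential g (-center n) = 0 := fun n => by
    rcases hb (-center n) with h0 | ⟨m, hm, hxm, -⟩
    · exact h0
    · have e1 : -center n - center m = -(center (n + m)) := by
        rw [← center_add]
        abel
      rw [e1, norm_neg, norm_center] at hxm
      have h2 : (2 : ℝ) ≤ (n + m : ℕ) := by exact_mod_cast (by omega : 2 ≤ n + m)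
      linarith
  have h0 : e - e' = 0 := by
    refine tendsto_nhds_unique (hlim.comp hneg) ?_
    exact tendsto_const_nhds.congr fun n => (hzero n).symm
  obtain ⟨C', hC', hev⟩ := h.le_nearPotential_center hη hq hα hlog
  simp only [e0, Real.rpow_zero, mul_one] at hev
  have := ge_of_tendsto (hlim.comp tendsto_center) hev
  linarith

/-- By contradiction: logarithmic growth bounds the near potential, yet it also activates the lower
bound at `a_n`, whose exponent is now positive. -/
theorem not_hasLogGrowth (hη : IsRadialCutoff η) (hq : 1 < q) (hα : 0 < α)
    (h : IsPotentialSolution (fun x => -exoticCurvature η ℓ q x) α c g)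
    (hgt : (ℓ - q) / 2 < α) :
    ¬ HasLogGrowth (fun x => c + (2 * Real.pi)⁻¹ * logPotential 0 g x) α := by
  intro hlog
  obtain ⟨e, he⟩ := h.tendsto_remainder_add_nearPotential
  have hN : nearPotential g =O[cocompact Plane] fun _ => (1 : ℝ) :=
    ((he.isBigO_one ℝ).sub hlog).congr_left fun x => by ring
  obtain ⟨B, hB⟩ := hN.bound
  obtain ⟨C', hC', hev⟩ := h.le_nearPotential_center hη hq hα hlog
  have hinf : Tendsto (fun n : ℕ => C' * (n : ℝ) ^ (2 * α - ℓ + q)) atTop atTop :=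
    ((tendsto_rpow_atTop (by linarith)).comp tendsto_natCast_atTop_atTop).const_mul_atTop hC'
  obtain ⟨n, h1, h2, h3⟩ := (hev.and ((tendsto_center.eventually hB).and
    (hinf.eventually_gt_atTop B))).exists
  rw [Real.norm_of_nonneg (nearPotential_nonneg h.nonneg _), norm_one, mul_one] at h2
  linarith

end

end IsPotentialSolution

/-! ### The Cheng–Lin solution in potential form -/

theorem exists_isPotentialSolution_exoticCurvature {η : Plane → ℝ} (hη : IsRadialCutoff η)
    {ℓ q α : ℝ} (hq : 1 < q) (hα : 0 < α) (hlt : α < (ℓ - 1) / 2) :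
    ∃ (c : ℝ) (g : Plane → ℝ),
      IsPotentialSolution (fun x => -exoticCurvature η ℓ q x) α c g ∧
      IsChengLinSolution (exoticCurvature η ℓ q) α
        fun x => c + (2 * Real.pi)⁻¹ * logPotential 0 g x := by
  have hk : ContDiff ℝ 1 fun x => -exoticCurvature η ℓ q x :=
    ((contDiff_exoticCurvature hη hq).of_le (by exact_mod_cast le_top)).neg
  have hk0 : ∀ x, 0 ≤ -exoticCurvature η ℓ q x := fun x =>
    neg_nonneg.2 (exoticCurvature_nonpos hη x)
  have i1 := integrable_exoticCurvature_mul hη hq hα.le (by linarith : 2 * α - ℓ < -1)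
  have i2 : Integrable fun x => logWeight x * (-exoticCurvature η ℓ q x * (1 + ‖x‖ ^ 2) ^ α) := by
    -- Half the gap to the critical exponent: the logarithmic weight is absorbed into `(1 +
    -- |x|²)^ε`, and `α + ε` is still admissible.
    set ε := ((ℓ - 1) / 2 - α) / 2 with hε
    have hε0 : 0 < ε := by linarith
    have i3 := integrable_exoticCurvature_mul hη hq (by linarith : 0 ≤ α + ε)
      (by linarith : 2 * (α + ε) - ℓ < -1)
    refine (i3.const_mul (1 / ε)).mono'
      (continuous_logWeight.aestronglyMeasurable.mul i1.aestronglyMeasurable)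
      (Eventually.of_forall fun x => ?_)
    have h0 : 0 ≤ -exoticCurvature η ℓ q x * (1 + ‖x‖ ^ 2) ^ α := mul_nonneg (hk0 x) (by positivity)
    rw [Real.norm_of_nonneg (mul_nonneg (logWeight_nonneg x) h0), Real.rpow_add (by positivity)]
    have h1 : logWeight x ≤ 1 / ε * (1 + ‖x‖ ^ 2) ^ ε := by
      have h2 := Real.log_le_rpow_div (by positivity : 0 ≤ 1 + ‖x‖ ^ 2) hε0
      have h3 := logWeight_nonneg x
      unfold logWeight at h3 ⊢
      rw [one_div_mul_eq_div]
      linarith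
    have := mul_le_mul_of_nonneg_right h1 h0
    linarith
  obtain ⟨c, g, h⟩ := exists_isPotentialSolution hk.continuous hk0
    (neg_pos.2 (exoticCurvature_center_neg hη hq le_rfl (ℓ := ℓ))) hα i1 i2
  have heq : (fun x => exoticCurvature η ℓ q x *
      Real.exp (2 * (c + (2 * Real.pi)⁻¹ * logPotential 0 g x))) = fun x => -g x := by
    ext x
    rw [h.eq x]
    ring
  refine ⟨c, g, h, ?_, ?_, ?_, ?_⟩
  · simpa using h.isCurvatureSolution hk
  · rw [heq]
    exact h.source.integrable.neg
  · rw [heq, integral_neg, h.mass]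
    ring
  · exact h.integrableOn_norm_gradient_remainder hα hk hk0 i1

end

theorem theorem1p2 (ℓ q : ℝ) (hq : 1 < q) (hℓ : q < ℓ)
    (η₀ : Plane → ℝ) (hη₀ : IsRadialCutoff η₀) :
    (∀ α : ℝ, 0 < α → α < (ℓ - 1) / 2 →
      ∃! u : Plane → ℝ, IsChengLinSolution (exoticCurvature η₀ ℓ q) α u) ∧
    (∀ α : ℝ, 0 < α → α < (ℓ - q) / 2 → ∀ u : Plane → ℝ,
      IsChengLinSolution (exoticCurvature η₀ ℓ q) α u → HasUniformLogGrowth u α) ∧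
    (∀ u : Plane → ℝ, IsChengLinSolution (exoticCurvature η₀ ℓ q) ((ℓ - q) / 2) u →
      HasLogGrowth u ((ℓ - q) / 2) ∧ ¬ HasUniformLogGrowth u ((ℓ - q) / 2)) ∧
    (∀ α : ℝ, (ℓ - q) / 2 < α → α < (ℓ - 1) / 2 → ∀ u : Plane → ℝ,
      IsChengLinSolution (exoticCurvature η₀ ℓ q) α u → ¬ HasLogGrowth u α) := by
  -- Uniqueness carries the asymptotics of the constructed solution over to an arbitrary Cheng–Lin
  -- solution.
  have huniq : ∀ {α : ℝ} {u v : Plane → ℝ}, IsChengLinSolution (exoticCurvature η₀ ℓ q) α u →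
      IsChengLinSolution (exoticCurvature η₀ ℓ q) α v → u = v := fun hu hv =>
    IsChengLinSolution.unique (exoticCurvature_nonpos hη₀)
      (exoticCurvature_center_neg hη₀ hq le_rfl) hu hv
  refine ⟨fun α h0 h1 => ?_, fun α h0 h1 u hu => ?_, fun u hu => ?_, fun α h0 h1 u hu => ?_⟩
  · obtain ⟨c, g, -, hv⟩ := exists_isPotentialSolution_exoticCurvature hη₀ hq h0 h1
    exact ⟨_, hv, fun u hu => huniq hu hv⟩
  · obtain ⟨c, g, h, hv⟩ := exists_isPotentialSolution_exoticCurvature hη₀ hq h0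
      (by linarith : α < (ℓ - 1) / 2)
    rw [huniq hu hv]
    exact h.hasUniformLogGrowth hη₀ hq h0 h1
  · have h0 : 0 < (ℓ - q) / 2 := by linarith
    obtain ⟨c, g, h, hv⟩ := exists_isPotentialSolution_exoticCurvature hη₀ hq h0
      (by linarith : (ℓ - q) / 2 < (ℓ - 1) / 2)
    rw [huniq hu hv]
    exact h.hasLogGrowth_and_not_hasUniformLogGrowth hη₀ hq h0 rfl
  · have h2 : 0 < α := by linarith
    obtain ⟨c, g, h, hv⟩ := exists_isPotentialSolution_exoticCurvature hη₀ hq h2 h1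
    rw [huniq hu hv]
    exact h.not_hasLogGrowth hη₀ hq h2 h0
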